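/- **Setting.** Let $A$ be a unital $C^*$-algebra, $G$ a discrete group and $(\rho,\sigma)$ a twisting pair: maps $\rho\colon G\to\mathrm{Aut}(A)$, $\sigma\colon G\times G\to U(A)$ with $\rho_x(\sigma_{y,z})=\sigma_{x,y}\sigma_{xy,z}\sigma_{x,yz}^*$, $\rho_x\rho_y=\mathrm{Ad}(\sigma_{x,y})\rho_{xy}$, $\sigma_{x,e}=\sigma_{e,x}=1$, $\rho_e=\mathrm{id}$. A spectral triple $(\mathcal A,H,D)$ on $A$ consists of a dense unital $*$-subalgebra $\mathcal A\subseteq A$, a unital representation $\pi\colon A\to\mathbb B(H)$ and a self-adjoint operator $D$ such that $(1+D^2)^{-1/2}$ is compact and, for all $a\in\mathcal A$, $\pi(a)$ preserves $\mathrm{Dom}\,D$ and $[D,\pi(a)]$ is bounded. It is *regular* if $\pi(\mathcal A)$ and $[D,\pi(\mathcal A)]$ lie in $\bigcap_k\mathrm{Dom}(\delta^k)$, where $\delta=[|D|,\cdot\,]$ is defined on the $T\in\mathbb B(H)$ that preserve $\mathrm{Dom}|D|$ and have bounded $[|D|,T]$. With $\Delta=1+D^2$ and $W^\infty=\bigcap_n\mathrm{Dom}(\Delta^n)$,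 a linear map $P\colon W^\infty\to W^\infty$ is in $\mathrm{Op}^t(\Delta)$ if for every $s\in\mathbb R$ it is bounded from the norm $\|\Delta^{(s+t)/2}\xi\|$ to the norm $\|\Delta^{s/2}\xi\|$; a bounded operator on $H$ is said to be in $\mathrm{Op}^t(\Delta)$ if it preserves $W^\infty$ and its restriction is. Let $(\mathcal A,H,D,\pi,U)$ be a $G$-equivariant odd spectral triple on $A$ with $\pi$ faithful: $\rho_x(\mathcal A)=\mathcal A$ and $\sigma_{x,y}\in\mathcal A$ for all $x,y$; $U\colon G\to U(H)$ satisfies $U_xU_y=\pi(\sigma_{x,y})U_{xy}$ and $\pi\circ\rho_x=\mathrm{Ad}(U_x)\circ\pi$; and each $U_g$ preserves $\mathrm{Dom}\,D$ with $[D,U_g]$ bounded. Let $V$ be a finite-dimensional Hilbert space and $\ell\colon G\to\mathbb B(V)$ a self-adjoint valued function which is translation bounded ($\sup_x\|\ell(x)-\ell(y^{-1}x)\|<\infty$ for each $y$) and proper ($\ell(g)=0$ iff $g=e$; $\mathcal S=\bigcup_x\mathrm{Sp}\,\ell(x)$ has no accumulation point in $\mathbb R$; each $t\in\mathcal S$ lies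 in $\mathrm{Sp}\,\ell(x)$ for only finitely many $x$). Let $\mathcal B=\{\sum_g\pi(a_g)U_g : a_g\in\mathcal A,\ \text{finite sums}\}$, acting on $H$, with norm closure $B$. Let $C_c(G)$ act on $\ell^2(G)\otimes V$ by left translations $\lambda_g$, and let $M_\ell(\delta_x\otimes v)=\delta_x\otimes\ell(x)v$ (self-adjoint closure). Let $A\rtimes_r^{\rho,\sigma}G$ be the $C^*$-algebra generated on $\ell^2(G,H)$ by the operators $\Pi(a\delta_x)(\xi\otimes\delta_y)=\pi(\rho_{y^{-1}x^{-1}}(a)\sigma_{y^{-1}x^{-1},x})\xi\otimes\delta_{xy}$. The equivariant construction is the triple $(C_c(G,\mathcal A),\widetilde H,\widetilde D)$ on $A\rtimes_r^{\rho,\sigma}G$ with $\widetilde H=(H\otimes\ell^2(G)\otimes V)^{\oplus2}$, the representation given by two copies of $a\delta_h\mapsto\pi(a)U_h\otimes\lambda_h\otimes1_V$ and $\widetilde D$ the closure of $$\begin{pmatrix}0&D\otimes1-i\,1\otimes M_\ell\\ D\otimes1+i\,1\otimes M_\ell&0\end{pmatrix}.$$ **Theorem.** 1. If $(\mathcal B,H,D)$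 and $(C_c(G),\ell^2(G)\otimes V,M_\ell)$ are regular, then the representation of $C_c(G,A)$ above extends to $A\rtimes_r^{\rho,\sigma}G$, and $(C_c(G,\mathcal A),\widetilde H,\widetilde D)$ is a regular spectral triple on $A\rtimes_r^{\rho,\sigma}G$. 2. Suppose that $(\mathcal A,H,D)$ is regular and that for every $g\in G$: $U_g\in\mathrm{Op}^0(\Delta)$, $[D,U_g]\in\mathrm{Op}^0(\Delta)$, and for every integer $k\ge0$ the $k$-fold commutators $[\Delta,[\Delta,\dots[\Delta,U_g]\dots]]$ and $[\Delta,[\Delta,\dots[\Delta,[D,U_g]]\dots]]$ are in $\mathrm{Op}^k(\Delta)$. Then $(\mathcal B,H,D)$ is a regular spectral triple on $B$. 3. Conversely, if $(\mathcal B,H,D)$ is regular, then $(\mathcal A,H,D)$ is regular and, for every $g\in G$ and every integer $k\ge0$, $U_g$ and $[D,U_g]$ satisfy all the conditions listed in 2. -/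

import Mathlib

open scoped TensorProduct

noncomputable section

namespace TwistedTriple

/-! ### Unbounded operators: commutators and functional calculus -/

section Operators

variable {H : Type*} [NormedAddCommGroup H] [InnerProductSpace ℂ H]

/-- `T` leaves the domain of the (unbounded) operator `S` invariant and the commutator
`[S, T] = S T - T S`, defined on that domain, extends to the bounded operator `C`. -/
def IsBoundedCommutator (S : H →ₗ.[ℂ] H) (T C : H →L[ℂ] H) : Prop :=
  ∀ x : S.domain, ∃ hx : T x ∈ S.domain, S ⟨T x, hx⟩ - T (S x) = C x

/-- `T ∈ Dom(δ^k)` for the derivation `δ = [S, ·]`. -/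
def InDomDerivation (S : H →ₗ.[ℂ] H) : ℕ → (H →L[ℂ] H) → Prop
  | 0, _ => True
  | k + 1, T => ∃ C : H →L[ℂ] H, IsBoundedCommutator S T C ∧ InDomDerivation S k C

/-- `T ∈ Dom^∞(δ) = ⋂ₖ Dom(δ^k)` for the derivation `δ = [S, ·]`. -/
def InDomInfty (S : H →ₗ.[ℂ] H) (T : H →L[ℂ] H) : Prop :=
  ∀ k : ℕ, InDomDerivation S k T

/-- The eigenspace `{x ∈ Dom D | D x = t x}` of an unbounded operator. -/
def eigenspace (D : H →ₗ.[ℂ] H) (t : ℝ) : Submodule ℂ H :=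
  (LinearMap.ker (D.toFun - (t : ℂ) • D.domain.subtype)).map D.domain.subtype

variable [CompleteSpace H]

/-- The spectral projection of `D` at the point `t`: the orthogonal projection onto the eigenspace
(which is closed as soon as `D` is). -/
def spectralProj (D : H →ₗ.[ℂ] H) (t : ℝ) : H →L[ℂ] H :=
  (eigenspace D t).topologicalClosure.starProjection

/-- The operator `f(D)` for a self-adjoint `D` with compact resolvent. Such a `D` is diagonal, that
is `H` is the Hilbert sum of the eigenspaces of `D`, so that
`f(D) x = ∑ₜ f(t) Pₜ x` on the domain of all `x` for which this orthogonal series converges. -/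
def funcCalc (D : H →ₗ.[ℂ] H) (f : ℝ → ℝ) : H →ₗ.[ℂ] H where
  domain :=
    { carrier := {x | Summable fun t : ℝ => (f t : ℂ) • spectralProj D t x}
      zero_mem' := by simp
      add_mem' := by
        intro x y hx hy
        simpa using Summable.add hx hy
      smul_mem' := by
        intro c x hx
        have h := Summable.const_smul c hx
        simpa [smul_comm c] using h }
  toFun :=
    { toFun := fun x => ∑' t : ℝ, (f t : ℂ) • spectralProj D t x
      map_add' := by
        intro x y
        rw [← Summable.tsum_add x.2 y.2]
        simp
      map_smul' := by
        intro c x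
        rw [RingHom.id_apply, ← Summable.tsum_const_smul c x.2]
        simp [smul_comm c] }

/-- The absolute value `|D|`. -/
def absOp (D : H →ₗ.[ℂ] H) : H →ₗ.[ℂ] H :=
  funcCalc D fun t => |t|

/-- The power `Δ^{s/2} = (1 + D²)^{s/2}`, for real `s`. -/
def laplacePow (D : H →ₗ.[ℂ] H) (s : ℝ) : H →ₗ.[ℂ] H :=
  funcCalc D fun t => (1 + t ^ 2) ^ (s / 2)

end Operators

/-! ### Spectral triples and regularity -/

section Triples

variable {H : Type*} [NormedAddCommGroup H] [InnerProductSpace ℂ H] [CompleteSpace H]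

/-- `(1 + D²)^{-1/2}` is compact: there is a compact positive operator `T` with
`T² = (1 + D²)⁻¹`. -/
def HasCompactResolvent (D : H →ₗ.[ℂ] H) : Prop :=
  ∃ T : H →L[ℂ] H, T.IsPositive ∧ IsCompactOperator T ∧
    ∀ x : H, ∃ (h₁ : T (T x) ∈ D.domain) (h₂ : D ⟨T (T x), h₁⟩ ∈ D.domain),
      T (T x) + D ⟨D ⟨T (T x), h₁⟩, h₂⟩ = x

/-- `(𝒜, H, D, π)` is a spectral triple (no grading being fixed) on the unital C⋆-algebra `A`. -/
structure IsSpectralTriple {A : Type*} [CStarAlgebra A] (𝒜 : Set A)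
    (π : A →⋆ₐ[ℂ] (H →L[ℂ] H)) (D : H →ₗ.[ℂ] H) : Prop where
  isStarSubalgebra : ∃ S : StarSubalgebra ℂ A, (S : Set A) = 𝒜
  dense : Dense 𝒜
  denseDomain : Dense (D.domain : Set H)
  selfAdjoint : IsSelfAdjoint D
  compactResolvent : HasCompactResolvent D
  boundedCommutator : ∀ a ∈ 𝒜, ∃ C : H →L[ℂ] H, IsBoundedCommutator D (π a) C

/-- Regularity of a spectral triple with Dirac operator `D` whose smooth algebra acts on `H` by the
operators in `𝒮`: both `𝒮` and `[D, 𝒮]` are contained in `Dom^∞(δ)`, where `δ = [|D|, ·]`. -/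
def IsRegular (𝒮 : Set (H →L[ℂ] H)) (D : H →ₗ.[ℂ] H) : Prop :=
  ∀ T ∈ 𝒮, InDomInfty (absOp D) T ∧
    ∃ C : H →L[ℂ] H, IsBoundedCommutator D T C ∧ InDomInfty (absOp D) C

end Triples

/-! ### The Laplacian, Sobolev norms and operators of finite analytic order -/

section Laplacian

variable {H : Type*} [NormedAddCommGroup H] [InnerProductSpace ℂ H]

/-- The Laplacian `Δ = 1 + D²` on `Dom(D²)`. -/
def laplacian (D : H →ₗ.[ℂ] H) : H →ₗ.[ℂ] H where
  domain :=
    { carrier := {x | ∃ hx : x ∈ D.domain, D ⟨x, hx⟩ ∈ D.domain}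
      zero_mem' := ⟨D.domain.zero_mem, by
        have : D ⟨0, D.domain.zero_mem⟩ = 0 := D.map_zero
        rw [this]; exact D.domain.zero_mem⟩
      add_mem' := by
        rintro x y ⟨hx, hx'⟩ ⟨hy, hy'⟩
        refine ⟨D.domain.add_mem hx hy, ?_⟩
        have : D ⟨x + y, D.domain.add_mem hx hy⟩ = D ⟨x, hx⟩ + D ⟨y, hy⟩ :=
          D.map_add ⟨x, hx⟩ ⟨y, hy⟩
        rw [this]; exact D.domain.add_mem hx' hy'
      smul_mem' := by
        rintro c x ⟨hx, hx'⟩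
        refine ⟨D.domain.smul_mem c hx, ?_⟩
        have : D ⟨c • x, D.domain.smul_mem c hx⟩ = c • D ⟨x, hx⟩ := D.map_smul c ⟨x, hx⟩
        rw [this]; exact D.domain.smul_mem c hx' }
  toFun :=
    { toFun := fun x => (x : H) + D ⟨D ⟨x, x.2.fst⟩, x.2.snd⟩
      map_add' := by
        intro x y
        have h : (⟨D ⟨(x + y : H), (x + y).2.fst⟩, (x + y).2.snd⟩ : D.domain) =
            ⟨D ⟨x, x.2.fst⟩, x.2.snd⟩ + ⟨D ⟨y, y.2.fst⟩, y.2.snd⟩ :=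
          Subtype.ext (D.map_add ⟨x, x.2.fst⟩ ⟨y, y.2.fst⟩)
        have h' := congrArg D h
        rw [D.map_add] at h'
        simp only [Submodule.coe_add]
        rw [h']; abel
      map_smul' := by
        intro c x
        have h : (⟨D ⟨(c • x : H), (c • x).2.fst⟩, (c • x).2.snd⟩ : D.domain) =
            c • ⟨D ⟨x, x.2.fst⟩, x.2.snd⟩ :=
          Subtype.ext (D.map_smul c ⟨x, x.2.fst⟩)
        have h' := congrArg D h
        rw [D.map_smul] at h'
        simp only [Submodule.coe_smul, RingHom.id_apply, smul_add]
        rw [h'] }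

/-- `Dom(L^n)`. -/
def powDomain (L : H →ₗ.[ℂ] H) : ℕ → Submodule ℂ H
  | 0 => ⊤
  | n + 1 => ((powDomain L n).comap L.toFun).map L.domain.subtype

lemma mem_powDomain_succ {L : H →ₗ.[ℂ] H} {n : ℕ} {x : H} :
    x ∈ powDomain L (n + 1) ↔ ∃ hx : x ∈ L.domain, L ⟨x, hx⟩ ∈ powDomain L n := by
  constructor
  · rintro ⟨y, hy, rfl⟩
    exact ⟨y.2, hy⟩
  · rintro ⟨hx, h⟩
    exact ⟨⟨x, hx⟩, h, rfl⟩

/-- The space `W^∞ = ⋂ₙ Dom(Δ^n)` of smooth vectors. -/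
def smoothVectors (D : H →ₗ.[ℂ] H) : Submodule ℂ H :=
  ⨅ n : ℕ, powDomain (laplacian D) n

lemma mem_smoothVectors {D : H →ₗ.[ℂ] H} {x : H} :
    x ∈ smoothVectors D ↔ ∀ n, x ∈ powDomain (laplacian D) n := by
  simp [smoothVectors, Submodule.mem_iInf]

lemma smoothVectors_le_laplacian (D : H →ₗ.[ℂ] H) : smoothVectors D ≤ (laplacian D).domain :=
  fun _ hx => (mem_powDomain_succ.1 (mem_smoothVectors.1 hx 1)).fst

lemma smoothVectors_le (D : H →ₗ.[ℂ] H) : smoothVectors D ≤ D.domain :=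
  fun _ hx => (smoothVectors_le_laplacian D hx).fst

lemma laplacian_mem_smoothVectors (D : H →ₗ.[ℂ] H) (x : smoothVectors D) :
    laplacian D ⟨x, smoothVectors_le_laplacian D x.2⟩ ∈ smoothVectors D :=
  mem_smoothVectors.2 fun n => (mem_powDomain_succ.1 (mem_smoothVectors.1 x.2 (n + 1))).snd

lemma dirac_mem_powDomain (D : H →ₗ.[ℂ] H) (n : ℕ) : ∀ (x : H) (hx : x ∈ D.domain),
    x ∈ powDomain (laplacian D) (n + 1) → D ⟨x, hx⟩ ∈ powDomain (laplacian D) n := by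
  induction n with
  | zero => intro x hx _; trivial
  | succ n ih =>
    intro x hx h
    obtain ⟨⟨h₁, h₂⟩, h₃⟩ := mem_powDomain_succ.1 h
    obtain ⟨⟨h₄, -⟩, -⟩ := mem_powDomain_succ.1 h₃
    have hval : laplacian D ⟨x, ⟨h₁, h₂⟩⟩ = x + D ⟨D ⟨x, h₁⟩, h₂⟩ := rfl
    have h₅ : D ⟨D ⟨x, h₁⟩, h₂⟩ ∈ D.domain := by
      have := D.domain.sub_mem h₄ h₁
      rw [hval] at this
      simpa using this
    refine mem_powDomain_succ.2 ⟨⟨h₂, h₅⟩, ?_⟩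
    have key : laplacian D ⟨D ⟨x, hx⟩, ⟨h₂, h₅⟩⟩ = D ⟨laplacian D ⟨x, ⟨h₁, h₂⟩⟩, h₄⟩ := by
      have : (⟨laplacian D ⟨x, ⟨h₁, h₂⟩⟩, h₄⟩ : D.domain) =
          ⟨x, h₁⟩ + ⟨D ⟨D ⟨x, h₁⟩, h₂⟩, h₅⟩ := Subtype.ext hval
      rw [this, D.map_add]
      rfl
    rw [key]
    exact ih _ h₄ h₃

lemma dirac_mem_smoothVectors (D : H →ₗ.[ℂ] H) (x : smoothVectors D) :
    D ⟨x, smoothVectors_le D x.2⟩ ∈ smoothVectors D :=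
  mem_smoothVectors.2 fun n => dirac_mem_powDomain D n x _ (mem_smoothVectors.1 x.2 (n + 1))

/-- `Δ` as an element of `End(W^∞)`. -/
def laplaceEnd (D : H →ₗ.[ℂ] H) : Module.End ℂ (smoothVectors D) :=
  LinearMap.codRestrict _ ((laplacian D).toFun ∘ₗ
    Submodule.inclusion (smoothVectors_le_laplacian D)) (laplacian_mem_smoothVectors D)

/-- `D` as an element of `End(W^∞)`. -/
def diracEnd (D : H →ₗ.[ℂ] H) : Module.End ℂ (smoothVectors D) :=
  LinearMap.codRestrict _ (D.toFun ∘ₗ Submodule.inclusion (smoothVectors_le D))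
    (dirac_mem_smoothVectors D)

/-- The `k`-fold commutator `[Δ, [Δ, … [Δ, P]…]]` in `End(W^∞)`. -/
def iterLaplaceComm (D : H →ₗ.[ℂ] H) (k : ℕ) (P : Module.End ℂ (smoothVectors D)) :
    Module.End ℂ (smoothVectors D) :=
  (fun Q => laplaceEnd D * Q - Q * laplaceEnd D)^[k] P

variable [CompleteSpace H]

/-- The Sobolev norm `‖Δ^{s/2} ξ‖` of a smooth vector `ξ`. For `D` self-adjoint with compact
resolvent, smooth vectors lie in the domain of `Δ^{s/2}` for all real `s`, and the value `0` is
never used. -/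
def sobolevNorm (D : H →ₗ.[ℂ] H) (s : ℝ) (ξ : smoothVectors D) : ℝ :=
  open Classical in
  if h : (ξ : H) ∈ (laplacePow D s).domain then ‖laplacePow D s ⟨ξ, h⟩‖ else 0

/-- `P ∈ Op^t(Δ)`. Since `W^∞` is dense in every Sobolev space `W^s`, the map `P : W^∞ → W^∞`
extends by continuity to a bounded operator `W^{s+t} → W^s` if and only if it is bounded on `W^∞`
for the two Sobolev norms. -/
def HasOrder (D : H →ₗ.[ℂ] H) (t : ℝ) (P : Module.End ℂ (smoothVectors D)) : Prop :=
  ∀ s : ℝ, ∃ C : ℝ, ∀ ξ : smoothVectors D, sobolevNorm D s (P ξ) ≤ C * sobolevNorm D (s + t) ξ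

/-- The bounded operator `T` maps `W^∞` to itself, `T` and `[D, T]` are in `Op^0(Δ)`, and for every
`k` the `k`-fold commutators of `Δ` with `T` and with `[D, T]` are in `Op^k(Δ)`. -/
def IsLaplaceCompatible (D : H →ₗ.[ℂ] H) (T : H →L[ℂ] H) : Prop :=
  ∃ hT : ∀ ξ ∈ smoothVectors D, T.toLinearMap ξ ∈ smoothVectors D,
    let P : Module.End ℂ (smoothVectors D) := T.toLinearMap.restrict hT
    let Q : Module.End ℂ (smoothVectors D) := diracEnd D * P - P * diracEnd D
    HasOrder D 0 P ∧ HasOrder D 0 Q ∧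
      ∀ k : ℕ, HasOrder D k (iterLaplaceComm D k P) ∧ HasOrder D k (iterLaplaceComm D k Q)

end Laplacian

/-! ### Twisted actions and covariant representations -/

section Twisted

variable {A : Type*} [CStarAlgebra A] {G : Type*} [Group G]

variable (A G) in
/-- A twisting pair `(ρ, σ)` for `A` and `G`. -/
structure TwistingPair where
  ρ : G → (A ≃⋆ₐ[ℂ] A)
  σ : G → G → unitary A
  cocycle : ∀ x y z, ρ x (σ y z : A) = σ x y * σ (x * y) z * star (σ x (y * z) : A)
  twist : ∀ x y a, ρ x (ρ y a) = σ x y * ρ (x * y) a * star (σ x y : A)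
  σ_one_right : ∀ x, σ x 1 = 1
  σ_one_left : ∀ x, σ 1 x = 1
  ρ_one : ∀ a, ρ 1 a = a

/-- The twisted action restricts to the smooth algebra `𝒜`. -/
structure TwistingPair.IsSmooth (τ : TwistingPair A G) (𝒜 : StarSubalgebra ℂ A) : Prop where
  ρ_mem : ∀ x, ∀ a ∈ 𝒜, τ.ρ x a ∈ 𝒜
  ρ_symm_mem : ∀ x, ∀ a ∈ 𝒜, (τ.ρ x).symm a ∈ 𝒜
  σ_mem : ∀ x y, (τ.σ x y : A) ∈ 𝒜

variable {H : Type*} [NormedAddCommGroup H] [InnerProductSpace ℂ H] [CompleteSpace H]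

/-- `(π, U)` is a twisted covariant representation of `(A, G, ρ, σ)`. -/
structure IsCovariantRep (τ : TwistingPair A G) (π : A →⋆ₐ[ℂ] (H →L[ℂ] H))
    (U : G → unitary (H →L[ℂ] H)) : Prop where
  mul : ∀ x y, (U x : H →L[ℂ] H) * U y = π (τ.σ x y) * U (x * y)
  covariant : ∀ x a, π (τ.ρ x a) = U x * π a * star (U x : H →L[ℂ] H)

/-- `(𝒜, H, D, π, U)` is a `G`-equivariant odd spectral triple over `A`, for a smooth twisted
action. -/
structure IsEquivariantTriple (τ : TwistingPair A G) (𝒜 : StarSubalgebra ℂ A)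
    (π : A →⋆ₐ[ℂ] (H →L[ℂ] H)) (D : H →ₗ.[ℂ] H) (U : G → unitary (H →L[ℂ] H)) : Prop where
  isSpectralTriple : IsSpectralTriple (𝒜 : Set A) π D
  isSmooth : τ.IsSmooth 𝒜
  isCovariantRep : IsCovariantRep τ π U
  boundedCommutator : ∀ g, ∃ C : H →L[ℂ] H, IsBoundedCommutator D (U g : H →L[ℂ] H) C

/-- `C_c(G, 𝒜)`, inside the finitely supported functions from `G` to `A`. -/
def finSupp (G : Type*) (𝒜 : StarSubalgebra ℂ A) : Set (G →₀ A) :=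
  {f | ∀ g, f g ∈ 𝒜}

/-- The integrated form `∑ₓ aₓ δₓ ↦ ∑ₓ π(aₓ) Uₓ` of `(π, U)` on finitely supported functions. -/
def integratedForm (π : A →⋆ₐ[ℂ] (H →L[ℂ] H)) (U : G → unitary (H →L[ℂ] H)) (f : G →₀ A) :
    H →L[ℂ] H :=
  f.sum fun g a => π a * (U g : H →L[ℂ] H)

/-- The C⋆-algebra generated by the image of `C_c(G, A)` under a representation `R`. -/
def cstarImage (R : (G →₀ A) → (H →L[ℂ] H)) : StarSubalgebra ℂ (H →L[ℂ] H) :=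
  (StarAlgebra.adjoin ℂ (Set.range R)).topologicalClosure

instance (R : (G →₀ A) → (H →L[ℂ] H)) : CStarAlgebra (cstarImage R) :=
  StarSubalgebra.cstarAlgebra _ (h_closed := StarSubalgebra.isClosed_topologicalClosure _)

/-- The element `R f` of the C⋆-algebra generated by the image of `R`. -/
def toImage (R : (G →₀ A) → (H →L[ℂ] H)) (f : G →₀ A) : cstarImage R :=
  ⟨R f, StarSubalgebra.le_topologicalClosure _ (StarAlgebra.subset_adjoin ℂ _ ⟨f, rfl⟩)⟩

end Twisted

/-! ### Weighted translations on `ℓ²(G, E)` and the reduced crossed product -/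

section Lp

variable {G : Type*} {E : Type*} [NormedAddCommGroup E] [InnerProductSpace ℂ E]

lemma weightedShift_sum_le (w : G → E →L[ℂ] E) {C : ℝ} (hw : ∀ z, ‖w z‖ ≤ C) (e : G ≃ G)
    (f : lp (fun _ : G => E) 2) (s : Finset G) :
    ∑ z ∈ s, ‖w z (f (e z))‖ ^ (2 : ENNReal).toReal ≤ (C * ‖f‖) ^ (2 : ENNReal).toReal := by
  have h2 : (0 : ℝ) < (2 : ENNReal).toReal := by norm_num
  have hpt : ∀ z, ‖w z (f (e z))‖ ≤ C * ‖f (e z)‖ := fun z => by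
    refine ((w z).le_opNorm _).trans ?_
    gcongr
    exact hw z
  by_cases hs : s.Nonempty
  · obtain ⟨z₀, -⟩ := hs
    have hC : 0 ≤ C := (norm_nonneg _).trans (hw z₀)
    calc ∑ z ∈ s, ‖w z (f (e z))‖ ^ (2 : ENNReal).toReal
        ≤ ∑ z ∈ s, (C * ‖f (e z)‖) ^ (2 : ENNReal).toReal := by
          gcongr with z _
          exact hpt z
      _ = C ^ (2 : ENNReal).toReal * ∑ z ∈ s, ‖f (e z)‖ ^ (2 : ENNReal).toReal := by
          rw [Finset.mul_sum]
          exact Finset.sum_congr rfl fun z _ => Real.mul_rpow hC (norm_nonneg _)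
      _ ≤ C ^ (2 : ENNReal).toReal * ‖f‖ ^ (2 : ENNReal).toReal := by
          gcongr
          have := lp.sum_rpow_le_norm_rpow h2 f (s.map e.toEmbedding)
          simpa using this
      _ = (C * ‖f‖) ^ (2 : ENNReal).toReal := (Real.mul_rpow hC (norm_nonneg _)).symm
  · rw [Finset.not_nonempty_iff_eq_empty] at hs
    subst hs
    simp only [Finset.sum_empty]
    norm_num
    exact sq_nonneg _

/-- The bounded operator `(T f)(z) = w(z) f(e z)` on `ℓ²(G, E)`, for a bounded family `w` of
operators on `E` and a bijection `e` of `G`. -/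
def weightedShift [Nonempty G] (w : G → E →L[ℂ] E) (C : ℝ) (hw : ∀ z, ‖w z‖ ≤ C) (e : G ≃ G) :
    lp (fun _ : G => E) 2 →L[ℂ] lp (fun _ : G => E) 2 :=
  LinearMap.mkContinuous
    { toFun := fun f => ⟨fun z => w z (f (e z)),
        memℓp_gen' (C := (C * ‖f‖) ^ (2 : ENNReal).toReal) (weightedShift_sum_le w hw e f)⟩
      map_add' := fun f g => by
        ext z
        exact (w z).map_add _ _
      map_smul' := fun c f => by
        ext z
        simp }
    C (fun f => lp.norm_le_of_forall_sum_le (by norm_num)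
        (mul_nonneg ((norm_nonneg _).trans (hw (Classical.arbitrary G))) (norm_nonneg _))
        (weightedShift_sum_le w hw e f))

end Lp

section Reduced

variable {A : Type*} [CStarAlgebra A] {G : Type*} [Group G]
variable {H : Type*} [NormedAddCommGroup H] [InnerProductSpace ℂ H] [CompleteSpace H]

lemma norm_regular_le (τ : TwistingPair A G) (π : A →⋆ₐ[ℂ] (H →L[ℂ] H)) (x : G) (a : A) (z : G) :
    ‖π (τ.ρ z⁻¹ a * τ.σ z⁻¹ x)‖ ≤ ‖a‖ := by
  refine (NonUnitalStarAlgHom.norm_apply_le π _).trans ?_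
  rw [CStarRing.norm_mul_coe_unitary]
  exact NonUnitalStarAlgHom.norm_apply_le (τ.ρ z⁻¹) a

/-- The left regular representation on `ℓ²(G, H)` induced by `π`:
`Π(a δₓ)(ξ ⊗ δ_y) = π(ρ_{y⁻¹x⁻¹}(a) σ_{y⁻¹x⁻¹,x}) ξ ⊗ δ_{xy}`, that is
`(Π(a δₓ) f)(z) = π(ρ_{z⁻¹}(a) σ_{z⁻¹,x}) f(x⁻¹z)`. -/
def regularRep (τ : TwistingPair A G) (π : A →⋆ₐ[ℂ] (H →L[ℂ] H)) (f : G →₀ A) :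
    lp (fun _ : G => H) 2 →L[ℂ] lp (fun _ : G => H) 2 :=
  f.sum fun x a => weightedShift (fun z => π (τ.ρ z⁻¹ a * τ.σ z⁻¹ x)) ‖a‖
    (norm_regular_le τ π x a) (Equiv.mulLeft x⁻¹)

/-- The reduced twisted crossed product, defined by the left regular representation induced by a
faithful representation `π`. -/
abbrev reducedCrossedProduct (τ : TwistingPair A G) (π : A →⋆ₐ[ℂ] (H →L[ℂ] H)) :
    StarSubalgebra ℂ (lp (fun _ : G => H) 2 →L[ℂ] lp (fun _ : G => H) 2) :=
  cstarImage (regularRep τ π)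

end Reduced

/-! ### Length functions and the spectral triple of the group -/

section Group

variable {G : Type*} [Group G] {V : Type*} [NormedAddCommGroup V] [InnerProductSpace ℂ V]

/-- A proper translation bounded length function with values in the self-adjoint operators of `V`.
Discreteness of the union of all spectra is meant in `ℝ`: it has no accumulation point. -/
structure IsProperTranslationBounded [CompleteSpace V] (ℓ : G → V →L[ℂ] V) : Prop where
  selfAdjoint : ∀ x, IsSelfAdjoint (ℓ x)
  translationBounded : ∀ y, ∃ C : ℝ, ∀ x, ‖ℓ x - ℓ (y⁻¹ * x)‖ ≤ C
  eq_zero_iff : ∀ x, ℓ x = 0 ↔ x = 1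
  discrete : ∀ R : ℝ, ((⋃ x, spectrum ℝ (ℓ x)) ∩ Set.Icc (-R) R).Finite
  finite_fibers : ∀ t ∈ ⋃ x, spectrum ℝ (ℓ x), {x | t ∈ spectrum ℝ (ℓ x)}.Finite

/-- The left regular representation, amplified to `ℓ²(G) ⊗ V = ℓ²(G, V)`:
`λ_g(δₓ ⊗ v) = δ_{gx} ⊗ v`. -/
def leftReg (V : Type*) [NormedAddCommGroup V] [InnerProductSpace ℂ V] (g : G) :
    lp (fun _ : G => V) 2 →L[ℂ] lp (fun _ : G => V) 2 :=
  weightedShift (fun _ => ContinuousLinearMap.id ℂ V) 1 (fun _ => ContinuousLinearMap.norm_id_le)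
    (Equiv.mulLeft g⁻¹)

/-- The operators on `ℓ²(G) ⊗ V` given by the group algebra `C_c(G)`. -/
def groupAlgebraOps (G : Type*) [Group G] (V : Type*) [NormedAddCommGroup V]
    [InnerProductSpace ℂ V] :
    Set (lp (fun _ : G => V) 2 →L[ℂ] lp (fun _ : G => V) 2) :=
  {T | ∃ f : G →₀ ℂ, T = f.sum fun g c => c • leftReg V g}

/-- The operator `M_ℓ` of multiplication by `ℓ` on `ℓ²(G) ⊗ V = ℓ²(G, V)`, on its maximal domain;
for self-adjoint `ℓ` this is the closure of its restriction to the finitely supported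
functions. -/
def mulLength (ℓ : G → V →L[ℂ] V) : lp (fun _ : G => V) 2 →ₗ.[ℂ] lp (fun _ : G => V) 2 where
  domain :=
    { carrier := {f | Memℓp (fun x => ℓ x (f x)) 2}
      zero_mem' := by
        have : (fun x => ℓ x ((0 : lp (fun _ : G => V) 2) x)) = 0 := by
          ext x
          simp
        rw [Set.mem_ofPred_eq, this]
        exact zero_memℓp
      add_mem' := by
        intro f g hf hg
        have : (fun x => ℓ x ((f + g) x)) = (fun x => ℓ x (f x)) + fun x => ℓ x (g x) := by
          ext x
          simp
        rw [Set.mem_ofPred_eq, this]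
        exact hf.add hg
      smul_mem' := by
        intro c f hf
        have : (fun x => ℓ x ((c • f) x)) = c • fun x => ℓ x (f x) := by
          ext x
          simp
        rw [Set.mem_ofPred_eq, this]
        exact hf.const_smul c }
  toFun :=
    { toFun := fun f => ⟨fun x => ℓ x ((f : lp (fun _ : G => V) 2) x), f.2⟩
      map_add' := fun f g => by
        ext x
        exact (ℓ x).map_add _ _
      map_smul' := fun c f => by
        ext x
        simp }

end Group

/-! ### Hilbert tensor products and the equivariant construction -/

section Product

variable (H K : Type*) [NormedAddCommGroup H] [InnerProductSpace ℂ H]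
  [NormedAddCommGroup K] [InnerProductSpace ℂ K]

/-- The Hilbert space tensor product: the completion of the algebraic tensor product. -/
def HilbertTensor : Type _ :=
  UniformSpace.Completion (H ⊗[ℂ] K)

instance : NormedAddCommGroup (HilbertTensor H K) :=
  inferInstanceAs (NormedAddCommGroup (UniformSpace.Completion (H ⊗[ℂ] K)))

instance : InnerProductSpace ℂ (HilbertTensor H K) :=
  inferInstanceAs (InnerProductSpace ℂ (UniformSpace.Completion (H ⊗[ℂ] K)))

instance : CompleteSpace (HilbertTensor H K) :=
  inferInstanceAs (CompleteSpace (UniformSpace.Completion (H ⊗[ℂ] K)))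

variable {H K}

/-- The simple tensor `x ⊗ y` in the Hilbert space tensor product. -/
def htmul (x : H) (y : K) : HilbertTensor H K :=
  ((x ⊗ₜ[ℂ] y : H ⊗[ℂ] K) : UniformSpace.Completion (H ⊗[ℂ] K))

/-- The operator `S ⊗ T` on the Hilbert space tensor product. -/
def tensorOp (S : H →L[ℂ] H) (T : K →L[ℂ] K) : HilbertTensor H K →L[ℂ] HilbertTensor H K :=
  (TensorProduct.mapL S T).completion

lemma tensorOp_htmul (S : H →L[ℂ] H) (T : K →L[ℂ] K) (x : H) (y : K) :
    tensorOp S T (htmul x y) = htmul (S x) (T y) :=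
  ContinuousLinearMap.completion_apply_coe (TensorProduct.mapL S T) (x ⊗ₜ[ℂ] y)

/-- The Hilbert space direct sum `E ⊕ E` of two copies of `E`. -/
abbrev Double (E : Type*) : Type _ :=
  WithLp 2 (E × E)

/-- The operator `T ⊕ T` on `E ⊕ E`. -/
def doubleOp {E : Type*} [NormedAddCommGroup E] [InnerProductSpace ℂ E] (T : E →L[ℂ] E) :
    Double E →L[ℂ] Double E :=
  ((WithLp.prodContinuousLinearEquiv 2 ℂ E E).symm : E × E →L[ℂ] Double E) ∘L (T.prodMap T) ∘L
    (WithLp.prodContinuousLinearEquiv 2 ℂ E E : Double E →L[ℂ] E × E)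

/-- The graph of the operator matrix with rows `(0, D₁ ⊗ 1 - i 1 ⊗ D₂)` and
`(D₁ ⊗ 1 + i 1 ⊗ D₂, 0)` on the direct sum of two copies of the algebraic tensor product
`Dom D₁ ⊗ Dom D₂`. -/
def productDiracGraph (D₁ : H →ₗ.[ℂ] H) (D₂ : K →ₗ.[ℂ] K) :
    Submodule ℂ (Double (HilbertTensor H K) × Double (HilbertTensor H K)) :=
  Submodule.span ℂ {p | ∃ (x x' : D₁.domain) (y y' : D₂.domain),
    p = (WithLp.toLp 2 (htmul (x : H) (y : K), htmul (x' : H) (y' : K)),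
      WithLp.toLp 2 (htmul (D₁ x') (y' : K) - Complex.I • htmul (x' : H) (D₂ y'),
        htmul (D₁ x) (y : K) + Complex.I • htmul (x : H) (D₂ y)))}

/-- The Dirac operator `D₁ × D₂` of the exterior product of two odd spectral triples: the closure of
the operator matrix with rows `(0, D₁ ⊗ 1 - i 1 ⊗ D₂)` and `(D₁ ⊗ 1 + i 1 ⊗ D₂, 0)`, which is
symmetric, hence closable, for self-adjoint `D₁` and `D₂`. -/
def productDirac (D₁ : H →ₗ.[ℂ] H) (D₂ : K →ₗ.[ℂ] K) :
    Double (HilbertTensor H K) →ₗ.[ℂ] Double (HilbertTensor H K) :=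
  (productDiracGraph D₁ D₂).topologicalClosure.toLinearPMap

end Product

section Equivariant

variable {A : Type*} [CStarAlgebra A] {G : Type*} [Group G]
variable {H : Type*} [NormedAddCommGroup H] [InnerProductSpace ℂ H] [CompleteSpace H]

/-- The Hilbert space `(H ⊗ ℓ²(G) ⊗ V) ⊕ (H ⊗ ℓ²(G) ⊗ V)` of the equivariant construction. -/
abbrev EquivariantSpace (H G V : Type*) [NormedAddCommGroup H] [InnerProductSpace ℂ H]
    [NormedAddCommGroup V] [InnerProductSpace ℂ V] : Type _ :=
  Double (HilbertTensor H (lp (fun _ : G => V) 2))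

/-- The representation of `C_c(G, A)` in the equivariant construction: two copies of
`a δ_h ↦ (ξ ⊗ δₓ ⊗ v ↦ π(a) U_h ξ ⊗ δ_{hx} ⊗ v)`. -/
def equivariantRep (V : Type*) [NormedAddCommGroup V] [InnerProductSpace ℂ V]
    (π : A →⋆ₐ[ℂ] (H →L[ℂ] H)) (U : G → unitary (H →L[ℂ] H)) (f : G →₀ A) :
    EquivariantSpace H G V →L[ℂ] EquivariantSpace H G V :=
  f.sum fun h a => doubleOp (tensorOp (π a * (U h : H →L[ℂ] H)) (leftReg V h))

/-- The Dirac operator of the equivariant construction. -/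
def equivariantDirac {V : Type*} [NormedAddCommGroup V] [InnerProductSpace ℂ V]
    (D : H →ₗ.[ℂ] H) (ℓ : G → V →L[ℂ] V) :
    EquivariantSpace H G V →ₗ.[ℂ] EquivariantSpace H G V :=
  productDirac D (mulLength ℓ)

end Equivariant

end TwistedTriple

end

/-! Because its resolvent is compact, `D` is diagonal in an orthonormal basis (`exists_isDiag`);
`M_ℓ` is diagonal because each `ℓ x` is (`exists_isDiag_mulLength`). All regularity conditions
thereby become conditions on infinite matrices. If `d i` are the eigenvalues, `T` is smooth for
`[|D|, ·]` exactly when every matrix `(|d i| - |d j|)^k T_ij` is bounded (`IsDiag.inDomInfty_iff`).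
With `w i = √(1 + d i ^ 2)`, an endomorphism is in `Op^t` exactly when `w i ^ r P_ij w j ^ (-(r +
t))` is bounded for every real `r` (`IsDiag.hasOrder_iff`). Exchanging `|d i|` for `w i` is a
bounded perturbation and does not affect smoothness.

The analytic core is the passage between commutators with `w` and with `w²`. In one direction, `w i
^ 2 - w j ^ 2 = (w i - w j)(w i + w j)`, and conjugation by powers of `w` keeps a smooth matrix
bounded: for integer powers by `w n w⁻¹ = n + [w, n] w⁻¹`, for real powers by interpolation on a
strip (`SmoothMat.sq_commutator`). In the other direction one has to divide by `w i + w j`; this is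
Schur multiplication by `√(w i w j) / (w i + w j)`, an integral of rank one kernels and hence
harmless (`BddMat.schur`, `SmoothMat.of_sq_commutator`). Together they give
`IsDiag.smoothMat_iff_hasOrder`. Assertions 2 and 3 follow: regular operators form an algebra by the
Leibniz rule, so `π(a) U_g` is regular if both factors are, and conversely `π(a)` and `U_g` are the
images of `a δ_e` and `1 δ_g`.

For assertion 1, the product Dirac operator splits into two-dimensional blocks, on which its
absolute value is the scalar `√(d² + e²)`. The absolute value is not additive in the two factors,
but its square is. So the commutators with the square expand by the binomial theorem into Kronecker
products, and the core result turns this back into smoothness (`SmoothMat.kronecker`). The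
representation extends to the reduced crossed product by Fell absorption: the isometries `ξ ⊗ δ_y ↦
U_{y⁻¹}^* ξ ⊗ δ_y ⊗ v` intertwine the regular representation with `π(a) U_x ⊗ λ_x ⊗ 1`, and when `v`
runs through an orthonormal basis of `V` their ranges fill the space (`tensorMap_comp_fell`,
`fellHom`). -/

open scoped TensorProduct

noncomputable section

namespace TwistedTriple

/-! ### Bounded infinite matrices and smoothness for a diagonal derivation. -/

section Matrices

open ComplexConjugate

variable {ι : Type*}

/-- The matrix `n` defines a bounded operator on `ℓ²(ι)`, expressed by its finite truncations. -/
def BddMat (n : ι → ι → ℂ) : Prop :=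
  ∃ K : ℝ, 0 < K ∧ ∀ (F : Finset ι) (x y : ι → ℂ),
    ‖∑ i ∈ F, ∑ j ∈ F, conj (y i) * n i j * x j‖ ≤ K * (∑ i ∈ F, ‖x i‖ ^ 2 + ∑ i ∈ F, ‖y i‖ ^ 2)

lemma BddMat.add {m n : ι → ι → ℂ} (hm : BddMat m) (hn : BddMat n) :
    BddMat fun i j => m i j + n i j := by
  obtain ⟨K, hK, h⟩ := hm
  obtain ⟨K', hK', h'⟩ := hn
  refine ⟨K + K', by positivity, fun F x y => ?_⟩
  have : ∑ i ∈ F, ∑ j ∈ F, conj (y i) * (m i j + n i j) * x j =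
      ∑ i ∈ F, ∑ j ∈ F, conj (y i) * m i j * x j + ∑ i ∈ F, ∑ j ∈ F, conj (y i) * n i j * x j := by
    simp only [← Finset.sum_add_distrib]
    exact Finset.sum_congr rfl fun i _ => Finset.sum_congr rfl fun j _ => by ring
  rw [this, add_mul]
  exact (norm_add_le _ _).trans (add_le_add (h F x y) (h' F x y))

lemma BddMat.zero : BddMat fun _ _ : ι => (0 : ℂ) :=
  ⟨1, one_pos, fun F x y => by simp; positivity⟩

lemma BddMat.diag_mul_mul_diag {n : ι → ι → ℂ} (hn : BddMat n) {g h : ι → ℝ} {c : ℝ}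
    (hg : ∀ i, |g i| ≤ c) (hh : ∀ i, |h i| ≤ c) :
    BddMat fun i j => (g i : ℂ) * n i j * (h j : ℂ) := by
  obtain ⟨K, hK, hn⟩ := hn
  refine ⟨K * (c ^ 2 + 1), by positivity, fun F x y => ?_⟩
  have key : ∀ (f : ι → ℝ), (∀ i, |f i| ≤ c) → ∀ z : ι → ℂ,
      ∑ i ∈ F, ‖(f i : ℂ) * z i‖ ^ 2 ≤ (c ^ 2 + 1) * ∑ i ∈ F, ‖z i‖ ^ 2 := by
    intro f hf z
    rw [Finset.mul_sum]
    refine Finset.sum_le_sum fun i _ => ?_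
    rw [norm_mul, mul_pow, Complex.norm_real, Real.norm_eq_abs]
    have : |f i| ^ 2 ≤ c ^ 2 := pow_le_pow_left₀ (abs_nonneg _) (hf i) 2
    gcongr
    linarith
  have := hn F (fun j => (h j : ℂ) * x j) (fun i => (g i : ℂ) * y i)
  have e : ∑ i ∈ F, ∑ j ∈ F, conj (y i) * ((g i : ℂ) * n i j * (h j : ℂ)) * x j =
      ∑ i ∈ F, ∑ j ∈ F, conj ((g i : ℂ) * y i) * n i j * ((h j : ℂ) * x j) :=
    Finset.sum_congr rfl fun i _ => Finset.sum_congr rfl fun j _ => by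
      rw [map_mul, Complex.conj_ofReal]; ring
  rw [e]
  refine this.trans ?_
  rw [mul_assoc, mul_add (c ^ 2 + 1)]
  gcongr
  · exact key h hh x
  · exact key g hg y

lemma BddMat.diag_mul {n : ι → ι → ℂ} (hn : BddMat n) {g : ι → ℝ} {c : ℝ}
    (hg : ∀ i, |g i| ≤ c) : BddMat fun i j => (g i : ℂ) * n i j := by
  have := hn.diag_mul_mul_diag (g := g) (h := fun _ => 1) (c := max c 1)
    (fun i => (hg i).trans (le_max_left _ _)) (fun i => by simp)
  simpa using this

lemma BddMat.mul_diag {n : ι → ι → ℂ} (hn : BddMat n) {g : ι → ℝ} {c : ℝ}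
    (hg : ∀ i, |g i| ≤ c) : BddMat fun i j => n i j * (g j : ℂ) := by
  have := hn.diag_mul_mul_diag (g := fun _ => 1) (h := g) (c := max c 1)
    (fun i => by simp) (fun i => (hg i).trans (le_max_left _ _))
  simpa using this

lemma BddMat.const_mul {n : ι → ι → ℂ} (hn : BddMat n) (c : ℂ) :
    BddMat fun i j => c * n i j := by
  obtain ⟨K, hK, hn⟩ := hn
  refine ⟨K * (‖c‖ + 1), by positivity, fun F x y => ?_⟩
  have e : ∑ i ∈ F, ∑ j ∈ F, conj (y i) * (c * n i j) * x j =
      c * ∑ i ∈ F, ∑ j ∈ F, conj (y i) * n i j * x j := by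
    simp only [Finset.mul_sum]
    exact Finset.sum_congr rfl fun i _ => Finset.sum_congr rfl fun j _ => by ring
  rw [e, norm_mul]
  have h0 : 0 ≤ ∑ i ∈ F, ‖x i‖ ^ 2 + ∑ i ∈ F, ‖y i‖ ^ 2 := by positivity
  calc ‖c‖ * _ ≤ (‖c‖ + 1) * (K * (∑ i ∈ F, ‖x i‖ ^ 2 + ∑ i ∈ F, ‖y i‖ ^ 2)) := by
        gcongr
        · linarith
        · exact hn F x y
    _ = _ := by ring

lemma BddMat.sum {κ : Type*} (s : Finset κ) {n : κ → ι → ι → ℂ} (h : ∀ k ∈ s, BddMat (n k)) :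
    BddMat fun i j => ∑ k ∈ s, n k i j := by
  classical
  induction s using Finset.induction_on with
  | empty => simpa using BddMat.zero
  | insert k s hk ih =>
    simp only [Finset.sum_insert hk]
    exact (h k (Finset.mem_insert_self _ _)).add
      (ih fun l hl => h l (Finset.mem_insert_of_mem hl))

open MeasureTheory Set in
/-- Schur multiplication by the kernel `√(aᵢaⱼ) / (aᵢ + aⱼ)` preserves boundedness. -/
lemma BddMat.schur {n : ι → ι → ℂ} (hn : BddMat n) {a : ι → ℝ} (ha : ∀ i, 0 < a i) :
    BddMat fun i j => ((√(a i) * √(a j) / (a i + a j) : ℝ) : ℂ) * n i j := by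
  obtain ⟨K, hK, hn⟩ := hn
  refine ⟨K, hK, fun F x y => ?_⟩
  have hexp : ∀ c : ℝ, 0 < c → IntegrableOn (fun u => Real.exp (-c * u)) (Ioi 0) :=
    fun c hc => integrableOn_exp_mul_Ioi (by linarith) 0
  have hint : ∀ c : ℝ, 0 < c → ∫ u in Ioi (0 : ℝ), Real.exp (-c * u) = 1 / c := fun c hc => by
    rw [integral_exp_mul_Ioi (by linarith)]
    simp [neg_div_neg_eq]
  -- The kernel is `∫₀^∞ √(a i) e^{-a i u} √(a j) e^{-a j u} du`. For fixed `u` the integrand only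
  -- rescales `x` and `y` diagonally, so the bound for `n` applies; since `∫ a e^{-2au} du = 1/2`,
  -- integrating the squared norms gives back half of them.
  let g : (ι → ℂ) → ℝ → ι → ℂ := fun z u i => ((√(a i) * Real.exp (-a i * u) : ℝ) : ℂ) * z i
  have hg : ∀ z : ι → ℂ, (IntegrableOn (fun u => ∑ i ∈ F, ‖g z u i‖ ^ 2) (Ioi 0)) ∧
      ∫ u in Ioi (0 : ℝ), ∑ i ∈ F, ‖g z u i‖ ^ 2 = (∑ i ∈ F, ‖z i‖ ^ 2) / 2 := by
    intro z
    have e : ∀ i u, ‖g z u i‖ ^ 2 = a i * ‖z i‖ ^ 2 * Real.exp (-(2 * a i) * u) := by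
      intro i u
      simp only [g]
      rw [norm_mul, Complex.norm_real, Real.norm_eq_abs, mul_pow, sq_abs, mul_pow,
        Real.sq_sqrt (ha i).le, ← Real.exp_nat_mul]
      push_cast
      ring_nf
    have hi : ∀ i ∈ F, IntegrableOn (fun u => ‖g z u i‖ ^ 2) (Ioi 0) := by
      intro i _
      simp only [e]
      exact (hexp _ (by linarith [ha i])).const_mul _
    refine ⟨integrable_finsetSum _ hi, ?_⟩
    rw [integral_finsetSum _ hi, Finset.sum_div]
    refine Finset.sum_congr rfl fun i _ => ?_
    simp only [e]
    rw [integral_const_mul, hint _ (by linarith [ha i])]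
    have := (ha i).ne'
    field_simp
  have hterm : ∀ i j, (fun u => conj (g y u i) * n i j * g x u j) = fun u =>
      (conj (y i) * n i j * x j * ((√(a i) * √(a j) : ℝ) : ℂ)) *
        ((Real.exp (-(a i + a j) * u) : ℝ) : ℂ) := by
    intro i j
    funext u
    simp only [g, map_mul, Complex.conj_ofReal]
    rw [show -(a i + a j) * u = -a i * u + -a j * u by ring, Real.exp_add]
    push_cast
    ring
  have hti : ∀ i j, IntegrableOn (fun u => conj (g y u i) * n i j * g x u j) (Ioi 0) := by
    intro i j
    rw [hterm]
    exact ((hexp _ (by linarith [ha i, ha j])).ofReal (𝕜 := ℂ)).const_mul _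
  have hmain : ∫ u in Ioi (0 : ℝ), ∑ i ∈ F, ∑ j ∈ F, conj (g y u i) * n i j * g x u j =
      ∑ i ∈ F, ∑ j ∈ F, conj (y i) *
        (((√(a i) * √(a j) / (a i + a j) : ℝ) : ℂ) * n i j) * x j := by
    rw [integral_finsetSum _ fun i _ => integrable_finsetSum _ fun j _ => hti i j]
    refine Finset.sum_congr rfl fun i _ => ?_
    rw [integral_finsetSum _ fun j _ => hti i j]
    refine Finset.sum_congr rfl fun j _ => ?_
    rw [hterm, integral_const_mul, integral_complex_ofReal, hint _ (by linarith [ha i, ha j])]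
    push_cast
    ring
  rw [← hmain]
  have hb : IntegrableOn (fun u => K * (∑ i ∈ F, ‖g x u i‖ ^ 2 + ∑ i ∈ F, ‖g y u i‖ ^ 2))
      (Ioi 0) := ((hg x).1.add (hg y).1).const_mul K
  refine (norm_integral_le_of_norm_le hb (Filter.Eventually.of_forall fun u => hn F _ _)).trans ?_
  rw [integral_const_mul, integral_add (hg x).1 (hg y).1, (hg x).2, (hg y).2]
  have : 0 ≤ ∑ i ∈ F, ‖x i‖ ^ 2 := by positivity
  have : 0 ≤ ∑ i ∈ F, ‖y i‖ ^ 2 := by positivity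
  gcongr <;> linarith

open Complex in
/-- Interpolation between conjugation by `a ^ N` and by `a ^ (-N)`. -/
lemma BddMat.interpolate {n : ι → ι → ℂ} {a : ι → ℝ} (ha : ∀ i, 0 < a i) {N : ℝ} (hN : 0 < N)
    (h₁ : BddMat fun i j => (((a i / a j) ^ N : ℝ) : ℂ) * n i j)
    (h₂ : BddMat fun i j => (((a i / a j) ^ (-N) : ℝ) : ℂ) * n i j) {r : ℝ} (hr : |r| ≤ N) :
    BddMat fun i j => (((a i / a j) ^ r : ℝ) : ℂ) * n i j := by
  obtain ⟨K₁, hK₁, h₁⟩ := h₁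
  obtain ⟨K₂, hK₂, h₂⟩ := h₂
  refine ⟨K₁ + K₂, by positivity, fun F x y => ?_⟩
  set S := ∑ i ∈ F, ‖x i‖ ^ 2 + ∑ i ∈ F, ‖y i‖ ^ 2 with hS
  have hS0 : 0 ≤ S := by positivity
  let f : ℂ → ℂ := fun z => ∑ i ∈ F, ∑ j ∈ F,
    conj (y i) * (exp (z * (Real.log (a i / a j) : ℝ)) * n i j) * x j
  have hdiff : Differentiable ℂ f := by
    refine Differentiable.fun_sum fun i _ => Differentiable.fun_sum fun j _ => ?_
    fun_prop
  have hreal : ∀ (t : ℝ) i j, exp ((t : ℂ) * (Real.log (a i / a j) : ℝ)) =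
      (((a i / a j) ^ t : ℝ) : ℂ) := by
    intro t i j
    rw [Real.rpow_def_of_pos (div_pos (ha i) (ha j)), ← ofReal_mul, ← ofReal_exp, mul_comm]
  have hline : ∀ (t : ℝ) (K : ℝ), 0 < K → (∀ (F : Finset ι) (x y : ι → ℂ),
      ‖∑ i ∈ F, ∑ j ∈ F, conj (y i) * ((((a i / a j) ^ t : ℝ) : ℂ) * n i j) * x j‖ ≤
        K * (∑ i ∈ F, ‖x i‖ ^ 2 + ∑ i ∈ F, ‖y i‖ ^ 2)) → ∀ z : ℂ, z.re = t → ‖f z‖ ≤ K * S := by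
    intro t K hK h z hz
    -- On a vertical line, the entries at `z` and at `Re z` differ by the unimodular diagonal
    -- factors `(a i)^{i Im z}` and `(a j)^{-i Im z}`. These are absorbed into the test vectors
    -- without changing their norms.
    let u : ι → ℂ := fun i => exp ((z.im * Real.log (a i) : ℝ) * I)
    have hu : ∀ i, ‖u i‖ = 1 := fun i => norm_exp_ofReal_mul_I _
    have hcu : ∀ i, conj (u i) = exp (-((z.im * Real.log (a i) : ℝ) * I)) := fun i => by
      rw [← exp_conj]; simp
    have := h F (fun j => conj (u j) * x j) (fun i => conj (u i) * y i)
    simp only [norm_mul, RCLike.norm_conj, hu, one_mul] at this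
    convert this using 3 with i _
    refine Finset.sum_congr rfl fun j _ => ?_
    rw [← hreal, map_mul, conj_conj, hcu]
    have e : exp (z * (Real.log (a i / a j) : ℝ)) = exp ((t : ℂ) * (Real.log (a i / a j) : ℝ)) *
        (u i * exp (-((z.im * Real.log (a j) : ℝ) * I))) := by
      simp only [u]
      rw [← exp_add, ← exp_add]
      congr 1
      conv_lhs => rw [← re_add_im z, hz]
      rw [Real.log_div (ha i).ne' (ha j).ne']
      push_cast
      ring
    rw [e]
    ring
  obtain ⟨B, hbdd⟩ : ∃ B, ∀ z : ℂ, |z.re| ≤ N → ‖f z‖ ≤ B := by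
    refine ⟨∑ i ∈ F, ∑ j ∈ F,
      ‖y i‖ * (Real.exp (N * |Real.log (a i / a j)|) * ‖n i j‖) * ‖x j‖, fun z hz => ?_⟩
    refine (norm_sum_le _ _).trans (Finset.sum_le_sum fun i _ => (norm_sum_le _ _).trans
      (Finset.sum_le_sum fun j _ => ?_))
    rw [norm_mul, norm_mul, norm_mul, RCLike.norm_conj, norm_exp]
    gcongr
    rw [re_mul_ofReal]
    refine (le_abs_self _).trans ?_
    rw [abs_mul]
    gcongr
  have hfr : ‖f r‖ ≤ (K₁ + K₂) * S := by
    -- The growth condition holds with both constants zero: for a fixed finite `F` the function is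
    -- bounded on the strip by `B`. That `B` depends on `F` is harmless, as only the bounds on the
    -- two edges survive.
    refine PhragmenLindelof.vertical_strip (a := -N) (b := N) hdiff.diffContOnCl
      ⟨0, div_pos Real.pi_pos (by linarith), 0, ?_⟩
      (fun z hz => (hline _ K₂ hK₂ h₂ z hz).trans (by gcongr; linarith))
      (fun z hz => (hline _ K₁ hK₁ h₁ z hz).trans (by gcongr; linarith))
      (by simpa using (abs_le.1 hr).1) (by simpa using (abs_le.1 hr).2)
    refine Asymptotics.IsBigO.of_bound B (Filter.eventually_inf_principal.2
      (Filter.Eventually.of_forall fun z hz => ?_))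
    simp only [zero_mul, Real.exp_zero, norm_one, mul_one]
    exact hbdd z (abs_le.2 ⟨hz.1.le, hz.2.le⟩)
  convert hfr using 2
  simp only [f]
  refine Finset.sum_congr rfl fun i _ => Finset.sum_congr rfl fun j _ => ?_
  rw [hreal]

/-- The matrix `n` is smooth for the derivation `[a, ·]`, where `a` is a diagonal matrix. -/
def SmoothMat (a : ι → ℝ) (n : ι → ι → ℂ) : Prop :=
  ∀ k : ℕ, BddMat fun i j => (((a i - a j) ^ k : ℝ) : ℂ) * n i j

namespace SmoothMat

variable {a p : ι → ℝ} {m n : ι → ι → ℂ}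

lemma bddMat (h : SmoothMat a n) : BddMat n := by simpa using h 0

lemma add (hm : SmoothMat a m) (hn : SmoothMat a n) : SmoothMat a fun i j => m i j + n i j :=
  fun k => by simpa [mul_add] using (hm k).add (hn k)

lemma const_mul (hn : SmoothMat a n) (c : ℂ) : SmoothMat a fun i j => c * n i j :=
  fun k => by simpa [mul_left_comm] using (hn k).const_mul c

lemma diag_mul (hn : SmoothMat a n) {g : ι → ℝ} {c : ℝ} (hg : ∀ i, |g i| ≤ c) :
    SmoothMat a fun i j => (g i : ℂ) * n i j :=
  fun k => by simpa [mul_left_comm] using (hn k).diag_mul hg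

lemma mul_diag (hn : SmoothMat a n) {g : ι → ℝ} {c : ℝ} (hg : ∀ i, |g i| ≤ c) :
    SmoothMat a fun i j => n i j * (g j : ℂ) :=
  fun k => by simpa [mul_assoc] using (hn k).mul_diag hg

lemma commutator (hn : SmoothMat a n) : SmoothMat a fun i j => ((a i - a j : ℝ) : ℂ) * n i j :=
  fun k => by simpa [pow_succ, mul_assoc] using hn (k + 1)

lemma commutator_pow (hn : SmoothMat a n) (k : ℕ) :
    SmoothMat a fun i j => (((a i - a j) ^ k : ℝ) : ℂ) * n i j :=
  fun l => by simpa [pow_add, mul_assoc] using hn (l + k)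

/-- Smoothness only depends on the diagonal matrix up to a bounded perturbation. -/
lemma of_bounded_sub (hn : SmoothMat p n) {c : ℝ} (hc : ∀ i, |a i - p i| ≤ c) :
    SmoothMat a n := by
  intro k
  induction k generalizing n with
  | zero => simpa using hn.bddMat
  | succ k ih =>
    -- This is `[a, n] = [p, n] + (a - p) n - n (a - p)`, which is again smooth for `p`, so the
    -- induction continues.
    have h := (hn.commutator.add (hn.diag_mul hc)).add ((hn.mul_diag hc).const_mul (-1))
    convert ih h using 3 with i j
    push_cast
    ring

/-- Conjugation is a commutator in disguise: `a n a⁻¹ = n + [a, n] a⁻¹`, where `a⁻¹` is bounded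
because `a ≥ 1`. -/
lemma div (hn : SmoothMat a n) (ha : ∀ i, 1 ≤ a i) :
    SmoothMat a fun i j => ((a i / a j : ℝ) : ℂ) * n i j := by
  have hinv : ∀ i, |(a i)⁻¹| ≤ 1 := fun i => by
    rw [abs_of_pos (inv_pos.2 (one_pos.trans_le (ha i)))]
    exact inv_le_one_of_one_le₀ (ha i)
  convert hn.add (hn.commutator.mul_diag hinv) using 3 with i j
  have : (a j : ℂ) ≠ 0 := by exact_mod_cast (one_pos.trans_le (ha j)).ne'
  push_cast
  field_simp
  ring

lemma div' (hn : SmoothMat a n) (ha : ∀ i, 1 ≤ a i) :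
    SmoothMat a fun i j => ((a j / a i : ℝ) : ℂ) * n i j := by
  have hinv : ∀ i, |(a i)⁻¹| ≤ 1 := fun i => by
    rw [abs_of_pos (inv_pos.2 (one_pos.trans_le (ha i)))]
    exact inv_le_one_of_one_le₀ (ha i)
  convert hn.add ((hn.commutator.diag_mul hinv).const_mul (-1)) using 3 with i j
  have : (a i : ℂ) ≠ 0 := by exact_mod_cast (one_pos.trans_le (ha i)).ne'
  push_cast
  field_simp
  ring

lemma div_pow (hn : SmoothMat a n) (ha : ∀ i, 1 ≤ a i) (N : ℕ) :
    SmoothMat a fun i j => (((a i / a j) ^ N : ℝ) : ℂ) * n i j := by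
  induction N with
  | zero => simpa using hn
  | succ N ih => simpa [pow_succ', mul_assoc] using ih.div ha

lemma div_pow' (hn : SmoothMat a n) (ha : ∀ i, 1 ≤ a i) (N : ℕ) :
    SmoothMat a fun i j => (((a j / a i) ^ N : ℝ) : ℂ) * n i j := by
  induction N with
  | zero => simpa using hn
  | succ N ih => simpa [pow_succ', mul_assoc] using ih.div' ha

/-- Integer powers in both directions come from iterating `div` and `div'`; a real exponent lies
between two of them, and interpolation does the rest. -/
lemma div_rpow (hn : SmoothMat a n) (ha : ∀ i, 1 ≤ a i) (r : ℝ) :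
    BddMat fun i j => (((a i / a j) ^ r : ℝ) : ℂ) * n i j := by
  obtain ⟨N, hN⟩ := exists_nat_ge |r|
  have ha0 : ∀ i, 0 < a i := fun i => one_pos.trans_le (ha i)
  -- The successor keeps the strip of positive width even when `N = 0`.
  refine BddMat.interpolate (N := (N + 1 : ℕ)) ha0 (by positivity) ?_ ?_
    (hN.trans (by push_cast; linarith))
  · simp only [Real.rpow_natCast]
    exact (hn.div_pow ha (N + 1)).bddMat
  · convert (hn.div_pow' ha (N + 1)).bddMat using 5 with i j
    rw [Real.rpow_neg (div_pos (ha0 i) (ha0 j)).le, Real.rpow_natCast, ← inv_pow, inv_div]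

/-- The iterated commutators of `a²` with a smooth matrix have the expected order. -/
lemma sq_commutator (hn : SmoothMat a n) (ha : ∀ i, 1 ≤ a i) (r : ℝ) (k : ℕ) :
    BddMat fun i j =>
      ((a i ^ r * (a i ^ 2 - a j ^ 2) ^ k * a j ^ (-(r + k)) : ℝ) : ℂ) * n i j := by
  have ha0 : ∀ i, 0 < a i := fun i => one_pos.trans_le (ha i)
  -- The weight factors as `(a i / a j)^r (a i / a j + 1)^k (a i - a j)^k`. The last two factors
  -- preserve smoothness, and the first is handled by `div_rpow`.
  have h₁ : ∀ l : ℕ, SmoothMat a fun i j =>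
      (((a i / a j + 1) ^ l : ℝ) : ℂ) * ((((a i - a j) ^ k : ℝ) : ℂ) * n i j) := by
    intro l
    induction l with
    | zero => simpa using hn.commutator_pow k
    | succ l ih =>
      convert (ih.div ha).add ih using 3 with i j
      push_cast
      ring
  convert (h₁ k).div_rpow ha r using 3 with i j
  rw [← mul_assoc, ← mul_assoc, ← Complex.ofReal_mul, ← Complex.ofReal_mul]
  congr 2
  have hj := ha0 j
  rw [Real.div_rpow (ha0 i).le hj.le, Real.rpow_neg hj.le, Real.rpow_add hj, Real.rpow_natCast,
    sq_sub_sq, mul_pow, div_add_one hj.ne', _root_.div_pow]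
  have := (Real.rpow_pos_of_pos hj r).ne'
  field_simp

/-- The exponent `r = -k/2` distributes the order `k` evenly over rows and columns. This is the form
that is compatible with Schur multipliers and Kronecker products. -/
lemma sq_commutator_symm (hn : SmoothMat a n) (ha : ∀ i, 1 ≤ a i) (k : ℕ) :
    BddMat fun i j => (((a i ^ 2 - a j ^ 2) ^ k / (√(a i) * √(a j)) ^ k : ℝ) : ℂ) * n i j := by
  have ha0 : ∀ i, 0 < a i := fun i => one_pos.trans_le (ha i)
  convert hn.sq_commutator ha (-(k / 2)) k using 5 with i j
  have hr : ∀ i, a i ^ (-(k / 2 : ℝ)) = (√(a i) ^ k)⁻¹ := fun i => by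
    rw [Real.rpow_neg (ha0 i).le, Real.sqrt_eq_rpow, ← Real.rpow_natCast,
      ← Real.rpow_mul (ha0 i).le]
    ring_nf
  rw [hr, show -(-(k / 2 : ℝ) + k) = -(k / 2 : ℝ) by ring, hr, mul_pow]
  field_simp

/-- Multiplying `(a i ^ 2 - a j ^ 2) / √(a i a j)` by the Schur kernel `√(a i a j) / (a i + a j)`
leaves `a i - a j`, so `k` applications of `BddMat.schur` turn the hypothesis into the desired
bound. -/
lemma of_sq_commutator (ha : ∀ i, 0 < a i)
    (h : ∀ k : ℕ, BddMat fun i j =>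
      (((a i ^ 2 - a j ^ 2) ^ k / (√(a i) * √(a j)) ^ k : ℝ) : ℂ) * n i j) :
    SmoothMat a n := by
  intro k
  have h₁ : ∀ (l : ℕ) (m : ι → ι → ℂ), BddMat m → BddMat fun i j =>
      (((√(a i) * √(a j) / (a i + a j)) ^ l : ℝ) : ℂ) * m i j := by
    intro l m hm
    induction l with
    | zero => simpa using hm
    | succ l ih => simpa [pow_succ', mul_assoc] using ih.schur ha
  convert h₁ k _ (h k) using 3 with i j
  rw [← mul_assoc, ← Complex.ofReal_mul]
  congr 2
  have hi := Real.sqrt_pos.2 (ha i)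
  have hj := Real.sqrt_pos.2 (ha j)
  have hij : a i + a j ≠ 0 := (add_pos (ha i) (ha j)).ne'
  rw [sq_sub_sq, _root_.div_pow, mul_pow (a i + a j)]
  have : (√(a i) * √(a j)) ≠ 0 := (mul_pos hi hj).ne'
  field_simp

end SmoothMat

end Matrices

/-! ### Matrix coefficients of vectors and operators in a Hilbert basis. -/

section Coefficients

open ComplexConjugate

variable {H : Type*} [NormedAddCommGroup H] [InnerProductSpace ℂ H] {ι : Type*}
  (b : HilbertBasis ι ℂ H)

lemma coef_ext {x y : H} (h : ∀ i, inner ℂ (b i) x = inner ℂ (b i) y) : x = y := by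
  apply b.repr.injective
  ext i
  rw [b.repr_apply_apply, b.repr_apply_apply, h i]

lemma hasSum_norm_sq_coef (x : H) : HasSum (fun i => ‖inner ℂ (b i) x‖ ^ 2) (‖x‖ ^ 2) := by
  have h := lp.hasSum_norm (p := 2) (by norm_num) (b.repr x)
  simpa [b.repr_apply_apply] using h

lemma exists_coef_of_summable {c : ι → ℂ} (h : Summable fun i => ‖c i‖ ^ 2) :
    ∃ w : H, ∀ i, inner ℂ (b i) w = c i := by
  have hc : Memℓp c 2 := memℓp_gen (by simpa using h)
  refine ⟨b.repr.symm ⟨c, hc⟩, fun i => ?_⟩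
  rw [← b.repr_apply_apply]
  simp

lemma exists_coef_of_le {c : ι → ℂ} (K : ℝ) (w' : H) (h : ∀ i, ‖c i‖ ≤ K * ‖inner ℂ (b i) w'‖) :
    ∃ w : H, ∀ i, inner ℂ (b i) w = c i := by
  refine exists_coef_of_summable b (.of_nonneg_of_le (fun i => by positivity) (fun i => ?_)
    ((hasSum_norm_sq_coef b w').summable.mul_left (K ^ 2)))
  rw [← mul_pow]
  exact pow_le_pow_left₀ (norm_nonneg _) (h i) 2

lemma inner_basis [DecidableEq ι] (i j : ι) : inner ℂ (b i) (b j) = if i = j then (1 : ℂ) else 0 :=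
  orthonormal_iff_ite.1 b.orthonormal i j

lemma norm_sq_sum_smul (F : Finset ι) (x : ι → ℂ) :
    ‖∑ i ∈ F, x i • b i‖ ^ 2 = ∑ i ∈ F, ‖x i‖ ^ 2 := by
  have h := b.orthonormal.inner_sum x x F
  rw [inner_self_eq_norm_sq_to_K] at h
  have h' : ((‖∑ i ∈ F, x i • b i‖ ^ 2 : ℝ) : ℂ) = ((∑ i ∈ F, ‖x i‖ ^ 2 : ℝ) : ℂ) := by
    push_cast
    rw [show ((‖∑ i ∈ F, x i • b i‖ : ℝ) : ℂ) ^ 2 = _ from h]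
    exact Finset.sum_congr rfl fun i _ => by rw [Complex.conj_mul']
  exact_mod_cast h'

/-- The matrix coefficients of an operator in a Hilbert basis. -/
def mat (T : H →L[ℂ] H) (i j : ι) : ℂ :=
  inner ℂ (b i) (T (b j))

lemma hasSum_mat (T : H →L[ℂ] H) (x : H) (i : ι) :
    HasSum (fun j => mat b T i j * inner ℂ (b j) x) (inner ℂ (b i) (T x)) := by
  have h := ((b.hasSum_repr x).mapL T).mapL (innerSL ℂ (b i))
  simpa [b.repr_apply_apply, mat, mul_comm] using h

lemma bddMat_mat (T : H →L[ℂ] H) : BddMat (mat b T) := by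
  refine ⟨‖T‖ + 1, by positivity, fun F x y => ?_⟩
  have e : ∑ i ∈ F, ∑ j ∈ F, conj (y i) * mat b T i j * x j =
      inner ℂ (∑ i ∈ F, y i • b i) (T (∑ j ∈ F, x j • b j)) := by
    rw [sum_inner]
    refine Finset.sum_congr rfl fun i _ => ?_
    rw [map_sum, inner_sum]
    refine Finset.sum_congr rfl fun j _ => ?_
    rw [map_smul, inner_smul_left, inner_smul_right, mat]
    ring
  rw [e, ← norm_sq_sum_smul b F x, ← norm_sq_sum_smul b F y]
  set u := ∑ i ∈ F, x i • b i
  set v := ∑ i ∈ F, y i • b i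
  calc ‖inner ℂ v (T u)‖ ≤ ‖v‖ * ‖T u‖ := norm_inner_le_norm _ _
    _ ≤ ‖v‖ * (‖T‖ * ‖u‖) := by gcongr; exact T.le_opNorm u
    _ = ‖T‖ * (‖u‖ * ‖v‖) := by ring
    _ ≤ (‖T‖ + 1) * (‖u‖ ^ 2 + ‖v‖ ^ 2) := by
        gcongr
        · linarith
        · nlinarith [sq_nonneg (‖u‖ - ‖v‖), norm_nonneg u, norm_nonneg v]

/-- The additive bound on the sesquilinear form is not homogeneous; testing it against `n x` itself,
with a suitable rescaling of `x`, recovers a genuine operator norm bound uniform in the truncation.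
-/
lemma BddMat.exists_column_bound {n : ι → ι → ℂ} (hn : BddMat n) :
    ∃ M : ℝ, 0 ≤ M ∧ ∀ (F : Finset ι) (x : ι → ℂ),
      ∑ i ∈ F, ‖∑ j ∈ F, n i j * x j‖ ^ 2 ≤ M * ∑ j ∈ F, ‖x j‖ ^ 2 := by
  obtain ⟨K, hK, hn⟩ := hn
  refine ⟨4 * K ^ 2, by positivity, fun F x => ?_⟩
  set v : ι → ℂ := fun i => ∑ j ∈ F, n i j * x j with hv
  -- With this scaling the inequality reads `2K‖v‖² ≤ K(4K²‖x‖² + ‖v‖²)`, so half of the left side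
  -- absorbs the `‖v‖²` on the right.
  have h := hn F (fun j => (2 * K : ℝ) * x j) v
  have e : ∑ i ∈ F, ∑ j ∈ F, conj (v i) * n i j * ((2 * K : ℝ) * x j) =
      ((2 * K * ∑ i ∈ F, ‖v i‖ ^ 2 : ℝ) : ℂ) := by
    rw [Finset.mul_sum]
    push_cast
    refine Finset.sum_congr rfl fun i _ => ?_
    rw [← Complex.conj_mul' (v i)]
    conv_rhs => rw [hv]
    simp only [Finset.mul_sum]
    exact Finset.sum_congr rfl fun j _ => by ring
  rw [e, Complex.norm_real, Real.norm_of_nonneg (by positivity)] at h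
  have e₂ : ∑ i ∈ F, ‖((2 * K : ℝ) : ℂ) * x i‖ ^ 2 = 4 * K ^ 2 * ∑ i ∈ F, ‖x i‖ ^ 2 := by
    rw [Finset.mul_sum]
    refine Finset.sum_congr rfl fun i _ => ?_
    rw [norm_mul, Complex.norm_real, Real.norm_of_nonneg (by positivity)]
    ring
  rw [e₂] at h
  have : 2 * ∑ i ∈ F, ‖v i‖ ^ 2 ≤ 4 * K ^ 2 * ∑ i ∈ F, ‖x i‖ ^ 2 + ∑ i ∈ F, ‖v i‖ ^ 2 :=
    le_of_mul_le_mul_left (by linarith) hK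
  linarith

/-- A bounded matrix is the matrix of a bounded operator. -/
lemma BddMat.exists_op [CompleteSpace H] {n : ι → ι → ℂ} (hn : BddMat n) :
    ∃ C : H →L[ℂ] H, ∀ i j, mat b C i j = n i j := by
  classical
  obtain ⟨M, hM, h⟩ := hn.exists_column_bound
  -- Testing the bound on the `j`-th unit vector shows that each column is square summable. The
  -- operator is then defined on finite combinations by sending `b j` to its column, and extended by
  -- continuity.
  have hcol : ∀ j, ∃ w : H, ∀ i, inner ℂ (b i) w = n i j := by
    intro j
    refine exists_coef_of_summable b (summable_of_sum_le (c := M) (fun i => by positivity) ?_)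
    intro F
    have := h (insert j F) (Pi.single j 1)
    simp only [Pi.single_apply, mul_ite, mul_one, mul_zero, Finset.sum_ite_eq',
      Finset.mem_insert_self, if_true] at this
    refine (Finset.sum_le_sum_of_subset_of_nonneg (Finset.subset_insert j F)
      fun i _ _ => by positivity).trans (this.trans ?_)
    rw [Finset.sum_eq_single j] <;> simp +contextual
  choose c hc using hcol
  have hdense : DenseRange (Finsupp.linearCombination ℂ b) := by
    have := b.dense_span
    rw [← Finsupp.range_linearCombination, ← Submodule.dense_iff_topologicalClosure_eq_top] at this
    exact this
  have hnorm : ∀ x, ‖Finsupp.linearCombination ℂ c x‖ ≤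
      √M * ‖Finsupp.linearCombination ℂ b x‖ := by
    intro x
    rw [← Real.sqrt_sq (norm_nonneg (Finsupp.linearCombination ℂ b x)), ← Real.sqrt_mul hM]
    refine Real.le_sqrt_of_sq_le ?_
    refine hasSum_le_of_sum_le (hasSum_norm_sq_coef b _) fun F => ?_
    refine (Finset.sum_le_sum_of_subset_of_nonneg (Finset.subset_union_left (s₂ := x.support))
      fun i _ _ => by positivity).trans ?_
    have e₁ : Finsupp.linearCombination ℂ b x = ∑ j ∈ F ∪ x.support, x j • b j := by
      rw [Finsupp.linearCombination_apply]
      exact Finsupp.sum_of_support_subset _ Finset.subset_union_right _ (by simp)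
    have e₂ : ∀ i, inner ℂ (b i) (Finsupp.linearCombination ℂ c x) =
        ∑ j ∈ F ∪ x.support, n i j * x j := by
      intro i
      rw [Finsupp.linearCombination_apply,
        Finsupp.sum_of_support_subset _ Finset.subset_union_right _ (by simp), inner_sum]
      exact Finset.sum_congr rfl fun j _ => by rw [inner_smul_right, hc, mul_comm]
    rw [e₁, norm_sq_sum_smul]
    simp only [e₂]
    exact h _ _
  refine ⟨(Finsupp.linearCombination ℂ c).extendOfNorm (Finsupp.linearCombination ℂ b),
    fun i j => ?_⟩
  have := LinearMap.extendOfNorm_eq hdense ⟨_, hnorm⟩ (Finsupp.single j 1)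
  rw [Finsupp.linearCombination_single, Finsupp.linearCombination_single, one_smul, one_smul]
    at this
  rw [mat, this, hc]

end Coefficients

/-! ### Maximal diagonal operators and commutators with them. -/

section Diagonal

variable {H : Type*} [NormedAddCommGroup H] [InnerProductSpace ℂ H] {ι : Type*}
  {b : HilbertBasis ι ℂ H}

/-- The operator `S` is the maximal diagonal operator with eigenvalues `s` in the basis `b`. -/
def IsDiag (S : H →ₗ.[ℂ] H) (b : HilbertBasis ι ℂ H) (s : ι → ℝ) : Prop :=
  ∀ x w : H, (x, w) ∈ S.graph ↔ ∀ i, inner ℂ (b i) w = s i * inner ℂ (b i) x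

namespace IsDiag

variable {S : H →ₗ.[ℂ] H} {s : ι → ℝ}

lemma inner_apply (hS : IsDiag S b s) (x : S.domain) (i : ι) :
    inner ℂ (b i) (S x) = s i * inner ℂ (b i) (x : H) :=
  (hS _ _).1 (S.mem_graph x) i

lemma exists_apply_eq (hS : IsDiag S b s) {x w : H}
    (h : ∀ i, inner ℂ (b i) w = s i * inner ℂ (b i) x) :
    ∃ hx : x ∈ S.domain, S ⟨x, hx⟩ = w := by
  obtain ⟨y, rfl, rfl⟩ := (S.mem_graph_iff).1 ((hS x w).2 h)
  exact ⟨y.2, rfl⟩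

lemma exists_apply_basis (hS : IsDiag S b s) (j : ι) :
    ∃ hx : b j ∈ S.domain, S ⟨b j, hx⟩ = (s j : ℂ) • b j := by
  classical
  refine hS.exists_apply_eq fun i => ?_
  rw [inner_smul_right, inner_basis]
  split_ifs with h
  · rw [h]
  · simp

/-- Evaluation on basis vectors gives the entries. Conversely, the entries show that `T (S x) + C x`
has the coefficients that `S (T x)` should have, and maximality of the domain puts `T x` in it. -/
lemma isBoundedCommutator_iff (hS : IsDiag S b s) {T C : H →L[ℂ] H} :
    IsBoundedCommutator S T C ↔ ∀ i j, mat b C i j = ((s i - s j : ℝ) : ℂ) * mat b T i j := by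
  constructor
  · intro h i j
    obtain ⟨hj, hj'⟩ := hS.exists_apply_basis j
    obtain ⟨hx, hx'⟩ := h ⟨b j, hj⟩
    have := congrArg (inner ℂ (b i)) hx'
    rw [inner_sub_right, hS.inner_apply, hj', map_smul, inner_smul_right] at this
    rw [mat, ← this]
    simp only [mat]
    push_cast
    ring
  · intro h x
    have key : ∀ i, inner ℂ (b i) (T (S x) + C x) = s i * inner ℂ (b i) (T x) := by
      intro i
      rw [inner_add_right]
      refine ((hasSum_mat b T (S x) i).add (hasSum_mat b C x i)).unique ?_
      refine ((hasSum_mat b T x i).mul_left (s i : ℂ)).congr_fun fun j => ?_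
      rw [hS.inner_apply, h]
      push_cast
      ring
    obtain ⟨hx, hx'⟩ := hS.exists_apply_eq key
    exact ⟨hx, by rw [hx']; abel⟩

/-- Each application of the derivation multiplies the entries by `s i - s j`, and every bounded
matrix comes from an operator, so the iterated commutators exist as soon as their matrices are
bounded. -/
lemma inDomInfty_iff [CompleteSpace H] (hS : IsDiag S b s) {T : H →L[ℂ] H} :
    InDomInfty S T ↔ SmoothMat s (mat b T) := by
  constructor
  · intro h k
    have h' := h k
    clear h
    induction k generalizing T with
    | zero => simpa using bddMat_mat b T
    | succ k ih =>
      obtain ⟨C, hC, hC'⟩ := h'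
      convert ih hC' using 3 with i j
      rw [hS.isBoundedCommutator_iff.1 hC i j, pow_succ]
      push_cast
      ring
  · intro h k
    induction k generalizing T with
    | zero => trivial
    | succ k ih =>
      obtain ⟨C, hC⟩ := h.commutator.bddMat.exists_op b
      refine ⟨C, hS.isBoundedCommutator_iff.2 hC, ih ?_⟩
      convert h.commutator using 2 with i j
      exact funext fun j => hC _ j

end IsDiag

end Diagonal

/-! ### Diagonalisation of self-adjoint operators with compact resolvent. -/

section SelfAdjoint

variable {H : Type*} [NormedAddCommGroup H] [InnerProductSpace ℂ H]

lemma mem_eigenspace {D : H →ₗ.[ℂ] H} {t : ℝ} {x : H} :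
    x ∈ eigenspace D t ↔ ∃ hx : x ∈ D.domain, D ⟨x, hx⟩ = (t : ℂ) • x := by
  constructor
  · rintro ⟨y, hy, rfl⟩
    exact ⟨y.2, sub_eq_zero.1 hy⟩
  · rintro ⟨hx, h⟩
    exact ⟨⟨x, hx⟩, sub_eq_zero.2 h, rfl⟩

lemma isClosed_eigenspace {D : H →ₗ.[ℂ] H} (hD : D.IsClosed) (t : ℝ) :
    IsClosed (eigenspace D t : Set H) := by
  have : (eigenspace D t : Set H) = (fun x : H => (x, (t : ℂ) • x)) ⁻¹' (D.graph : Set (H × H)) := by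
    ext x
    rw [SetLike.mem_coe, mem_eigenspace, Set.mem_preimage, SetLike.mem_coe, D.mem_graph_iff]
    constructor
    · rintro ⟨hx, h⟩
      exact ⟨⟨x, hx⟩, rfl, h⟩
    · rintro ⟨⟨y, hy⟩, rfl, h⟩
      exact ⟨hy, h⟩
  rw [this]
  exact IsClosed.preimage (by fun_prop) hD

/-- The factorisation `D² - t² = (D - t)(D + t)`: the two components of `x` are `(x ± t⁻¹ D x) / 2`.
-/
lemma mem_eigenspace_sup {D : H →ₗ.[ℂ] H} {x : H} (hx : x ∈ D.domain)
    (hx' : D ⟨x, hx⟩ ∈ D.domain) {t : ℝ} (ht : t ≠ 0)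
    (h : D ⟨D ⟨x, hx⟩, hx'⟩ = ((t ^ 2 : ℝ) : ℂ) • x) :
    x ∈ eigenspace D t ⊔ eigenspace D (-t) := by
  have key : ∀ r : ℝ, r ≠ 0 → r ^ 2 = t ^ 2 → x + (r : ℂ)⁻¹ • D ⟨x, hx⟩ ∈ eigenspace D r := by
    intro r hr hrt
    have hr' : (r : ℂ) ≠ 0 := by exact_mod_cast hr
    refine mem_eigenspace.2 ⟨D.domain.add_mem hx (D.domain.smul_mem _ hx'), ?_⟩
    have e : (⟨x + (r : ℂ)⁻¹ • D ⟨x, hx⟩, D.domain.add_mem hx (D.domain.smul_mem _ hx')⟩ :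
        D.domain) = ⟨x, hx⟩ + (r : ℂ)⁻¹ • ⟨D ⟨x, hx⟩, hx'⟩ := rfl
    rw [e, D.map_add, D.map_smul, h, ← hrt, smul_add, smul_smul, smul_smul, mul_inv_cancel₀ hr',
      one_smul, add_comm]
    congr 2
    push_cast
    field_simp
  have e : x = (2 : ℂ)⁻¹ • (x + (t : ℂ)⁻¹ • D ⟨x, hx⟩) +
      (2 : ℂ)⁻¹ • (x + ((-t : ℝ) : ℂ)⁻¹ • D ⟨x, hx⟩) := by
    push_cast
    rw [inv_neg]
    module
  rw [e]
  exact Submodule.add_mem_sup (Submodule.smul_mem _ _ (key t ht rfl))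
    (Submodule.smul_mem _ _ (key (-t) (neg_ne_zero.2 ht) (by ring)))

variable [CompleteSpace H]

lemma inner_apply_symm {D : H →ₗ.[ℂ] H} (hD : IsSelfAdjoint D) (x y : D.domain) :
    inner ℂ (D x) (y : H) = inner ℂ (x : H) (D y) := by
  have h := LinearPMap.adjoint_isFormalAdjoint hD.dense_domain
  rw [LinearPMap.isSelfAdjoint_def.1 hD] at h
  exact h x y

/-- The adjoint has the largest domain compatible with the pairing; self-adjointness makes this a
criterion for membership in the graph of `D` itself. -/
lemma mem_graph_of_isSelfAdjoint {D : H →ₗ.[ℂ] H} (hD : IsSelfAdjoint D) {x w : H}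
    (h : ∀ y : D.domain, inner ℂ w (y : H) = inner ℂ x (D y)) : (x, w) ∈ D.graph := by
  have hx : x ∈ D.adjoint.domain := LinearPMap.mem_adjoint_domain_of_exists x ⟨w, h⟩
  have : (x, w) ∈ D.adjoint.graph := by
    rw [← LinearPMap.adjoint_apply_eq hD.dense_domain ⟨x, hx⟩ h]
    exact D.adjoint.mem_graph ⟨x, hx⟩
  rwa [LinearPMap.isSelfAdjoint_def.1 hD] at this

lemma eigenspace_orthogonalFamily {D : H →ₗ.[ℂ] H} (hD : IsSelfAdjoint D) :
    OrthogonalFamily ℂ (fun t : ℝ => eigenspace D t) fun t => (eigenspace D t).subtypeₗᵢ := by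
  intro s t hst x y
  obtain ⟨hx, hx'⟩ := mem_eigenspace.1 x.2
  obtain ⟨hy, hy'⟩ := mem_eigenspace.1 y.2
  have h := inner_apply_symm hD ⟨x, hx⟩ ⟨y, hy⟩
  rw [hx', hy', inner_smul_left, inner_smul_right, Complex.conj_ofReal] at h
  have h' : ((s - t : ℝ) : ℂ) * inner ℂ (x : H) (y : H) = 0 := by
    push_cast
    linear_combination h
  rcases mul_eq_zero.1 h' with h' | h'
  · exact absurd (sub_eq_zero.1 (by exact_mod_cast h')) hst
  · exact h'

/-- The eigenspaces of a self-adjoint operator with compact resolvent span a dense subspace. -/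
lemma eq_zero_of_orthogonal_eigenspaces {D : H →ₗ.[ℂ] H} (hD : IsSelfAdjoint D)
    (hc : HasCompactResolvent D) {x : H}
    (hx : ∀ (t : ℝ), ∀ y ∈ eigenspace D t, inner ℂ y x = 0) : x = 0 := by
  obtain ⟨T, hT, hTc, hTD⟩ := hc
  have h := ContinuousLinearMap.orthogonalComplement_iSup_eigenspaces_eq_bot hTc hT.isSymmetric
  rw [← Submodule.mem_bot ℂ, ← h]
  rw [Submodule.mem_orthogonal]
  intro y hy
  induction hy using Submodule.iSup_induction' with
  | zero => simp
  | add y z _ _ hy hz => rw [inner_add_left, hy, hz, add_zero]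
  | mem μ y hy =>
    have hy : T y = μ • y := Module.End.mem_eigenspace_iff.1 hy
    by_cases hy0 : y = 0
    · simp [hy0]
    obtain ⟨h₁, h₂, h₃⟩ := hTD y
    have hTT : T (T y) = μ ^ 2 • y := by rw [hy, map_smul, hy, smul_smul, sq]
    -- `T²` has left inverse `1 + D²`, so it cannot annihilate `y`.
    have hμ : μ ^ 2 ≠ 0 := by
      intro h0
      rw [h0, zero_smul] at hTT
      have e₁ : D ⟨T (T y), h₁⟩ = 0 := by
        have : (⟨T (T y), h₁⟩ : D.domain) = 0 := Subtype.ext hTT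
        rw [this, D.map_zero]
      have e₂ : (⟨D ⟨T (T y), h₁⟩, h₂⟩ : D.domain) = 0 := Subtype.ext e₁
      rw [e₂, D.map_zero, hTT, add_zero] at h₃
      exact hy0 h₃.symm
    have hyT : y = (μ ^ 2)⁻¹ • T (T y) := by rw [hTT, smul_smul, inv_mul_cancel₀ hμ, one_smul]
    have hyD : y ∈ D.domain := by rw [hyT]; exact D.domain.smul_mem _ h₁
    have hDy : D ⟨y, hyD⟩ = (μ ^ 2)⁻¹ • D ⟨T (T y), h₁⟩ := by
      rw [← D.map_smul]
      exact congrArg D (Subtype.ext hyT)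
    have hyD' : D ⟨y, hyD⟩ ∈ D.domain := by rw [hDy]; exact D.domain.smul_mem _ h₂
    have hDDy : D ⟨D ⟨y, hyD⟩, hyD'⟩ = ((μ ^ 2)⁻¹ - 1) • y := by
      have : D ⟨D ⟨y, hyD⟩, hyD'⟩ = (μ ^ 2)⁻¹ • D ⟨D ⟨T (T y), h₁⟩, h₂⟩ := by
        rw [← D.map_smul]
        exact congrArg D (Subtype.ext hDy)
      rw [this, eq_sub_of_add_eq' h₃, hTT, smul_sub, smul_smul, inv_mul_cancel₀ hμ, sub_smul]
    have hn : (‖D ⟨y, hyD⟩‖ : ℂ) ^ 2 = ((μ ^ 2)⁻¹ - 1) * (‖y‖ : ℂ) ^ 2 := by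
      have := inner_apply_symm hD ⟨y, hyD⟩ ⟨D ⟨y, hyD⟩, hyD'⟩
      rw [hDDy, inner_smul_right] at this
      rw [inner_self_eq_norm_sq_to_K] at this
      erw [inner_self_eq_norm_sq_to_K] at this
      exact this
    by_cases h0 : D ⟨y, hyD⟩ = 0
    · exact hx 0 y (mem_eigenspace.2 ⟨hyD, by simpa using h0⟩)
    -- Symmetry gives `‖D y‖² = (μ⁻² - 1)‖y‖²`, so this `t` is a real square root of the eigenvalue
    -- of `D²`, and `y` splits into eigenvectors of `D` for `t` and `-t`.
    · set t : ℝ := ‖D ⟨y, hyD⟩‖ / ‖y‖ with ht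
      have hyn : (‖y‖ : ℂ) ≠ 0 := by exact_mod_cast norm_ne_zero_iff.2 hy0
      have hsq : ((t ^ 2 : ℝ) : ℂ) = (μ ^ 2)⁻¹ - 1 := by
        rw [ht]
        push_cast
        rw [div_pow, hn]
        field_simp
      have ht0 : t ≠ 0 := div_ne_zero (norm_ne_zero_iff.2 h0) (norm_ne_zero_iff.2 hy0)
      obtain ⟨u, hu, v, hv, rfl⟩ := Submodule.mem_sup.1
        (mem_eigenspace_sup hyD hyD' ht0 (by rw [hsq, hDDy]))
      rw [inner_add_left, hx _ u hu, hx _ v hv, add_zero]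

/-- A self-adjoint operator with compact resolvent is diagonal in an orthonormal basis. -/
lemma exists_isDiag.{u} {H : Type u} [NormedAddCommGroup H] [InnerProductSpace ℂ H]
    [CompleteSpace H] {D : H →ₗ.[ℂ] H} (hD : IsSelfAdjoint D) (hc : HasCompactResolvent D) :
    ∃ (ι : Type u) (b : HilbertBasis ι ℂ H) (d : ι → ℝ), IsDiag D b d := by
  have hcl : ∀ t : ℝ, CompleteSpace (eigenspace D t) := fun t =>
    (isClosed_eigenspace hD.isClosed t).completeSpace_coe
  have hb : ∀ t : ℝ, ∃ (w : Set (eigenspace D t)) (b : HilbertBasis w ℂ (eigenspace D t)),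
      ⇑b = ((↑) : w → eigenspace D t) := fun t => exists_hilbertBasis ℂ (eigenspace D t)
  choose w e _ using hb
  have hon := (eigenspace_orthogonalFamily hD).orthonormal_sigma_orthonormal
    (fun t => (e t).orthonormal)
  have hperp : (Submodule.span ℂ (Set.range fun a : Σ t, w t =>
      (eigenspace D a.1).subtypeₗᵢ (e a.1 a.2)))ᗮ = ⊥ := by
    rw [Submodule.eq_bot_iff]
    intro x hx
    rw [Submodule.mem_orthogonal] at hx
    refine eq_zero_of_orthogonal_eigenspaces hD hc fun t y hy => ?_
    have h := (((e t).hasSum_repr ⟨y, hy⟩).mapL (eigenspace D t).subtypeL).mapL (innerSL ℂ x)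
    have h0 : ∀ i, inner ℂ x ((e t i : eigenspace D t) : H) = 0 := fun i => by
      have := hx ((e t i : eigenspace D t) : H) (Submodule.subset_span ⟨⟨t, i⟩, rfl⟩)
      rw [← inner_conj_symm, this, map_zero]
    simp only [map_smul, Submodule.subtypeL_apply, innerSL_apply_apply, h0, smul_zero] at h
    rw [← inner_conj_symm, h.unique hasSum_zero, map_zero]
  let b := HilbertBasis.mkOfOrthogonalEqBot hon hperp
  have hbv : ∀ a : Σ t, w t, ∃ hx : b a ∈ D.domain, D ⟨b a, hx⟩ = (a.1 : ℂ) • b a := by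
    intro a
    have : b a = (e a.1 a.2 : eigenspace D a.1) :=
      congrFun (HilbertBasis.coe_mkOfOrthogonalEqBot hon hperp) a
    rw [← mem_eigenspace, this]
    exact (e a.1 a.2).2
  refine ⟨_, b, fun a => a.1, fun x z => ⟨fun h a => ?_, fun h => ?_⟩⟩
  · obtain ⟨y, rfl, rfl⟩ := D.mem_graph_iff.1 h
    obtain ⟨ha, ha'⟩ := hbv a
    have := inner_apply_symm hD ⟨b a, ha⟩ y
    rw [ha', inner_smul_left, Complex.conj_ofReal] at this
    exact this.symm
  -- The converse inclusion says that the diagonal operator is no larger than `D`: by Parseval, a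
  -- pair with matching coefficients pairs correctly with the whole graph of `D`, and `D` is
  -- self-adjoint.
  · refine mem_graph_of_isSelfAdjoint hD fun y => ?_
    refine (b.hasSum_inner_mul_inner z y).unique ?_
    refine (b.hasSum_inner_mul_inner x (D y)).congr_fun fun a => ?_
    obtain ⟨ha, ha'⟩ := hbv a
    have h₁ := inner_apply_symm hD ⟨b a, ha⟩ y
    rw [ha', inner_smul_left, Complex.conj_ofReal] at h₁
    rw [← inner_conj_symm z, h a, map_mul, Complex.conj_ofReal, inner_conj_symm, ← h₁]
    ring

end SelfAdjoint

/-! ### Self-adjointness and compact resolvent of diagonal operators. -/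

section DiagonalConverse

variable {H : Type*} [NormedAddCommGroup H] [InnerProductSpace ℂ H] {ι : Type*}
  {b : HilbertBasis ι ℂ H} {D : H →ₗ.[ℂ] H} {d : ι → ℝ}

lemma IsDiag.dense_domain (hD : IsDiag D b d) : Dense (D.domain : Set H) := by
  have h : Submodule.span ℂ (Set.range b) ≤ D.domain := by
    rw [Submodule.span_le]
    rintro _ ⟨i, rfl⟩
    exact (hD.exists_apply_basis i).fst
  refine Dense.mono h ?_
  rw [Submodule.dense_iff_topologicalClosure_eq_top]
  exact b.dense_span

lemma IsDiag.isFormalAdjoint (hD : IsDiag D b d) : D.IsFormalAdjoint D := by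
  intro x y
  refine (b.hasSum_inner_mul_inner (D x) y).unique ?_
  refine (b.hasSum_inner_mul_inner x (D y)).congr_fun fun i => ?_
  rw [← inner_conj_symm (D x), hD.inner_apply, hD.inner_apply, map_mul, Complex.conj_ofReal,
    inner_conj_symm]
  ring

lemma IsDiag.isSelfAdjoint [CompleteSpace H] (hD : IsDiag D b d) : IsSelfAdjoint D := by
  rw [LinearPMap.isSelfAdjoint_def]
  refine le_antisymm (LinearPMap.le_of_le_graph ?_)
    (hD.isFormalAdjoint.le_adjoint hD.dense_domain)
  rintro ⟨x, w⟩ h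
  rw [hD]
  intro i
  obtain ⟨y, rfl, rfl⟩ := D.adjoint.mem_graph_iff.1 h
  obtain ⟨hi, hi'⟩ := hD.exists_apply_basis i
  have := LinearPMap.adjoint_isFormalAdjoint hD.dense_domain y ⟨b i, hi⟩
  rw [hi', inner_smul_right] at this
  have := congrArg (starRingEnd ℂ) this
  rwa [map_mul, Complex.conj_ofReal, inner_conj_symm, inner_conj_symm] at this

lemma norm_le_of_coef_le (b : HilbertBasis ι ℂ H) {x y : H} {c : ℝ} (hc : 0 ≤ c)
    (h : ∀ i, ‖inner ℂ (b i) y‖ ≤ c * ‖inner ℂ (b i) x‖) : ‖y‖ ≤ c * ‖x‖ := by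
  refine le_of_sq_le_sq ?_ (by positivity)
  rw [mul_pow]
  refine hasSum_le (fun i => ?_) (hasSum_norm_sq_coef b y) ((hasSum_norm_sq_coef b x).mul_left _)
  rw [← mul_pow]
  exact pow_le_pow_left₀ (norm_nonneg _) (h i) 2

lemma exists_diagOp [CompleteSpace H] (b : HilbertBasis ι ℂ H) {g : ι → ℝ} {c : ℝ}
    (hg : ∀ i, |g i| ≤ c) :
    ∃ T : H →L[ℂ] H, ∀ x i, inner ℂ (b i) (T x) = g i * inner ℂ (b i) x := by
  have h := (bddMat_mat b (ContinuousLinearMap.id ℂ H)).diag_mul hg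
  obtain ⟨T, hT⟩ := h.exists_op b
  refine ⟨T, fun x i => (hasSum_mat b T x i).unique ?_⟩
  refine ((hasSum_mat b (ContinuousLinearMap.id ℂ H) x i).mul_left (g i : ℂ)).congr_fun
    fun j => ?_
  rw [hT, mul_assoc]

/-- Truncating to the finitely many indices with `|g i| ≥ 1/(n+1)` gives finite rank operators at
norm distance at most `1/(n+1)`. -/
lemma isCompactOperator_of_diag [CompleteSpace H] {T : H →L[ℂ] H} {g : ι → ℝ}
    (hT : ∀ x i, inner ℂ (b i) (T x) = g i * inner ℂ (b i) x)
    (hg : ∀ ε > 0, {i | ε ≤ |g i|}.Finite) : IsCompactOperator T := by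
  classical
  have hfin : ∀ n : ℕ, {i | 1 / ((n : ℝ) + 1) ≤ |g i|}.Finite := fun n => hg _ (by positivity)
  let F : ℕ → Finset ι := fun n => (hfin n).toFinset
  let A : ℕ → H →L[ℂ] H := fun n =>
    ∑ i ∈ F n, (ContinuousLinearMap.toSpanSingleton ℂ ((g i : ℂ) • b i)).comp (innerSL ℂ (b i))
  have hA : ∀ n x j, inner ℂ (b j) (A n x) = if j ∈ F n then g j * inner ℂ (b j) x else 0 := by
    intro n x j
    simp only [A, sum_apply, ContinuousLinearMap.comp_apply,
      ContinuousLinearMap.toSpanSingleton_apply, innerSL_apply_apply, inner_sum, inner_smul_right,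
      inner_basis]
    simp [mul_comm]
  have hAc : ∀ n, IsCompactOperator (A n) := by
    intro n
    refine (compactOperator (RingHom.id ℂ) H H).sum_mem fun i _ => ?_
    exact (isCompactOperator_of_locallyCompactSpace_dom (innerSL ℂ (b i))).clm_comp
      (ContinuousLinearMap.toSpanSingleton ℂ ((g i : ℂ) • b i))
  refine isCompactOperator_of_tendsto (F := A) (l := Filter.atTop) ?_
    (Filter.Eventually.of_forall hAc)
  rw [tendsto_iff_norm_sub_tendsto_zero]
  refine squeeze_zero (fun n => norm_nonneg _) (fun n => ?_)
    tendsto_one_div_add_atTop_nhds_zero_nat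
  refine ContinuousLinearMap.opNorm_le_bound _ (by positivity) fun x => ?_
  refine norm_le_of_coef_le b (by positivity) fun i => ?_
  rw [sub_apply, inner_sub_right, hA, hT]
  split_ifs with hi
  · rw [sub_self, norm_zero]; positivity
  · simp only [F, Set.Finite.mem_toFinset, Set.mem_ofPred_eq, not_le] at hi
    rw [zero_sub, norm_neg, norm_mul, Complex.norm_real]
    gcongr
    exact hi.le

/-- The witness is the diagonal operator with entries `(1 + d i ^ 2)^{-1/2}`, which tend to zero
because only finitely many eigenvalues, counted with multiplicity, lie in a bounded interval. -/
lemma IsDiag.hasCompactResolvent [CompleteSpace H] (hD : IsDiag D b d)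
    (hd : ∀ R : ℝ, {i | |d i| ≤ R}.Finite) : HasCompactResolvent D := by
  have hpos : ∀ i, 0 < 1 + d i ^ 2 := fun i => by positivity
  let g : ι → ℝ := fun i => (√(1 + d i ^ 2))⁻¹
  have hg0 : ∀ i, 0 < g i := fun i => inv_pos.2 (Real.sqrt_pos.2 (hpos i))
  have hg1 : ∀ i, |g i| ≤ 1 := fun i => by
    rw [abs_of_pos (hg0 i)]
    refine inv_le_one_of_one_le₀ (Real.one_le_sqrt.2 ?_)
    nlinarith [sq_nonneg (d i)]
  have hg2 : ∀ i, g i * g i = (1 + d i ^ 2)⁻¹ := fun i => by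
    rw [← mul_inv, Real.mul_self_sqrt (hpos i).le]
  obtain ⟨T, hT⟩ := exists_diagOp b hg1
  have hinner : ∀ x y, HasSum (fun i => (g i : ℂ) * (inner ℂ x (b i) * inner ℂ (b i) y))
      (inner ℂ (T x) y) := fun x y => by
    refine (b.hasSum_inner_mul_inner (T x) y).congr_fun fun i => ?_
    rw [← inner_conj_symm (T x), hT, map_mul, Complex.conj_ofReal, inner_conj_symm]
    ring
  refine ⟨T, ⟨fun x y => ?_, fun x => ?_⟩, isCompactOperator_of_diag hT fun ε hε => ?_,
    fun x => ?_⟩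
  · refine (hinner x y).unique ?_
    refine (b.hasSum_inner_mul_inner x (T y)).congr_fun fun i => ?_
    rw [hT]
    ring
  · have := Complex.hasSum_re (hinner x x)
    refine this.nonneg fun i => ?_
    rw [← inner_conj_symm, Complex.conj_mul', ← Complex.ofReal_pow, ← Complex.ofReal_mul,
      Complex.ofReal_re]
    have := (hg0 i).le
    positivity
  · refine (hd ε⁻¹).subset fun i hi => ?_
    rw [Set.mem_ofPred_eq, abs_of_pos (hg0 i)] at hi
    rw [Set.mem_ofPred_eq]
    have h₁ : √(1 + d i ^ 2) ≤ ε⁻¹ := by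
      rw [← inv_inv √(1 + d i ^ 2)]
      exact inv_anti₀ hε hi
    rw [← Real.sqrt_sq_eq_abs]
    exact (Real.sqrt_le_sqrt (by linarith)).trans h₁
  · have hTT : ∀ i, inner ℂ (b i) (T (T x)) = ((1 + d i ^ 2)⁻¹ : ℝ) * inner ℂ (b i) x := fun i => by
      rw [hT, hT, ← mul_assoc, ← Complex.ofReal_mul, hg2]
    have hle : ∀ i, |d i| ≤ 1 + d i ^ 2 := fun i => by
      rw [← sq_abs]
      nlinarith [sq_nonneg (|d i| - 1), abs_nonneg (d i)]
    obtain ⟨w, hw⟩ := exists_coef_of_le b (c := fun i => d i * inner ℂ (b i) (T (T x))) 1 x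
      fun i => by
        rw [hTT, norm_mul, norm_mul, Complex.norm_real, Complex.norm_real, ← mul_assoc]
        gcongr
        rw [norm_inv, Real.norm_of_nonneg (hpos i).le, Real.norm_eq_abs,
          ← div_eq_mul_inv, div_le_one (hpos i)]
        exact hle i
    obtain ⟨h₁, h₁'⟩ := hD.exists_apply_eq hw
    have hw' : ∀ i, inner ℂ (b i) (x - T (T x)) = d i * inner ℂ (b i) w := fun i => by
      have : ((1 : ℂ) + (d i : ℂ) ^ 2) ≠ 0 := by exact_mod_cast (hpos i).ne'
      rw [inner_sub_right, hw, hTT]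
      push_cast
      field_simp
      ring
    obtain ⟨h₂, h₂'⟩ := hD.exists_apply_eq hw'
    subst h₁'
    exact ⟨h₁, h₂, by rw [h₂']; abel⟩

/-- If infinitely many basis vectors had `|d i| ≤ R`, their images under the compact operator `T²`
would be pairwise separated by at least `(1 + R²)⁻¹`, and no subsequence could converge. -/
lemma IsDiag.finite_of_hasCompactResolvent [CompleteSpace H] (hD : IsDiag D b d)
    (hc : HasCompactResolvent D) (R : ℝ) : {i | |d i| ≤ R}.Finite := by
  classical
  obtain ⟨T, -, hTc, hTD⟩ := hc
  have hpos : ∀ i, 0 < 1 + d i ^ 2 := fun i => by positivity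
  have hTT : ∀ x i, inner ℂ (b i) (T (T x)) = ((1 + d i ^ 2)⁻¹ : ℝ) * inner ℂ (b i) x := by
    intro x i
    obtain ⟨h₁, h₂, h₃⟩ := hTD x
    have := congrArg (inner ℂ (b i)) h₃
    rw [inner_add_right, hD.inner_apply, hD.inner_apply] at this
    have hne : ((1 : ℂ) + (d i : ℂ) ^ 2) ≠ 0 := by exact_mod_cast (hpos i).ne'
    rw [← this]
    push_cast
    field_simp
  by_contra hinf
  have hinf : {i | |d i| ≤ R}.Infinite := hinf
  let f := hinf.natEmbedding
  have hcomp : IsCompactOperator (T ∘L T) := hTc.comp_clm T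
  obtain ⟨K, hK, hsub⟩ := hcomp.image_closedBall_subset_compact (r := 1) (𝕜₁ := ℂ)
    (f := ((T ∘L T : H →L[ℂ] H) : H →ₗ[ℂ] H))
  have hmem : ∀ n, T (T (b (f n))) ∈ K := fun n =>
    hsub ⟨b (f n), by simp [b.orthonormal.1], rfl⟩
  obtain ⟨a, -, φ, hφ, hlim⟩ := hK.tendsto_subseq hmem
  set c := (1 + R ^ 2)⁻¹ with hcdef
  have hcpos : 0 < c := by positivity
  have hcau := hlim.cauchySeq
  rw [Metric.cauchySeq_iff'] at hcau
  obtain ⟨N, hN⟩ := hcau c hcpos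
  have hlt := hN (N + 1) (by omega)
  have hne : (f (φ N) : ι) ≠ f (φ (N + 1)) := by
    intro h
    have := f.injective (Subtype.ext h)
    exact (hφ (Nat.lt_succ_self N)).ne this
  rw [dist_eq_norm] at hlt
  set i : ι := (f (φ (N + 1)) : ι)
  set j : ι := (f (φ N) : ι)
  have hi : |d i| ≤ R := (f (φ (N + 1))).2
  have h₁ : inner ℂ (b i) (T (T (b i)) - T (T (b j))) = ((1 + d i ^ 2)⁻¹ : ℝ) := by
    rw [inner_sub_right, hTT, hTT, inner_basis, inner_basis, if_pos rfl, if_neg hne.symm]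
    simp
  have h₂ : c ≤ ‖T (T (b i)) - T (T (b j))‖ := by
    calc c ≤ (1 + d i ^ 2)⁻¹ := by
          refine inv_anti₀ (hpos i) ?_
          rw [← sq_abs]
          gcongr
      _ = ‖inner ℂ (b i) (T (T (b i)) - T (T (b j)))‖ := by
          rw [h₁, Complex.norm_real, Real.norm_of_nonneg (inv_nonneg.2 (hpos i).le)]
      _ ≤ ‖b i‖ * ‖T (T (b i)) - T (T (b j))‖ := norm_inner_le_norm _ _
      _ = _ := by rw [b.orthonormal.1, one_mul]
  exact absurd hlt (not_lt.2 h₂)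

end DiagonalConverse

/-! ### The Laplacian, smooth vectors and functional calculus in an eigenbasis. -/

section FunctionalCalculus

variable {H : Type*} [NormedAddCommGroup H] [InnerProductSpace ℂ H] {ι : Type*}
  {b : HilbertBasis ι ℂ H} {D : H →ₗ.[ℂ] H} {d : ι → ℝ}

lemma IsDiag.mem_eigenspace_iff (hD : IsDiag D b d) {t : ℝ} {x : H} :
    x ∈ eigenspace D t ↔ ∀ i, d i ≠ t → inner ℂ (b i) x = 0 := by
  rw [mem_eigenspace]
  constructor
  · rintro ⟨hx, h⟩ i hi
    have := hD.inner_apply ⟨x, hx⟩ i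
    rw [h, inner_smul_right] at this
    have h' : ((d i - t : ℝ) : ℂ) * inner ℂ (b i) x = 0 := by
      push_cast
      linear_combination -this
    exact (mul_eq_zero.1 h').resolve_left (by exact_mod_cast sub_ne_zero.2 hi)
  · intro h
    refine hD.exists_apply_eq fun i => ?_
    rw [inner_smul_right]
    by_cases hi : d i = t
    · rw [hi]
    · rw [h i hi, mul_zero, mul_zero]

/-- The eigenvalues of `Δ^{1/2} = (1 + D²)^{1/2}`. -/
def weight (d : ι → ℝ) (i : ι) : ℝ :=
  √(1 + d i ^ 2)

lemma one_le_weight (d : ι → ℝ) (i : ι) : 1 ≤ weight d i :=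
  Real.one_le_sqrt.2 (by nlinarith [sq_nonneg (d i)])

lemma weight_pos (d : ι → ℝ) (i : ι) : 0 < weight d i :=
  one_pos.trans_le (one_le_weight d i)

lemma weight_sq (d : ι → ℝ) (i : ι) : weight d i ^ 2 = 1 + d i ^ 2 :=
  Real.sq_sqrt (by positivity)

lemma abs_weight_sub_le (d : ι → ℝ) (i : ι) : |weight d i - (|d i|)| ≤ 1 := by
  have h₁ := weight_sq d i
  have h₂ := weight_pos d i
  have h₃ := abs_nonneg (d i)
  have h₄ := sq_abs (d i)
  rw [abs_le]
  constructor <;> nlinarith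

/-- `|D|` is the operator in the definition of regularity, while `Δ^{1/2}` is bounded below by one
and has `Δ` as its square. Their difference is bounded, so they define the same smooth matrices. -/
lemma smoothMat_weight_iff {d : ι → ℝ} {n : ι → ι → ℂ} :
    SmoothMat (weight d) n ↔ SmoothMat (fun i => |d i|) n :=
  ⟨fun h => h.of_bounded_sub (c := 1) fun i => by rw [abs_sub_comm]; exact abs_weight_sub_le d i,
    fun h => h.of_bounded_sub (abs_weight_sub_le d)⟩

lemma IsDiag.laplacian (hD : IsDiag D b d) :
    IsDiag (laplacian D) b fun i => weight d i ^ 2 := by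
  intro x w
  constructor
  · intro h i
    obtain ⟨y, rfl, rfl⟩ := (LinearPMap.mem_graph_iff _).1 h
    obtain ⟨y, hy, hy'⟩ := y
    change inner ℂ (b i) (y + D ⟨D ⟨y, hy⟩, hy'⟩) = ((weight d i ^ 2 : ℝ) : ℂ) * inner ℂ (b i) y
    rw [inner_add_right, hD.inner_apply, hD.inner_apply, weight_sq]
    push_cast
    ring
  · intro h
    beta_reduce at h
    obtain ⟨v, hv⟩ := exists_coef_of_le b (c := fun i => d i * inner ℂ (b i) x) 1 w fun i => by
      rw [h, norm_mul, norm_mul, Complex.norm_real, Complex.norm_real, one_mul,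
        Real.norm_eq_abs, Real.norm_of_nonneg (by positivity), weight_sq]
      gcongr
      rw [← sq_abs]
      nlinarith [sq_nonneg (|d i| - 1), abs_nonneg (d i)]
    obtain ⟨h₁, rfl⟩ := hD.exists_apply_eq hv
    have hv' : ∀ i, inner ℂ (b i) (w - x) = d i * inner ℂ (b i) (D ⟨x, h₁⟩) := fun i => by
      rw [inner_sub_right, hv, h, weight_sq]
      push_cast
      ring
    obtain ⟨h₂, h₃⟩ := hD.exists_apply_eq hv'
    refine (LinearPMap.mem_graph_iff _).2 ⟨⟨x, ⟨h₁, h₂⟩⟩, rfl, ?_⟩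
    change x + D ⟨D ⟨x, h₁⟩, h₂⟩ = w
    rw [h₃]
    abel

lemma IsDiag.mem_powDomain_iff {L : H →ₗ.[ℂ] H} {l : ι → ℝ} (hL : IsDiag L b l)
    (hl : ∀ i, 1 ≤ l i) (n : ℕ) (x : H) :
    x ∈ powDomain L n ↔ ∃ w, ∀ i, inner ℂ (b i) w = ((l i ^ n : ℝ) : ℂ) * inner ℂ (b i) x := by
  induction n generalizing x with
  | zero => exact ⟨fun _ => ⟨x, by simp⟩, fun _ => trivial⟩
  | succ n ih =>
    rw [mem_powDomain_succ]
    constructor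
    · rintro ⟨hx, h⟩
      obtain ⟨w, hw⟩ := (ih _).1 h
      refine ⟨w, fun i => ?_⟩
      rw [hw, hL.inner_apply, pow_succ]
      push_cast
      ring
    · rintro ⟨w, hw⟩
      obtain ⟨v, hv⟩ := exists_coef_of_le b (c := fun i => l i * inner ℂ (b i) x) 1 w fun i => by
        have h1 := hl i
        rw [hw, norm_mul, norm_mul, Complex.norm_real, Complex.norm_real, one_mul,
          Real.norm_of_nonneg (by linarith), Real.norm_of_nonneg (by positivity)]
        gcongr
        exact le_self_pow₀ h1 n.succ_ne_zero
      obtain ⟨hx, rfl⟩ := hL.exists_apply_eq hv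
      refine ⟨hx, (ih _).2 ⟨w, fun i => ?_⟩⟩
      rw [hw, hv, pow_succ]
      push_cast
      ring

/-- The domains of `Δ^n` only control even powers of the weight; as the weight is at least one,
these dominate all real powers. -/
lemma IsDiag.mem_smoothVectors_iff (hD : IsDiag D b d) {x : H} :
    x ∈ smoothVectors D ↔
      ∀ s : ℝ, ∃ w, ∀ i, inner ℂ (b i) w = ((weight d i ^ s : ℝ) : ℂ) * inner ℂ (b i) x := by
  have hl : ∀ i, 1 ≤ weight d i ^ 2 := fun i => one_le_pow₀ (one_le_weight d i)
  rw [mem_smoothVectors]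
  simp only [hD.laplacian.mem_powDomain_iff hl]
  constructor
  · intro h s
    obtain ⟨n, hn⟩ := exists_nat_ge s
    obtain ⟨w, hw⟩ := h n
    refine exists_coef_of_le b 1 w fun i => ?_
    have := weight_pos d i
    rw [hw, norm_mul, norm_mul, Complex.norm_real, Complex.norm_real, one_mul,
      Real.norm_of_nonneg (by positivity), Real.norm_of_nonneg (by positivity)]
    gcongr
    rw [← pow_mul, ← Real.rpow_natCast]
    refine Real.rpow_le_rpow_of_exponent_le (one_le_weight d i) (hn.trans ?_)
    exact_mod_cast Nat.le_mul_of_pos_left n two_pos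
  · intro h n
    obtain ⟨w, hw⟩ := h (2 * n : ℕ)
    refine ⟨w, fun i => ?_⟩
    rw [hw, Real.rpow_natCast, pow_mul]

lemma IsDiag.basis_mem_smoothVectors (hD : IsDiag D b d) (j : ι) : b j ∈ smoothVectors D := by
  classical
  rw [hD.mem_smoothVectors_iff]
  intro s
  refine ⟨((weight d j ^ s : ℝ) : ℂ) • b j, fun i => ?_⟩
  rw [inner_smul_right, inner_basis]
  split_ifs with h
  · rw [h]
  · simp

variable [CompleteSpace H]

lemma IsDiag.inner_spectralProj (hD : IsDiag D b d) (t : ℝ) (x : H) (i : ι) :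
    inner ℂ (b i) (spectralProj D t x) = if d i = t then inner ℂ (b i) x else 0 := by
  classical
  rw [spectralProj, ← Submodule.inner_starProjection_left_eq_right]
  split_ifs with hi
  · rw [Submodule.starProjection_eq_self_iff.2]
    refine Submodule.le_topologicalClosure _ (hD.mem_eigenspace_iff.2 fun j hj => ?_)
    rw [inner_basis, if_neg]
    rintro rfl
    exact hj hi
  · rw [(Submodule.starProjection_apply_eq_zero_iff _).2, inner_zero_left]
    rw [Submodule.mem_orthogonal]
    intro y hy
    rw [(isClosed_eigenspace hD.isSelfAdjoint.isClosed t).submodule_topologicalClosure_eq] at hy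
    rw [← inner_conj_symm, hD.mem_eigenspace_iff.1 hy i hi, map_zero]

/-- The basis expansion of `x`, regrouped along the fibres of `d`, is its expansion into spectral
projections. -/
lemma IsDiag.hasSum_spectralProj (hD : IsDiag D b d) (x : H) :
    HasSum (fun t => spectralProj D t x) x := by
  have h : HasSum (fun i => inner ℂ (b i) x • b i) x := by
    simpa [b.repr_apply_apply] using b.hasSum_repr x
  have h' := (Equiv.hasSum_iff (Equiv.sigmaFiberEquiv d)).2 h
  refine h'.sigma fun t => ?_
  have hP : HasSum (fun i => inner ℂ (b i) (spectralProj D t x) • b i) (spectralProj D t x) := by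
    simpa [b.repr_apply_apply] using b.hasSum_repr (spectralProj D t x)
  have hsupp : Function.support (fun i => inner ℂ (b i) (spectralProj D t x) • b i) ⊆
      Set.range (Subtype.val : {i // d i = t} → ι) := by
    intro i hi
    rw [Subtype.range_coe_subtype]
    by_contra hne
    have hne : d i ≠ t := hne
    refine hi ?_
    simp only [hD.inner_spectralProj]
    rw [if_neg hne, zero_smul]
  rw [← Function.Injective.hasSum_iff Subtype.val_injective
    (fun i hi => Function.notMem_support.1 fun h => hi (hsupp h))] at hP
  refine hP.congr_fun fun i => ?_
  simp [hD.inner_spectralProj, i.2, Equiv.sigmaFiberEquiv]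

/-- The functional calculus acts on the eigenvalues. -/
lemma IsDiag.funcCalc (hD : IsDiag D b d) (f : ℝ → ℝ) :
    IsDiag (funcCalc D f) b fun i => f (d i) := by
  intro x w
  have hgraph : (x, w) ∈ (TwistedTriple.funcCalc D f).graph ↔
      HasSum (fun t => (f t : ℂ) • spectralProj D t x) w := by
    rw [LinearPMap.mem_graph_iff]
    constructor
    · rintro ⟨y, rfl, rfl⟩
      exact Summable.hasSum y.2
    · intro h
      exact ⟨⟨x, h.summable⟩, rfl, h.tsum_eq⟩
  rw [hgraph]
  constructor
  · intro h i
    refine (h.mapL (innerSL ℂ (b i))).unique ?_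
    refine (hasSum_ite_eq (d i) ((f (d i) : ℂ) * inner ℂ (b i) x)).congr_fun fun t => ?_
    rw [map_smul, innerSL_apply_apply, hD.inner_spectralProj, smul_eq_mul]
    by_cases h : t = d i
    · simp [h]
    · rw [if_neg (Ne.symm h), if_neg h, mul_zero]
  · intro h
    refine (hD.hasSum_spectralProj w).congr_fun fun t => coef_ext b fun i => ?_
    rw [inner_smul_right, hD.inner_spectralProj, hD.inner_spectralProj]
    split_ifs with hi
    · rw [h, ← hi]
    · rw [mul_zero]

lemma IsDiag.absOp (hD : IsDiag D b d) : IsDiag (absOp D) b fun i => |d i| :=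
  hD.funcCalc _

lemma IsDiag.laplacePow (hD : IsDiag D b d) (s : ℝ) :
    IsDiag (laplacePow D s) b fun i => weight d i ^ s := by
  have h := hD.funcCalc fun t => (1 + t ^ 2) ^ (s / 2)
  have e : (fun i => weight d i ^ s) = fun i => (1 + d i ^ 2) ^ (s / 2) := by
    funext i
    rw [weight, Real.sqrt_eq_rpow, ← Real.rpow_mul (by positivity)]
    congr 1
    ring
  rw [e]
  exact h

lemma IsDiag.sobolevNorm_eq (hD : IsDiag D b d) {s : ℝ} {ξ : smoothVectors D} {w : H}
    (hw : ∀ i, inner ℂ (b i) w = ((weight d i ^ s : ℝ) : ℂ) * inner ℂ (b i) (ξ : H)) :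
    sobolevNorm D s ξ = ‖w‖ := by
  obtain ⟨h, h'⟩ := (hD.laplacePow s).exists_apply_eq hw
  rw [sobolevNorm, dif_pos h, h']

end FunctionalCalculus

/-! ### Operators of finite analytic order as weighted matrices. -/

section Order

open ComplexConjugate

variable {H : Type*} [NormedAddCommGroup H] [InnerProductSpace ℂ H] {ι : Type*}
  {b : HilbertBasis ι ℂ H} {D : H →ₗ.[ℂ] H} {d : ι → ℝ}

/-- The matrix `m` represents the endomorphism `P` of the space of smooth vectors. -/
def HasMatrix (b : HilbertBasis ι ℂ H) {D : H →ₗ.[ℂ] H} (P : Module.End ℂ (smoothVectors D))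
    (m : ι → ι → ℂ) : Prop :=
  ∀ (ξ : smoothVectors D) (i : ι),
    HasSum (fun j => m i j * inner ℂ (b j) (ξ : H)) (inner ℂ (b i) (P ξ : H))

lemma hasMatrix_restrict (T : H →L[ℂ] H)
    (hT : ∀ ξ ∈ smoothVectors D, T.toLinearMap ξ ∈ smoothVectors D) :
    HasMatrix b (T.toLinearMap.restrict hT) (mat b T) :=
  fun ξ i => hasSum_mat b T ξ i

lemma HasMatrix.commutator {P S : Module.End ℂ (smoothVectors D)} {m : ι → ι → ℂ} {s : ι → ℝ}
    (hP : HasMatrix b P m)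
    (hS : ∀ (ξ : smoothVectors D) i, inner ℂ (b i) (S ξ : H) = s i * inner ℂ (b i) (ξ : H)) :
    HasMatrix b (S * P - P * S) fun i j => ((s i - s j : ℝ) : ℂ) * m i j := by
  intro ξ i
  have h := ((hP ξ i).mul_left (s i : ℂ)).sub (hP (S ξ) i)
  rw [← hS, ← inner_sub_right] at h
  refine h.congr_fun fun j => ?_
  rw [hS]
  push_cast
  ring

lemma IsDiag.inner_diracEnd (hD : IsDiag D b d) (ξ : smoothVectors D) (i : ι) :
    inner ℂ (b i) (diracEnd D ξ : H) = d i * inner ℂ (b i) (ξ : H) :=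
  hD.inner_apply ⟨ξ, smoothVectors_le D ξ.2⟩ i

lemma IsDiag.inner_laplaceEnd (hD : IsDiag D b d) (ξ : smoothVectors D) (i : ι) :
    inner ℂ (b i) (laplaceEnd D ξ : H) = ((weight d i ^ 2 : ℝ) : ℂ) * inner ℂ (b i) (ξ : H) :=
  hD.laplacian.inner_apply ⟨ξ, smoothVectors_le_laplacian D ξ.2⟩ i

lemma IsDiag.hasMatrix_iterLaplaceComm (hD : IsDiag D b d) {P : Module.End ℂ (smoothVectors D)}
    {m : ι → ι → ℂ} (hP : HasMatrix b P m) (k : ℕ) :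
    HasMatrix b (iterLaplaceComm D k P) fun i j =>
      (((weight d i ^ 2 - weight d j ^ 2) ^ k : ℝ) : ℂ) * m i j := by
  induction k with
  | zero => simpa [iterLaplaceComm] using hP
  | succ k ih =>
    have h := ih.commutator (hD.inner_laplaceEnd)
    have e : iterLaplaceComm D (k + 1) P =
        laplaceEnd D * iterLaplaceComm D k P - iterLaplaceComm D k P * laplaceEnd D :=
      Function.iterate_succ_apply' _ _ _
    rw [e]
    convert h using 3 with i j
    rw [pow_succ]
    push_cast
    ring

variable [CompleteSpace H]

/-- The Sobolev norms are the norms of `Δ^{s/2} ξ`, so the estimate says that `Δ^{r/2} P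
Δ^{-(r+t)/2}` is bounded. The matrix condition states this entrywise. -/
lemma IsDiag.hasOrder_iff (hD : IsDiag D b d) {P : Module.End ℂ (smoothVectors D)}
    {m : ι → ι → ℂ} (hP : HasMatrix b P m) (t : ℝ) :
    HasOrder D t P ↔ ∀ r : ℝ, BddMat fun i j =>
      ((weight d i ^ r * weight d j ^ (-(r + t)) : ℝ) : ℂ) * m i j := by
  classical
  have hcancel : ∀ (r : ℝ) i, ((weight d i ^ (-r) : ℝ) : ℂ) * ((weight d i ^ r : ℝ) : ℂ) = 1 := by
    intro r i
    rw [← Complex.ofReal_mul, ← Real.rpow_add (weight_pos d i)]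
    simp
  constructor
  · intro h r
    obtain ⟨K, hK⟩ := h r
    refine ⟨|K| + 1, by positivity, fun F x y => ?_⟩
    -- The test vector is `Δ^{-(r+t)/2}` applied to the finite combination with coefficients `x`. It
    -- is smooth, and its Sobolev norm of index `r + t` is the plain norm of that combination.
    have hmem : ∑ j ∈ F, (((weight d j ^ (-(r + t)) : ℝ) : ℂ) * x j) • b j ∈ smoothVectors D :=
      Submodule.sum_mem _ fun j _ => Submodule.smul_mem _ _ (hD.basis_mem_smoothVectors j)
    set ξ : smoothVectors D := ⟨_, hmem⟩ with hξ
    have hcoef : ∀ j, inner ℂ (b j) (ξ : H) =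
        if j ∈ F then ((weight d j ^ (-(r + t)) : ℝ) : ℂ) * x j else 0 := by
      intro j
      simp only [hξ, inner_sum, inner_smul_right, inner_basis]
      simp
    have hPξ : ∀ i, inner ℂ (b i) (P ξ : H) =
        ∑ j ∈ F, m i j * (((weight d j ^ (-(r + t)) : ℝ) : ℂ) * x j) := by
      intro i
      refine (hP ξ i).unique ?_
      have : ∑ j ∈ F, m i j * (((weight d j ^ (-(r + t)) : ℝ) : ℂ) * x j) =
          ∑ j ∈ F, m i j * inner ℂ (b j) (ξ : H) :=
        Finset.sum_congr rfl fun j hj => by rw [hcoef, if_pos hj]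
      rw [this]
      refine hasSum_sum_of_ne_finset_zero fun j hj => ?_
      rw [hcoef, if_neg hj, mul_zero]
    obtain ⟨u, hu⟩ := hD.mem_smoothVectors_iff.1 (P ξ).2 r
    have hξn : sobolevNorm D (r + t) ξ = ‖∑ j ∈ F, x j • b j‖ := by
      refine hD.sobolevNorm_eq fun j => ?_
      rw [hcoef]
      simp only [inner_sum, inner_smul_right, inner_basis]
      by_cases hj : j ∈ F
      · simp only [mul_ite, mul_one, mul_zero, Finset.sum_ite_eq, hj, if_true]
        rw [← mul_assoc, mul_comm ((weight d j ^ (r + t) : ℝ) : ℂ), hcancel, one_mul]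
      · simp [hj]
    have hle := hK ξ
    rw [hD.sobolevNorm_eq hu, hξn] at hle
    have e : ∑ i ∈ F, ∑ j ∈ F, conj (y i) *
        (((weight d i ^ r * weight d j ^ (-(r + t)) : ℝ) : ℂ) * m i j) * x j =
        inner ℂ (∑ i ∈ F, y i • b i) u := by
      rw [sum_inner]
      refine Finset.sum_congr rfl fun i _ => ?_
      rw [inner_smul_left, hu, hPξ, Finset.mul_sum, Finset.mul_sum]
      refine Finset.sum_congr rfl fun j _ => ?_
      push_cast
      ring
    rw [e, ← norm_sq_sum_smul b F x, ← norm_sq_sum_smul b F y]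
    set v := ∑ i ∈ F, x i • b i
    set z := ∑ i ∈ F, y i • b i
    calc ‖inner ℂ z u‖ ≤ ‖z‖ * ‖u‖ := norm_inner_le_norm _ _
      _ ≤ ‖z‖ * (|K| * ‖v‖) := by
          gcongr
          exact hle.trans (by gcongr; exact le_abs_self K)
      _ = |K| * (‖v‖ * ‖z‖) := by ring
      _ ≤ (|K| + 1) * (‖v‖ ^ 2 + ‖z‖ ^ 2) := by
          gcongr
          · linarith
          · nlinarith [sq_nonneg (‖v‖ - ‖z‖), norm_nonneg v, norm_nonneg z]
  · intro h r
    obtain ⟨C, hC⟩ := (h r).exists_op b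
    refine ⟨‖C‖, fun ξ => ?_⟩
    obtain ⟨η, hη⟩ := hD.mem_smoothVectors_iff.1 ξ.2 (r + t)
    have hCη : ∀ i, inner ℂ (b i) (C η) =
        ((weight d i ^ r : ℝ) : ℂ) * inner ℂ (b i) (P ξ : H) := by
      intro i
      refine (hasSum_mat b C η i).unique ?_
      refine ((hP ξ i).mul_left ((weight d i ^ r : ℝ) : ℂ)).congr_fun fun j => ?_
      rw [hC, hη]
      push_cast
      have := hcancel (r + t) j
      linear_combination ((weight d i ^ r : ℝ) : ℂ) * m i j * inner ℂ (b j) (ξ : H) * this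
    rw [hD.sobolevNorm_eq hCη, hD.sobolevNorm_eq hη]
    exact C.le_opNorm η

/-- Smoothness for `[|D|, ·]` is characterized by the orders of the iterated commutators with the
Laplacian. -/
lemma IsDiag.smoothMat_iff_hasOrder (hD : IsDiag D b d) {P : Module.End ℂ (smoothVectors D)}
    {m : ι → ι → ℂ} (hP : HasMatrix b P m) :
    SmoothMat (fun i => |d i|) m ↔ ∀ k : ℕ, HasOrder D k (iterLaplaceComm D k P) := by
  rw [← smoothMat_weight_iff]
  simp only [fun k => hD.hasOrder_iff (hD.hasMatrix_iterLaplaceComm hP k)]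
  constructor
  · intro h k r
    convert h.sq_commutator (one_le_weight d) r k using 3 with i j
    push_cast
    ring
  · intro h
    refine SmoothMat.of_sq_commutator (weight_pos d) fun k => ?_
    -- Only the Sobolev index `-k/2` is needed here: it is the one that gives the symmetric form of
    -- the commutator bound.
    convert h k (-(k / 2)) using 3 with i j
    have hr : ∀ i, weight d i ^ (-(k / 2 : ℝ)) = (√(weight d i) ^ k)⁻¹ := fun i => by
      rw [Real.rpow_neg (weight_pos d i).le, Real.sqrt_eq_rpow, ← Real.rpow_natCast,
        ← Real.rpow_mul (weight_pos d i).le]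
      ring_nf
    rw [hr, show -(-(k / 2 : ℝ) + k) = -(k / 2 : ℝ) by ring, hr, mul_pow]
    push_cast
    ring

/-- A smooth matrix stays bounded after conjugation by any real power of the weight, so it preserves
each of the domains whose intersection is `W^∞`. -/
lemma IsDiag.map_smoothVectors (hD : IsDiag D b d) {T : H →L[ℂ] H}
    (hT : SmoothMat (fun i => |d i|) (mat b T)) :
    ∀ ξ ∈ smoothVectors D, T.toLinearMap ξ ∈ smoothVectors D := by
  intro ξ hξ
  rw [hD.mem_smoothVectors_iff] at hξ ⊢
  intro s
  obtain ⟨C, hC⟩ := ((smoothMat_weight_iff.2 hT).div_rpow (one_le_weight d) s).exists_op b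
  obtain ⟨η, hη⟩ := hξ s
  refine ⟨C η, fun i => (hasSum_mat b C η i).unique ?_⟩
  refine ((hasSum_mat b T ξ i).mul_left ((weight d i ^ s : ℝ) : ℂ)).congr_fun fun j => ?_
  rw [hC, hη, Real.div_rpow (weight_pos d i).le (weight_pos d j).le]
  have : ((weight d j ^ s : ℝ) : ℂ) ≠ 0 := by
    exact_mod_cast (Real.rpow_pos_of_pos (weight_pos d j) s).ne'
  push_cast at this ⊢
  field_simp

/-- An operator with bounded commutator satisfies the conditions on commutators with the Laplacian
if and only if it satisfies the regularity conditions. -/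
lemma IsDiag.isLaplaceCompatible_iff (hD : IsDiag D b d) {T C : H →L[ℂ] H}
    (hC : IsBoundedCommutator D T C) :
    IsLaplaceCompatible D T ↔ InDomInfty (TwistedTriple.absOp D) T ∧
      InDomInfty (TwistedTriple.absOp D) C := by
  rw [hD.absOp.inDomInfty_iff, hD.absOp.inDomInfty_iff]
  have hCm := hD.isBoundedCommutator_iff.1 hC
  have hQ : ∀ hT : ∀ ξ ∈ smoothVectors D, T.toLinearMap ξ ∈ smoothVectors D,
      HasMatrix b (diracEnd D * T.toLinearMap.restrict hT - T.toLinearMap.restrict hT * diracEnd D)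
        (mat b C) := by
    intro hT
    have h := (hasMatrix_restrict (b := b) T hT).commutator hD.inner_diracEnd
    convert h using 1
    funext i j
    exact hCm i j
  constructor
  · rintro ⟨hT, -, -, h⟩
    exact ⟨(hD.smoothMat_iff_hasOrder (hasMatrix_restrict T hT)).2 fun k => (h k).1,
      (hD.smoothMat_iff_hasOrder (hQ hT)).2 fun k => (h k).2⟩
  · rintro ⟨h₁, h₂⟩
    have hT := hD.map_smoothVectors h₁
    have h₃ := (hD.smoothMat_iff_hasOrder (hasMatrix_restrict T hT)).1 h₁
    have h₄ := (hD.smoothMat_iff_hasOrder (hQ hT)).1 h₂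
    refine ⟨hT, ?_, ?_, fun k => ⟨h₃ k, h₄ k⟩⟩
    -- The order zero conditions are the case `k = 0` of those on iterated commutators.
    · simpa [iterLaplaceComm] using h₃ 0
    · simpa [iterLaplaceComm] using h₄ 0

end Order

/-! ### The algebra of regular operators. -/

section RegularOperators

variable {H : Type*} [NormedAddCommGroup H] [InnerProductSpace ℂ H]

namespace IsBoundedCommutator

variable {S : H →ₗ.[ℂ] H} {T T' C C' : H →L[ℂ] H}

lemma add (h : IsBoundedCommutator S T C) (h' : IsBoundedCommutator S T' C') :
    IsBoundedCommutator S (T + T') (C + C') := by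
  intro x
  obtain ⟨h₁, h₂⟩ := h x
  obtain ⟨h₁', h₂'⟩ := h' x
  refine ⟨S.domain.add_mem h₁ h₁', ?_⟩
  have e : (⟨(T + T') x, S.domain.add_mem h₁ h₁'⟩ : S.domain) = ⟨T x, h₁⟩ + ⟨T' x, h₁'⟩ := rfl
  rw [e, S.map_add, add_apply, add_apply, ← h₂, ← h₂']
  abel

lemma mul (h : IsBoundedCommutator S T C) (h' : IsBoundedCommutator S T' C') :
    IsBoundedCommutator S (T * T') (C * T' + T * C') := by
  intro x
  obtain ⟨h₁', h₂'⟩ := h' x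
  obtain ⟨h₁, h₂⟩ := h ⟨T' x, h₁'⟩
  refine ⟨h₁, ?_⟩
  have h₂ : S ⟨T (T' x), h₁⟩ - T (S ⟨T' x, h₁'⟩) = C (T' x) := h₂
  change S ⟨T (T' x), h₁⟩ - T (T' (S x)) = C (T' x) + T (C' x)
  rw [← h₂, ← h₂', map_sub]
  abel

lemma zero (S : H →ₗ.[ℂ] H) : IsBoundedCommutator S 0 0 := fun x =>
  ⟨S.domain.zero_mem, by
    have : S ⟨(0 : H →L[ℂ] H) x, S.domain.zero_mem⟩ = 0 := S.map_zero
    rw [this]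
    simp⟩

end IsBoundedCommutator

variable {S : H →ₗ.[ℂ] H} {T T' : H →L[ℂ] H} {k : ℕ}

lemma InDomDerivation.of_succ (h : InDomDerivation S (k + 1) T) : InDomDerivation S k T := by
  induction k generalizing T with
  | zero => trivial
  | succ k ih =>
    obtain ⟨C, hC, hC'⟩ := h
    exact ⟨C, hC, ih hC'⟩

lemma InDomDerivation.add (h : InDomDerivation S k T) (h' : InDomDerivation S k T') :
    InDomDerivation S k (T + T') := by
  induction k generalizing T T' with
  | zero => trivial
  | succ k ih =>
    obtain ⟨C, hC, hk⟩ := h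
    obtain ⟨C', hC', hk'⟩ := h'
    exact ⟨C + C', hC.add hC', ih hk hk'⟩

/-- Leibniz rule. In each term one factor is not differentiated, and only its weaker membership from
`of_succ` is used. -/
lemma InDomDerivation.mul (h : InDomDerivation S k T) (h' : InDomDerivation S k T') :
    InDomDerivation S k (T * T') := by
  induction k generalizing T T' with
  | zero => trivial
  | succ k ih =>
    have h₀ := h.of_succ
    have h₀' := h'.of_succ
    obtain ⟨C, hC, hk⟩ := h
    obtain ⟨C', hC', hk'⟩ := h'
    exact ⟨C * T' + T * C', hC.mul hC', (ih hk h₀').add (ih h₀ hk')⟩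

lemma InDomDerivation.zero : InDomDerivation S k 0 := by
  induction k with
  | zero => trivial
  | succ k ih => exact ⟨0, .zero S, ih⟩

variable [CompleteSpace H]

/-- `T` and `[D, T]` are smooth for the derivation `[|D|, ·]`. -/
def IsRegularOp (D : H →ₗ.[ℂ] H) (T : H →L[ℂ] H) : Prop :=
  InDomInfty (absOp D) T ∧ ∃ C : H →L[ℂ] H, IsBoundedCommutator D T C ∧ InDomInfty (absOp D) C

namespace IsRegularOp

variable {D : H →ₗ.[ℂ] H}

lemma zero : IsRegularOp D 0 :=
  ⟨fun _ => .zero, 0, .zero D, fun _ => .zero⟩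

lemma add (h : IsRegularOp D T) (h' : IsRegularOp D T') : IsRegularOp D (T + T') := by
  obtain ⟨h, C, hC, hk⟩ := h
  obtain ⟨h', C', hC', hk'⟩ := h'
  exact ⟨fun k => (h k).add (h' k), C + C', hC.add hC', fun k => (hk k).add (hk' k)⟩

lemma mul (h : IsRegularOp D T) (h' : IsRegularOp D T') : IsRegularOp D (T * T') := by
  obtain ⟨h, C, hC, hk⟩ := h
  obtain ⟨h', C', hC', hk'⟩ := h'
  exact ⟨fun k => (h k).mul (h' k), C * T' + T * C', hC.mul hC',
    fun k => ((hk k).mul (h' k)).add ((h k).mul (hk' k))⟩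

lemma sum {κ : Type*} {s : Finset κ} {T : κ → H →L[ℂ] H} (h : ∀ i ∈ s, IsRegularOp D (T i)) :
    IsRegularOp D (∑ i ∈ s, T i) :=
  Finset.sum_induction T (IsRegularOp D) (fun _ _ => add) zero h

/-- For an operator with bounded commutator, regularity amounts to the conditions on commutators
with the Laplacian. -/
lemma iff_isLaplaceCompatible (hD : IsSelfAdjoint D) (hc : HasCompactResolvent D)
    (hT : ∃ C, IsBoundedCommutator D T C) : IsRegularOp D T ↔ IsLaplaceCompatible D T := by
  obtain ⟨ι, b, d, hd⟩ := exists_isDiag hD hc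
  constructor
  · rintro ⟨h, C, hC, h'⟩
    exact (hd.isLaplaceCompatible_iff hC).2 ⟨h, h'⟩
  · obtain ⟨C, hC⟩ := hT
    intro h
    obtain ⟨h₁, h₂⟩ := (hd.isLaplaceCompatible_iff hC).1 h
    exact ⟨h₁, C, hC, h₂⟩

end IsRegularOp

end RegularOperators

/-! ### Hilbert tensor products and Kronecker products of smooth matrices. -/

section Tensor

variable {H K : Type*} [NormedAddCommGroup H] [InnerProductSpace ℂ H]
  [NormedAddCommGroup K] [InnerProductSpace ℂ K]

variable (H K) in
/-- The simple tensor as a continuous bilinear map. -/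
def htmulL : H →L[ℂ] K →L[ℂ] HilbertTensor H K :=
  (ContinuousLinearMap.compL ℂ K (H ⊗[ℂ] K) (UniformSpace.Completion (H ⊗[ℂ] K))
    UniformSpace.Completion.toComplL).comp (TensorProduct.mkL ℂ H K)

lemma htmulL_apply (x : H) (y : K) : htmulL H K x y = htmul x y := rfl

lemma inner_htmul (x x' : H) (y y' : K) :
    inner ℂ (htmul x y) (htmul x' y') = inner ℂ x x' * inner ℂ y y' :=
  (UniformSpace.Completion.inner_coe (𝕜 := ℂ) (x ⊗ₜ[ℂ] y) (x' ⊗ₜ[ℂ] y')).trans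
    (by simp)

lemma htmul_add_left (x x' : H) (y : K) : htmul (x + x') y = htmul x y + htmul x' y := by
  simp only [← htmulL_apply, map_add, add_apply]

lemma htmul_add_right (x : H) (y y' : K) : htmul x (y + y') = htmul x y + htmul x y' := by
  simp only [← htmulL_apply, map_add]

lemma htmul_smul_left (c : ℂ) (x : H) (y : K) : htmul (c • x) y = c • htmul x y := by
  simp only [← htmulL_apply, map_smul, smul_apply]

lemma htmul_smul_right (c : ℂ) (x : H) (y : K) : htmul x (c • y) = c • htmul x y := by
  simp only [← htmulL_apply, map_smul]

lemma dense_span_htmul :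
    Dense (Submodule.span ℂ {z : HilbertTensor H K | ∃ x y, z = htmul x y} :
      Set (HilbertTensor H K)) := by
  have hr : DenseRange ((↑) : H ⊗[ℂ] K → UniformSpace.Completion (H ⊗[ℂ] K)) :=
    UniformSpace.Completion.denseRange_coe
  refine Dense.mono ?_ hr
  rintro _ ⟨t, rfl⟩
  induction t using TensorProduct.induction_on with
  | zero => exact (UniformSpace.Completion.coe_zero (α := H ⊗[ℂ] K)) ▸ Submodule.zero_mem _
  | tmul x y => exact Submodule.subset_span ⟨x, y, rfl⟩
  | add s t hs ht =>
    rw [UniformSpace.Completion.coe_add]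
    exact Submodule.add_mem _ hs ht

lemma ext_htmul {F : Type*} [NormedAddCommGroup F] [NormedSpace ℂ F]
    {S T : HilbertTensor H K →L[ℂ] F} (h : ∀ x y, S (htmul x y) = T (htmul x y)) : S = T := by
  refine ContinuousLinearMap.ext_on (dense_span_htmul (H := H) (K := K)) ?_
  rintro _ ⟨x, y, rfl⟩
  exact h x y

variable {ι κ : Type*}

lemma eq_zero_of_inner_tensor (b : HilbertBasis ι ℂ H) (c : HilbertBasis κ ℂ K)
    {z : HilbertTensor H K} (hz : ∀ i j, inner ℂ (htmul (b i) (c j)) z = 0) : z = 0 := by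
  have h₁ : ∀ x j, inner ℂ z (htmul x (c j)) = 0 := by
    intro x j
    have h := ((b.hasSum_repr x).mapL ((htmulL H K).flip (c j))).mapL (innerSL ℂ z)
    refine h.unique ?_
    refine hasSum_zero.congr_fun fun i => ?_
    rw [map_smul, map_smul, ContinuousLinearMap.flip_apply, htmulL_apply, innerSL_apply_apply,
      ← inner_conj_symm, hz, map_zero, smul_zero]
  have h₂ : ∀ x y, inner ℂ z (htmul x y) = 0 := by
    intro x y
    have h := ((c.hasSum_repr y).mapL (htmulL H K x)).mapL (innerSL ℂ z)
    refine h.unique ?_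
    refine hasSum_zero.congr_fun fun j => ?_
    rw [map_smul, map_smul, htmulL_apply, innerSL_apply_apply, h₁, smul_zero]
  have h₃ : innerSL ℂ z = 0 := ext_htmul fun x y => by
    rw [innerSL_apply_apply, h₂, zero_apply]
  exact inner_self_eq_zero.1 (by rw [← innerSL_apply_apply, h₃, zero_apply] :
    inner ℂ z z = (0 : ℂ))

lemma orthonormal_htmul (b : HilbertBasis ι ℂ H) (c : HilbertBasis κ ℂ K) :
    Orthonormal ℂ fun p : ι × κ => htmul (b p.1) (c p.2) := by
  classical
  rw [orthonormal_iff_ite]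
  rintro ⟨i, j⟩ ⟨i', j'⟩
  rw [inner_htmul, inner_basis, inner_basis]
  simp only [Prod.mk.injEq]
  split_ifs <;> simp_all

/-- The product basis of the Hilbert space tensor product. -/
def tensorBasis (b : HilbertBasis ι ℂ H) (c : HilbertBasis κ ℂ K) :
    HilbertBasis (ι × κ) ℂ (HilbertTensor H K) :=
  HilbertBasis.mkOfOrthogonalEqBot (orthonormal_htmul b c) <| by
    rw [Submodule.eq_bot_iff]
    intro z hz
    rw [Submodule.mem_orthogonal] at hz
    exact eq_zero_of_inner_tensor b c fun i j => hz _ (Submodule.subset_span ⟨(i, j), rfl⟩)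

lemma tensorBasis_apply (b : HilbertBasis ι ℂ H) (c : HilbertBasis κ ℂ K) (p : ι × κ) :
    tensorBasis b c p = htmul (b p.1) (c p.2) := by
  rw [tensorBasis, HilbertBasis.coe_mkOfOrthogonalEqBot]

lemma inner_tensorBasis_htmul (b : HilbertBasis ι ℂ H) (c : HilbertBasis κ ℂ K) (p : ι × κ)
    (x : H) (y : K) :
    inner ℂ (tensorBasis b c p) (htmul x y) = inner ℂ (b p.1) x * inner ℂ (c p.2) y := by
  rw [tensorBasis_apply, inner_htmul]

lemma mat_tensorOp (b : HilbertBasis ι ℂ H) (c : HilbertBasis κ ℂ K) (S : H →L[ℂ] H)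
    (T : K →L[ℂ] K) (p q : ι × κ) :
    mat (tensorBasis b c) (tensorOp S T) p q = mat b S p.1 q.1 * mat c T p.2 q.2 := by
  rw [mat, tensorBasis_apply b c q, tensorOp_htmul, inner_tensorBasis_htmul, mat, mat]

variable [CompleteSpace H] [CompleteSpace K]

/-- The bases enter only to realise the matrices as operators; boundedness is then that of the
operator `S ⊗ T`. -/
lemma BddMat.kronecker (b : HilbertBasis ι ℂ H) (c : HilbertBasis κ ℂ K) {m : ι → ι → ℂ}
    {n : κ → κ → ℂ} (hm : BddMat m) (hn : BddMat n) :
    BddMat fun p q : ι × κ => m p.1 q.1 * n p.2 q.2 := by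
  obtain ⟨S, hS⟩ := hm.exists_op b
  obtain ⟨T, hT⟩ := hn.exists_op c
  convert bddMat_mat (tensorBasis b c) (tensorOp S T) using 3 with p q
  rw [mat_tensorOp, hS, hT]

/-- The tensor product of smooth matrices is smooth. -/
lemma SmoothMat.kronecker (b : HilbertBasis ι ℂ H) (c : HilbertBasis κ ℂ K) {d : ι → ℝ}
    {e : κ → ℝ} {m : ι → ι → ℂ} {n : κ → κ → ℂ} (hm : SmoothMat (fun i => |d i|) m)
    (hn : SmoothMat (fun j => |e j|) n) :
    SmoothMat (fun p : ι × κ => √(d p.1 ^ 2 + e p.2 ^ 2)) fun p q => m p.1 q.1 * n p.2 q.2 := by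
  rw [← smoothMat_weight_iff] at hm hn
  set u := weight d
  set v := weight e
  have hu : ∀ i, 1 ≤ u i := one_le_weight d
  have hv : ∀ j, 1 ≤ v j := one_le_weight e
  let q : ι × κ → ℝ := fun p => √(u p.1 ^ 2 + v p.2 ^ 2)
  have hu0 : ∀ i, 0 < u i := weight_pos d
  have hv0 : ∀ j, 0 < v j := weight_pos e
  have hqsq : ∀ p, q p ^ 2 = u p.1 ^ 2 + v p.2 ^ 2 := fun p => Real.sq_sqrt (by positivity)
  have hq0 : ∀ p, 0 < q p := fun p => Real.sqrt_pos.2 (by have := hu0 p.1; positivity)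
  have huq : ∀ p, u p.1 ≤ q p := fun p => Real.le_sqrt_of_sq_le (by nlinarith [sq_nonneg (v p.2)])
  have hvq : ∀ p, v p.2 ≤ q p := fun p => Real.le_sqrt_of_sq_le (by nlinarith [sq_nonneg (u p.1)])
  have hq : SmoothMat q fun p q => m p.1 q.1 * n p.2 q.2 := by
    -- Squares are additive: `q p ^ 2 - q p' ^ 2` is the sum of the differences of `u²` and of `v²`,
    -- so its `k`-th power is a binomial sum of Kronecker products.
    refine SmoothMat.of_sq_commutator hq0 fun k => ?_
    have hl : ∀ l ∈ Finset.range (k + 1), BddMat fun p p' : ι × κ =>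
        (((√(u p.1) ^ l * √(v p.2) ^ (k - l) / √(q p) ^ k : ℝ) : ℂ) *
          (((((u p.1 ^ 2 - u p'.1 ^ 2) ^ l / (√(u p.1) * √(u p'.1)) ^ l : ℝ) : ℂ) * m p.1 p'.1) *
            ((((v p.2 ^ 2 - v p'.2 ^ 2) ^ (k - l) / (√(v p.2) * √(v p'.2)) ^ (k - l) : ℝ) : ℂ) *
              n p.2 p'.2)) *
          ((√(u p'.1) ^ l * √(v p'.2) ^ (k - l) / √(q p') ^ k : ℝ) : ℂ)) := by
      intro l hl
      -- The symmetric bounds of the factors are normalised by powers of `√u` and `√v` instead of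
      -- `√q`. The correction is a contraction because `u` and `v` are at most `q`.
      have hg : ∀ p : ι × κ, |√(u p.1) ^ l * √(v p.2) ^ (k - l) / √(q p) ^ k| ≤ 1 := by
        intro p
        have hqp := Real.sqrt_pos.2 (hq0 p)
        rw [abs_of_nonneg (by positivity), div_le_one (by positivity)]
        calc √(u p.1) ^ l * √(v p.2) ^ (k - l) ≤ √(q p) ^ l * √(q p) ^ (k - l) := by
              gcongr
              · exact huq p
              · exact hvq p
          _ = √(q p) ^ k := by
              rw [← pow_add, Nat.add_sub_cancel' (Nat.lt_succ_iff.1 (Finset.mem_range.1 hl))]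
      exact ((hm.sq_commutator_symm hu l).kronecker b c
        (hn.sq_commutator_symm hv (k - l))).diag_mul_mul_diag hg hg
    have hsum := BddMat.sum _ fun l hl' => (hl l hl').const_mul (k.choose l : ℂ)
    convert hsum using 3 with p p'
    have hsplit : q p ^ 2 - q p' ^ 2 = (u p.1 ^ 2 - u p'.1 ^ 2) + (v p.2 ^ 2 - v p'.2 ^ 2) := by
      rw [hqsq, hqsq]
      ring
    rw [hsplit, add_pow, Finset.sum_div, Complex.ofReal_sum, Finset.sum_mul]
    refine Finset.sum_congr rfl fun l _ => ?_
    have hne : ∀ x : ℝ, 0 < x → ((√x : ℝ) : ℂ) ≠ 0 := fun x hx => by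
      exact_mod_cast (Real.sqrt_pos.2 hx).ne'
    have h₁ := hne _ (hu0 p.1)
    have h₂ := hne _ (hu0 p'.1)
    have h₃ := hne _ (hv0 p.2)
    have h₄ := hne _ (hv0 p'.2)
    have h₅ := hne _ (hq0 p)
    have h₆ := hne _ (hq0 p')
    push_cast
    field_simp
    ring
  -- `q² = d² + e² + 2`, one unit from each weight, so the square roots differ by less than two.
  refine hq.of_bounded_sub (c := 2) fun p => ?_
  have hrs : √(d p.1 ^ 2 + e p.2 ^ 2) ^ 2 = d p.1 ^ 2 + e p.2 ^ 2 := Real.sq_sqrt (by positivity)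
  have hr0 := Real.sqrt_nonneg (d p.1 ^ 2 + e p.2 ^ 2)
  have hqq := hqsq p
  rw [show u p.1 ^ 2 = _ from weight_sq d p.1, show v p.2 ^ 2 = _ from weight_sq e p.2] at hqq
  have := hq0 p
  rw [abs_le]
  constructor <;> nlinarith

end Tensor

/-! ### Off-diagonal operators on two copies of a Hilbert space. -/

section Double

open ComplexConjugate

variable {E : Type*} [NormedAddCommGroup E] [InnerProductSpace ℂ E] {κ : Type*}

/-- The operator matrix with rows `(0, X)` and `(Y, 0)`. -/
def offDiagOp (X Y : E →L[ℂ] E) : Double E →L[ℂ] Double E :=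
  ((WithLp.prodContinuousLinearEquiv 2 ℂ E E).symm : E × E →L[ℂ] Double E) ∘L
    ((X ∘L ContinuousLinearMap.snd ℂ E E).prod (Y ∘L ContinuousLinearMap.fst ℂ E E)) ∘L
    (WithLp.prodContinuousLinearEquiv 2 ℂ E E : Double E →L[ℂ] E × E)

lemma offDiagOp_apply (X Y : E →L[ℂ] E) (z : Double E) :
    offDiagOp X Y z = WithLp.toLp 2 (X z.snd, Y z.fst) := rfl

lemma doubleOp_apply (T : E →L[ℂ] E) (z : Double E) :
    doubleOp T z = WithLp.toLp 2 (T z.fst, T z.snd) := rfl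

lemma inner_double (z w : Double E) :
    inner ℂ z w = inner ℂ z.fst w.fst + inner ℂ z.snd w.snd := WithLp.prod_inner_apply z w

lemma double_ext {E : Type*} {z w : Double E} (h₁ : z.fst = w.fst) (h₂ : z.snd = w.snd) : z = w :=
  WithLp.ofLp_injective 2 (Prod.ext h₁ h₂)

/-- The vectors `(f_k, 0)` and `(0, f_k)`. -/
def doubleVec (f : HilbertBasis κ ℂ E) (p : κ × Bool) : Double E :=
  if p.2 then WithLp.toLp 2 (0, f p.1) else WithLp.toLp 2 (f p.1, 0)

lemma orthonormal_doubleVec (f : HilbertBasis κ ℂ E) : Orthonormal ℂ (doubleVec f) := by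
  classical
  rw [orthonormal_iff_ite]
  rintro ⟨k, ε⟩ ⟨l, ε'⟩
  rw [inner_double]
  cases ε <;> cases ε' <;> simp [doubleVec, inner_basis]

/-- The vectors `2^{-1/2} (f_k, ± u_k f_k)`. -/
def twistVec (f : HilbertBasis κ ℂ E) (u : κ → ℂ) (p : κ × Bool) : Double E :=
  (((√2)⁻¹ : ℝ) : ℂ) • WithLp.toLp 2 (f p.1, (if p.2 then -u p.1 else u p.1) • f p.1)

lemma inner_twistVec (f : HilbertBasis κ ℂ E) (u : κ → ℂ) (p : κ × Bool) (z : Double E) :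
    inner ℂ (twistVec f u p) z = (((√2)⁻¹ : ℝ) : ℂ) * (inner ℂ (f p.1) z.fst +
      (if p.2 then -conj (u p.1) else conj (u p.1)) * inner ℂ (f p.1) z.snd) := by
  rw [twistVec, inner_smul_left, Complex.conj_ofReal, inner_double]
  simp only [WithLp.toLp_fst, WithLp.toLp_snd, inner_smul_left]
  congr 3
  split_ifs <;> simp

lemma orthonormal_twistVec (f : HilbertBasis κ ℂ E) {u : κ → ℂ} (hu : ∀ k, conj (u k) * u k = 1) :
    Orthonormal ℂ (twistVec f u) := by
  classical
  rw [orthonormal_iff_ite]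
  rintro ⟨k, ε⟩ ⟨l, ε'⟩
  have h2 : (((√2)⁻¹ : ℝ) : ℂ) * (((√2)⁻¹ : ℝ) : ℂ) = 1 / 2 := by
    rw [← Complex.ofReal_mul, ← mul_inv, Real.mul_self_sqrt (by norm_num)]
    norm_num
  rw [inner_twistVec]
  have e₁ : (twistVec f u (l, ε')).fst = (((√2)⁻¹ : ℝ) : ℂ) • f l := rfl
  have e₂ : (twistVec f u (l, ε')).snd =
      (((√2)⁻¹ : ℝ) : ℂ) • (if ε' then -u l else u l) • f l := rfl
  rw [e₁, e₂]
  simp only [inner_smul_right, inner_basis, Prod.mk.injEq]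
  by_cases hkl : k = l
  · subst hkl
    have h1 := hu k
    cases ε <;> cases ε' <;> simp only [if_true, if_false, true_and, mul_one, Bool.false_eq_true,
      reduceCtorEq]
    · linear_combination (1 + conj (u k) * u k) * h2 + 1 / 2 * h1
    · linear_combination (1 - conj (u k) * u k) * h2 - 1 / 2 * h1
    · linear_combination (1 - conj (u k) * u k) * h2 - 1 / 2 * h1
    · linear_combination (1 + conj (u k) * u k) * h2 + 1 / 2 * h1
  · simp [hkl]

variable [CompleteSpace E]

/-- The basis of `E ⊕ E` consisting of the vectors `(f_k, 0)` and `(0, f_k)`. -/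
def doubleBasis (f : HilbertBasis κ ℂ E) : HilbertBasis (κ × Bool) ℂ (Double E) :=
  HilbertBasis.mkOfOrthogonalEqBot (orthonormal_doubleVec f) <| by
    rw [Submodule.eq_bot_iff]
    intro z hz
    rw [Submodule.mem_orthogonal] at hz
    refine double_ext (coef_ext f fun k => ?_) (coef_ext f fun k => ?_)
    · have := hz _ (Submodule.subset_span ⟨(k, false), rfl⟩)
      simpa [inner_double, doubleVec] using this
    · have := hz _ (Submodule.subset_span ⟨(k, true), rfl⟩)
      simpa [inner_double, doubleVec] using this

lemma doubleBasis_apply (f : HilbertBasis κ ℂ E) (p : κ × Bool) :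
    doubleBasis f p = doubleVec f p := by
  rw [doubleBasis, HilbertBasis.coe_mkOfOrthogonalEqBot]

lemma inner_doubleBasis (f : HilbertBasis κ ℂ E) (p : κ × Bool) (z : Double E) :
    inner ℂ (doubleBasis f p) z = inner ℂ (f p.1) (if p.2 then z.snd else z.fst) := by
  obtain ⟨k, ε⟩ := p
  rw [doubleBasis_apply, inner_double]
  cases ε <;> simp [doubleVec]

lemma mat_doubleOp (f : HilbertBasis κ ℂ E) (T : E →L[ℂ] E) (p q : κ × Bool) :
    mat (doubleBasis f) (doubleOp T) p q = if p.2 = q.2 then mat f T p.1 q.1 else 0 := by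
  obtain ⟨k, ε⟩ := p
  obtain ⟨l, ε'⟩ := q
  rw [mat, inner_doubleBasis, doubleBasis_apply, doubleOp_apply]
  cases ε <;> cases ε' <;> simp [doubleVec, mat]

lemma mat_offDiagOp (f : HilbertBasis κ ℂ E) (X Y : E →L[ℂ] E) (p q : κ × Bool) :
    mat (doubleBasis f) (offDiagOp X Y) p q =
      if p.2 = q.2 then 0 else if p.2 then mat f Y p.1 q.1 else mat f X p.1 q.1 := by
  obtain ⟨k, ε⟩ := p
  obtain ⟨l, ε'⟩ := q
  rw [mat, inner_doubleBasis, doubleBasis_apply, offDiagOp_apply]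
  cases ε <;> cases ε' <;> simp [doubleVec, mat]

lemma smoothMat_doubleOp {f : HilbertBasis κ ℂ E} {r : κ → ℝ} {T : E →L[ℂ] E}
    (h : SmoothMat r (mat f T)) :
    SmoothMat (fun p : κ × Bool => r p.1) (mat (doubleBasis f) (doubleOp T)) := by
  intro k
  obtain ⟨C, hC⟩ := (h k).exists_op f
  convert bddMat_mat (doubleBasis f) (doubleOp C) using 3 with p q
  rw [mat_doubleOp, mat_doubleOp, hC, mul_ite, mul_zero]

lemma smoothMat_offDiagOp {f : HilbertBasis κ ℂ E} {r : κ → ℝ} {X Y : E →L[ℂ] E}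
    (hX : SmoothMat r (mat f X)) (hY : SmoothMat r (mat f Y)) :
    SmoothMat (fun p : κ × Bool => r p.1) (mat (doubleBasis f) (offDiagOp X Y)) := by
  intro k
  obtain ⟨C, hC⟩ := (hX k).exists_op f
  obtain ⟨C', hC'⟩ := (hY k).exists_op f
  convert bddMat_mat (doubleBasis f) (offDiagOp C C') using 3 with p q
  rw [mat_offDiagOp, mat_offDiagOp, hC, hC', mul_ite, mul_ite, mul_zero]

/-- The basis of `E ⊕ E` consisting of the vectors `2^{-1/2} (f_k, ± u_k f_k)`. -/
def twistBasis (f : HilbertBasis κ ℂ E) {u : κ → ℂ} (hu : ∀ k, conj (u k) * u k = 1) :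
    HilbertBasis (κ × Bool) ℂ (Double E) :=
  HilbertBasis.mkOfOrthogonalEqBot (orthonormal_twistVec f hu) <| by
    rw [Submodule.eq_bot_iff]
    intro z hz
    rw [Submodule.mem_orthogonal] at hz
    have h0 : (((√2)⁻¹ : ℝ) : ℂ) ≠ 0 := by
      exact_mod_cast (inv_pos.2 (Real.sqrt_pos.2 two_pos)).ne'
    have key : ∀ k, inner ℂ (f k) z.fst = 0 ∧ inner ℂ (f k) z.snd = 0 := by
      intro k
      have h₁ := hz _ (Submodule.subset_span ⟨(k, false), rfl⟩)
      have h₂ := hz _ (Submodule.subset_span ⟨(k, true), rfl⟩)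
      rw [inner_twistVec, mul_eq_zero] at h₁ h₂
      have h₁ := h₁.resolve_left h0
      have h₂ := h₂.resolve_left h0
      simp only [if_true, if_false, Bool.false_eq_true] at h₁ h₂
      constructor
      · linear_combination (h₁ + h₂) / 2
      · linear_combination (u k) * (h₁ - h₂) / 2 - inner ℂ (f k) z.snd * hu k
    exact double_ext (coef_ext f fun k => by simpa using (key k).1)
      (coef_ext f fun k => by simpa using (key k).2)

lemma inner_twistBasis (f : HilbertBasis κ ℂ E) {u : κ → ℂ} (hu : ∀ k, conj (u k) * u k = 1)
    (p : κ × Bool) (z : Double E) :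
    inner ℂ (twistBasis f hu p) z = (((√2)⁻¹ : ℝ) : ℂ) * (inner ℂ (f p.1) z.fst +
      (if p.2 then -conj (u p.1) else conj (u p.1)) * inner ℂ (f p.1) z.snd) := by
  rw [twistBasis, HilbertBasis.coe_mkOfOrthogonalEqBot, inner_twistVec]

/-- In the basis `f`, the operator `S` on `E ⊕ E` is the maximal operator matrix with rows
`(0, z̄)` and `(z, 0)`. -/
def IsOffDiag (S : Double E →ₗ.[ℂ] Double E) (f : HilbertBasis κ ℂ E) (z : κ → ℂ) : Prop :=
  ∀ ξ η : Double E, (ξ, η) ∈ S.graph ↔ ∀ k,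
    inner ℂ (f k) η.fst = conj (z k) * inner ℂ (f k) ξ.snd ∧
      inner ℂ (f k) η.snd = z k * inner ℂ (f k) ξ.fst

lemma exists_phase (z : κ → ℂ) : ∃ u : κ → ℂ, (∀ k, conj (u k) * u k = 1) ∧
    ∀ k, z k = (‖z k‖ : ℂ) * u k := by
  -- The value `1` at a zero of `z` is arbitrary; any number of modulus one would do.
  refine ⟨fun k => if z k = 0 then 1 else z k / (‖z k‖ : ℂ), fun k => ?_, fun k => ?_⟩
  · by_cases h : z k = 0
    · simp [h]
    · have hn : (‖z k‖ : ℂ) ≠ 0 := by exact_mod_cast norm_ne_zero_iff.2 h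
      simp only [h, if_false]
      rw [Complex.conj_mul', norm_div, Complex.norm_real, norm_norm,
        div_self (norm_ne_zero_iff.2 h)]
      simp
  · by_cases h : z k = 0
    · simp [h]
    · have hn : (‖z k‖ : ℂ) ≠ 0 := by exact_mod_cast norm_ne_zero_iff.2 h
      simp only [h, if_false]
      field_simp

/-- The block with rows `(0, z̄)` and `(z, 0)`, where `z = |z| u`, has eigenvectors `(1, ±u)` with
eigenvalues `±|z|`. -/
lemma IsOffDiag.isDiag_twistBasis {S : Double E →ₗ.[ℂ] Double E} {f : HilbertBasis κ ℂ E}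
    {z : κ → ℂ} (hS : IsOffDiag S f z) {u : κ → ℂ} (hu : ∀ k, conj (u k) * u k = 1)
    (hz : ∀ k, z k = (‖z k‖ : ℂ) * u k) :
    IsDiag S (twistBasis f hu) fun p => if p.2 then -‖z p.1‖ else ‖z p.1‖ := by
  have h0 : (((√2)⁻¹ : ℝ) : ℂ) ≠ 0 := by
    exact_mod_cast (inv_pos.2 (Real.sqrt_pos.2 two_pos)).ne'
  intro ξ η
  rw [hS]
  have hcz : ∀ k, conj (z k) = (‖z k‖ : ℂ) * conj (u k) := fun k => by
    conv_lhs => rw [hz k]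
    rw [map_mul, Complex.conj_ofReal]
  constructor
  · rintro h ⟨k, ε⟩
    obtain ⟨h₁, h₂⟩ := h k
    rw [inner_twistBasis, inner_twistBasis]
    simp only
    rw [h₁, h₂, hcz]
    cases ε
    · simp only [if_false, Bool.false_eq_true]
      linear_combination (((√2)⁻¹ : ℝ) : ℂ) * inner ℂ (f k) ξ.fst *
        (conj (u k) * hz k + (‖z k‖ : ℂ) * hu k)
    · simp only [if_true, Complex.ofReal_neg]
      linear_combination -(((√2)⁻¹ : ℝ) : ℂ) * inner ℂ (f k) ξ.fst *
        (conj (u k) * hz k + (‖z k‖ : ℂ) * hu k)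
  · intro h k
    have h₁ := h (k, false)
    have h₂ := h (k, true)
    rw [inner_twistBasis, inner_twistBasis] at h₁ h₂
    simp only [if_true, if_false, Bool.false_eq_true, Complex.ofReal_neg] at h₁ h₂
    have h₁' := mul_left_cancel₀ h0 (h₁.trans (mul_left_comm _ _ _))
    have h₂' := mul_left_cancel₀ h0 (h₂.trans (mul_left_comm _ _ _))
    constructor
    · linear_combination (h₁' + h₂') / 2 - inner ℂ (f k) ξ.snd * hcz k
    · linear_combination u k * (h₁' - h₂') / 2 - inner ℂ (f k) η.snd * hu k -
        inner ℂ (f k) ξ.fst * hz k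

/-- On each two-dimensional block both eigenvalues have absolute value `|z k|`, so `|S|` is scalar
there. It is therefore diagonal in the untwisted basis too, where `T ⊕ T` has a simple matrix. -/
lemma IsOffDiag.isDiag_absOp {S : Double E →ₗ.[ℂ] Double E} {f : HilbertBasis κ ℂ E}
    {z : κ → ℂ} (hS : IsOffDiag S f z) :
    IsDiag (absOp S) (doubleBasis f) fun p => ‖z p.1‖ := by
  obtain ⟨u, hu, hz⟩ := exists_phase z
  have h := (hS.isDiag_twistBasis hu hz).absOp
  have h0 : (((√2)⁻¹ : ℝ) : ℂ) ≠ 0 := by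
    exact_mod_cast (inv_pos.2 (Real.sqrt_pos.2 two_pos)).ne'
  intro ξ η
  rw [h]
  have habs : ∀ p : κ × Bool, |if p.2 then -‖z p.1‖ else ‖z p.1‖| = ‖z p.1‖ := fun p => by
    split_ifs <;> simp
  simp only [inner_twistBasis, inner_doubleBasis, habs]
  constructor
  · rintro h ⟨k, ε⟩
    have h₁ := h (k, false)
    have h₂ := h (k, true)
    simp only [if_true, if_false, Bool.false_eq_true] at h₁ h₂
    have h₁' := mul_left_cancel₀ h0 (h₁.trans (mul_left_comm _ _ _))
    have h₂' := mul_left_cancel₀ h0 (h₂.trans (mul_left_comm _ _ _))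
    cases ε
    · simp only [if_false, Bool.false_eq_true]
      linear_combination (h₁' + h₂') / 2
    · simp only [if_true]
      linear_combination u k * (h₁' - h₂') / 2 -
        (inner ℂ (f k) η.snd - (‖z k‖ : ℂ) * inner ℂ (f k) ξ.snd) * hu k
  · rintro h ⟨k, ε⟩
    have h₁ := h (k, false)
    have h₂ := h (k, true)
    simp only [if_true, if_false, Bool.false_eq_true] at h₁ h₂
    simp only
    rw [h₁, h₂]
    ring

end Double

/-! ### The Dirac operator of an exterior product. -/

section ProductDirac

open ComplexConjugate

variable {H K : Type*} [NormedAddCommGroup H] [InnerProductSpace ℂ H]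
  [NormedAddCommGroup K] [InnerProductSpace ℂ K] {ι κ : Type*}
  {b : HilbertBasis ι ℂ H} {c : HilbertBasis κ ℂ K} {D : H →ₗ.[ℂ] H} {M : K →ₗ.[ℂ] K}
  {d : ι → ℝ} {e : κ → ℝ}

lemma hasSum_inner_smul {E μ : Type*} [NormedAddCommGroup E] [InnerProductSpace ℂ E]
    (f : HilbertBasis μ ℂ E) (x : E) : HasSum (fun k => inner ℂ (f k) x • f k) x := by
  simpa [f.repr_apply_apply] using f.hasSum_repr x

/-- Products of eigenvectors span a core. The coefficient equations are closed and linear, so they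
pass from simple tensors to the closure; conversely, the partial sums of the basis expansion of a
pair satisfying them already lie in the graph before closure. -/
lemma mem_closure_productDiracGraph (hD : IsDiag D b d) (hM : IsDiag M c e)
    (p : Double (HilbertTensor H K) × Double (HilbertTensor H K)) :
    p ∈ (productDiracGraph D M).topologicalClosure ↔ ∀ k : ι × κ,
      inner ℂ (tensorBasis b c k) p.2.fst =
          conj (d k.1 + Complex.I * e k.2 : ℂ) * inner ℂ (tensorBasis b c k) p.1.snd ∧
        inner ℂ (tensorBasis b c k) p.2.snd =
          (d k.1 + Complex.I * e k.2 : ℂ) * inner ℂ (tensorBasis b c k) p.1.fst := by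
  have hconj : ∀ k : ι × κ, conj (d k.1 + Complex.I * e k.2 : ℂ) = d k.1 - Complex.I * e k.2 := by
    intro k
    simp [sub_eq_add_neg]
  set f := tensorBasis b c with hf
  let fstL := WithLp.fstL 2 ℂ (HilbertTensor H K) (HilbertTensor H K)
  let sndL := WithLp.sndL 2 ℂ (HilbertTensor H K) (HilbertTensor H K)
  constructor
  · intro hp
    have hclosed : ∀ (φ : Double (HilbertTensor H K) × Double (HilbertTensor H K) →L[ℂ] ℂ),
        (∀ q ∈ productDiracGraph D M, φ q = 0) → φ p = 0 := by
      intro φ hφ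
      have hle : productDiracGraph D M ≤ LinearMap.ker φ.toLinearMap := fun q hq => hφ q hq
      exact Submodule.topologicalClosure_minimal _ hle φ.isClosed_ker hp
    intro k
    constructor
    · let φ : Double (HilbertTensor H K) × Double (HilbertTensor H K) →L[ℂ] ℂ :=
        innerSL ℂ (f k) ∘L fstL ∘L ContinuousLinearMap.snd ℂ _ _ -
          conj (d k.1 + Complex.I * e k.2 : ℂ) •
            (innerSL ℂ (f k) ∘L sndL ∘L ContinuousLinearMap.fst ℂ _ _)
      refine sub_eq_zero.1 (hclosed φ fun q hq => ?_)
      refine (Submodule.span_le (p := LinearMap.ker φ.toLinearMap)).2 ?_ hq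
      rintro _ ⟨x, x', y, y', rfl⟩
      refine sub_eq_zero.2 ?_
      change inner ℂ (f k) (htmul (D x') (y' : K) - Complex.I • htmul (x' : H) (M y')) =
        conj (d k.1 + Complex.I * e k.2 : ℂ) * inner ℂ (f k) (htmul (x' : H) (y' : K))
      rw [inner_sub_right, inner_smul_right, inner_tensorBasis_htmul, inner_tensorBasis_htmul,
        inner_tensorBasis_htmul, hD.inner_apply, hM.inner_apply, hconj]
      ring
    · let φ : Double (HilbertTensor H K) × Double (HilbertTensor H K) →L[ℂ] ℂ :=
        innerSL ℂ (f k) ∘L sndL ∘L ContinuousLinearMap.snd ℂ _ _ -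
          (d k.1 + Complex.I * e k.2 : ℂ) •
            (innerSL ℂ (f k) ∘L fstL ∘L ContinuousLinearMap.fst ℂ _ _)
      refine sub_eq_zero.1 (hclosed φ fun q hq => ?_)
      refine (Submodule.span_le (p := LinearMap.ker φ.toLinearMap)).2 ?_ hq
      rintro _ ⟨x, x', y, y', rfl⟩
      refine sub_eq_zero.2 ?_
      change inner ℂ (f k) (htmul (D x) (y : K) + Complex.I • htmul (x : H) (M y)) =
        (d k.1 + Complex.I * e k.2 : ℂ) * inner ℂ (f k) (htmul (x : H) (y : K))
      rw [inner_add_right, inner_smul_right, inner_tensorBasis_htmul, inner_tensorBasis_htmul,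
        inner_tensorBasis_htmul, hD.inner_apply, hM.inner_apply]
      ring
  · intro h
    obtain ⟨ξ, η⟩ := p
    let toLpL := ((WithLp.prodContinuousLinearEquiv 2 ℂ (HilbertTensor H K)
      (HilbertTensor H K)).symm :
        HilbertTensor H K × HilbertTensor H K →L[ℂ] Double (HilbertTensor H K))
    have hξ := ((hasSum_inner_smul f ξ.fst).prodMk
      (hasSum_inner_smul f ξ.snd)).mapL toLpL
    have hη := ((hasSum_inner_smul f η.fst).prodMk
      (hasSum_inner_smul f η.snd)).mapL toLpL
    have hsum := hξ.prodMk hη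
    refine (Submodule.isClosed_topologicalClosure _).mem_of_tendsto hsum
      (Filter.Eventually.of_forall fun F => ?_)
    refine Submodule.le_topologicalClosure _ (Submodule.sum_mem _ fun k _ => ?_)
    obtain ⟨h₁, h₂⟩ := h k
    obtain ⟨hb, hb'⟩ := hD.exists_apply_basis k.1
    obtain ⟨hc, hc'⟩ := hM.exists_apply_basis k.2
    refine Submodule.subset_span ⟨inner ℂ (f k) ξ.fst • ⟨b k.1, hb⟩,
      inner ℂ (f k) ξ.snd • ⟨b k.1, hb⟩, ⟨c k.2, hc⟩, ⟨c k.2, hc⟩, ?_⟩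
    rw [D.map_smul, D.map_smul, hb', hc']
    simp only [Submodule.coe_smul, htmul_smul_left, htmul_smul_right]
    rw [← tensorBasis_apply, ← hf]
    change (WithLp.toLp 2 (_, _), WithLp.toLp 2 (_, _)) = _
    simp only at h₁ h₂
    rw [h₁, h₂, hconj]
    refine congrArg (Prod.mk _) (congrArg (WithLp.toLp 2) (Prod.ext ?_ ?_)) <;> simp only <;> module

lemma isOffDiag_productDirac (hD : IsDiag D b d) (hM : IsDiag M c e) :
    IsOffDiag (productDirac D M) (tensorBasis b c)
      fun k => (d k.1 + Complex.I * e k.2 : ℂ) := by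
  intro ξ η
  rw [productDirac, Submodule.toLinearPMap_graph_eq, mem_closure_productDiracGraph hD hM]
  -- The remaining obligation is closability: the closure is the graph of an operator because the
  -- coefficient equations force `y = 0` when `x = 0`.
  rintro ⟨x, y⟩ hx (rfl : x = 0)
  rw [mem_closure_productDiracGraph hD hM] at hx
  refine double_ext (coef_ext (tensorBasis b c) fun k => ?_)
    (coef_ext (tensorBasis b c) fun k => ?_)
  · simpa using (hx k).1
  · simpa using (hx k).2

lemma norm_add_I_mul (x y : ℝ) : ‖(x + Complex.I * y : ℂ)‖ = √(x ^ 2 + y ^ 2) := by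
  rw [mul_comm, Complex.norm_add_mul_I]

lemma mem_graph_productDirac (hD : IsDiag D b d) (hM : IsDiag M c e) :
    (productDirac D M).graph = (productDiracGraph D M).topologicalClosure := by
  ext ⟨ξ, η⟩
  rw [isOffDiag_productDirac hD hM, mem_closure_productDiracGraph hD hM]

/-- The identity is elementary on simple tensors of domain vectors; boundedness of all operators
involved carries it to the closed graph. -/
lemma isBoundedCommutator_productDirac (hD : IsDiag D b d) (hM : IsDiag M c e)
    {T C : H →L[ℂ] H} {T' C' : K →L[ℂ] K} (hC : IsBoundedCommutator D T C)
    (hC' : IsBoundedCommutator M T' C') :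
    IsBoundedCommutator (productDirac D M) (doubleOp (tensorOp T T'))
      (offDiagOp (tensorOp C T' + (-Complex.I) • tensorOp T C')
        (tensorOp C T' + Complex.I • tensorOp T C')) := by
  set R := doubleOp (tensorOp T T')
  set Q := offDiagOp (tensorOp C T' + (-Complex.I) • tensorOp T C')
    (tensorOp C T' + Complex.I • tensorOp T C')
  -- Having commutator `Q` with `R` means that the bounded map `(ξ, η) ↦ (R ξ, R η + Q ξ)` preserves
  -- the graph, a property that survives closure.
  let Λ : Double (HilbertTensor H K) × Double (HilbertTensor H K) →L[ℂ]
      Double (HilbertTensor H K) × Double (HilbertTensor H K) :=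
    (R ∘L ContinuousLinearMap.fst ℂ _ _).prod
      (R ∘L ContinuousLinearMap.snd ℂ _ _ + Q ∘L ContinuousLinearMap.fst ℂ _ _)
  have hle : productDiracGraph D M ≤ (productDiracGraph D M).comap Λ.toLinearMap := by
    refine Submodule.span_le.2 ?_
    rintro _ ⟨x, x', y, y', rfl⟩
    obtain ⟨h₁, h₂⟩ := hC x
    obtain ⟨h₁', h₂'⟩ := hC x'
    obtain ⟨h₃, h₄⟩ := hC' y
    obtain ⟨h₃', h₄'⟩ := hC' y'
    refine Submodule.subset_span ⟨⟨T x, h₁⟩, ⟨T x', h₁'⟩, ⟨T' y, h₃⟩, ⟨T' y', h₃'⟩, ?_⟩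
    rw [eq_add_of_sub_eq h₂, eq_add_of_sub_eq h₂', eq_add_of_sub_eq h₄, eq_add_of_sub_eq h₄']
    refine Prod.ext (double_ext ?_ ?_) (double_ext ?_ ?_)
    · exact tensorOp_htmul _ _ _ _
    · exact tensorOp_htmul _ _ _ _
    · change tensorOp T T' (htmul (D x') (y' : K) - Complex.I • htmul (x' : H) (M y')) +
        (tensorOp C T' + (-Complex.I) • tensorOp T C') (htmul (x' : H) (y' : K)) =
        htmul (C x' + T (D x')) (T' y') - Complex.I • htmul (T x') (C' y' + T' (M y'))
      simp only [map_sub, map_smul, add_apply, smul_apply, tensorOp_htmul, htmul_add_left,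
        htmul_add_right]
      module
    · change tensorOp T T' (htmul (D x) (y : K) + Complex.I • htmul (x : H) (M y)) +
        (tensorOp C T' + Complex.I • tensorOp T C') (htmul (x : H) (y : K)) =
        htmul (C x + T (D x)) (T' y) + Complex.I • htmul (T x) (C' y + T' (M y))
      simp only [map_add, map_smul, add_apply, smul_apply, tensorOp_htmul, htmul_add_left,
        htmul_add_right]
      module
  have hcl : (productDiracGraph D M).topologicalClosure ≤
      (productDiracGraph D M).topologicalClosure.comap Λ.toLinearMap :=
    Submodule.topologicalClosure_minimal _
      (hle.trans (Submodule.comap_mono (Submodule.le_topologicalClosure _)))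
      ((Submodule.isClosed_topologicalClosure _).preimage Λ.continuous)
  rw [← mem_graph_productDirac hD hM] at hcl
  intro ξ
  have h := hcl ((productDirac D M).mem_graph ξ)
  obtain ⟨η, h₁, h₂⟩ := (LinearPMap.mem_graph_iff _).1 h
  change (η : Double (HilbertTensor H K)) = R ξ at h₁
  change productDirac D M η = R (productDirac D M ξ) + Q ξ at h₂
  refine ⟨h₁ ▸ η.2, ?_⟩
  have : (⟨R ξ, h₁ ▸ η.2⟩ : (productDirac D M).domain) = η := Subtype.ext h₁.symm
  rw [this, h₂]
  abel

lemma isSelfAdjoint_productDirac (hD : IsDiag D b d) (hM : IsDiag M c e) :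
    IsSelfAdjoint (productDirac D M) := by
  obtain ⟨u, hu, hz⟩ := exists_phase fun k : ι × κ => (d k.1 + Complex.I * e k.2 : ℂ)
  exact ((isOffDiag_productDirac hD hM).isDiag_twistBasis hu hz).isSelfAdjoint

lemma hasCompactResolvent_productDirac (hD : IsDiag D b d) (hM : IsDiag M c e)
    (hd : ∀ R : ℝ, {i | |d i| ≤ R}.Finite) (he : ∀ R : ℝ, {j | |e j| ≤ R}.Finite) :
    HasCompactResolvent (productDirac D M) := by
  obtain ⟨u, hu, hz⟩ := exists_phase fun k : ι × κ => (d k.1 + Complex.I * e k.2 : ℂ)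
  refine ((isOffDiag_productDirac hD hM).isDiag_twistBasis hu hz).hasCompactResolvent fun R => ?_
  refine (((hd R).prod (he R)).prod (Set.finite_univ (α := Bool))).subset ?_
  rintro ⟨⟨i, j⟩, ε⟩ h
  have h' : √(d i ^ 2 + e j ^ 2) ≤ R := by
    rw [← norm_add_I_mul]
    refine le_trans (le_of_eq ?_) (show |_| ≤ R from h)
    cases ε <;> simp
  refine ⟨⟨?_, ?_⟩, trivial⟩
  · exact (Real.abs_le_sqrt (by nlinarith [sq_nonneg (e j)])).trans h'
  · exact (Real.abs_le_sqrt (by nlinarith [sq_nonneg (d i)])).trans h'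

lemma mat_add_smul {μ : Type*} (f : HilbertBasis μ ℂ H) (S T : H →L[ℂ] H) (z : ℂ) :
    mat f (S + z • T) = fun i j => mat f S i j + z * mat f T i j := by
  funext i j
  simp only [mat, add_apply, smul_apply, inner_add_right, inner_smul_right]

variable [CompleteSpace H] [CompleteSpace K]

/-- The exterior product of regular operators is regular for the product Dirac operator. -/
lemma IsRegularOp.doubleOp_tensorOp (hD : IsDiag D b d) (hM : IsDiag M c e) {T : H →L[ℂ] H}
    {T' : K →L[ℂ] K} (hT : IsRegularOp D T) (hT' : IsRegularOp M T') :
    IsRegularOp (productDirac D M) (doubleOp (tensorOp T T')) := by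
  obtain ⟨hT, C, hC, hC₁⟩ := hT
  obtain ⟨hT', C', hC', hC₁'⟩ := hT'
  have habs := (isOffDiag_productDirac hD hM).isDiag_absOp
  rw [hD.absOp.inDomInfty_iff] at hT hC₁
  rw [hM.absOp.inDomInfty_iff] at hT' hC₁'
  have key : ∀ {S : H →L[ℂ] H} {S' : K →L[ℂ] K}, SmoothMat (fun i => |d i|) (mat b S) →
      SmoothMat (fun j => |e j|) (mat c S') →
      SmoothMat (fun k : ι × κ => ‖(d k.1 + Complex.I * e k.2 : ℂ)‖)
        (mat (tensorBasis b c) (tensorOp S S')) := by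
    intro S S' hS hS'
    have e₁ : (fun k : ι × κ => ‖(d k.1 + Complex.I * e k.2 : ℂ)‖) =
        fun k => √(d k.1 ^ 2 + e k.2 ^ 2) := funext fun k => norm_add_I_mul _ _
    have e₂ : mat (tensorBasis b c) (tensorOp S S') = fun p q =>
        mat b S p.1 q.1 * mat c S' p.2 q.2 := funext fun p => funext (mat_tensorOp b c S S' p)
    rw [e₁, e₂]
    exact hS.kronecker b c hS'
  -- Both nonzero blocks of the commutator have this form, with `z = -i` and `z = i`.
  have key' : ∀ z : ℂ, SmoothMat (fun k : ι × κ => ‖(d k.1 + Complex.I * e k.2 : ℂ)‖)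
      (mat (tensorBasis b c) (tensorOp C T' + z • tensorOp T C')) := by
    intro z
    rw [mat_add_smul]
    exact (key hC₁ hT').add ((key hT hC₁').const_mul z)
  have h₁ := smoothMat_doubleOp (key hT hT')
  have h₂ := smoothMat_offDiagOp (key' (-Complex.I)) (key' Complex.I)
  refine ⟨habs.inDomInfty_iff.2 h₁, _, isBoundedCommutator_productDirac hD hM hC hC', ?_⟩
  exact habs.inDomInfty_iff.2 h₂

end ProductDirac

/-! ### Diagonalisation of the length operator. -/

section Length

variable {G : Type*} {V : Type*} [NormedAddCommGroup V] [InnerProductSpace ℂ V] [CompleteSpace V]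

/-- The basis of `ℓ²(G, V)` obtained from a family of orthonormal bases of `V`. -/
lemma exists_lpBasis [DecidableEq G] {n : ℕ} (v : G → OrthonormalBasis (Fin n) ℂ V) :
    ∃ c : HilbertBasis (G × Fin n) ℂ (lp (fun _ : G => V) 2),
      ∀ p, c p = lp.single 2 p.1 (v p.1 p.2) := by
  have hon : Orthonormal ℂ fun p : G × Fin n =>
      (lp.single 2 p.1 (v p.1 p.2) : lp (fun _ : G => V) 2) := by
    rw [orthonormal_iff_ite]
    rintro ⟨x, k⟩ ⟨y, l⟩
    rw [lp.inner_single_left]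
    by_cases h : x = y
    · subst h
      simp [orthonormal_iff_ite.1 (v x).orthonormal k l]
    · simp [h, lp.single_apply]
  refine ⟨HilbertBasis.mkOfOrthogonalEqBot hon ?_, fun p => by
    rw [HilbertBasis.coe_mkOfOrthogonalEqBot]⟩
  rw [Submodule.eq_bot_iff]
  intro z hz
  rw [Submodule.mem_orthogonal] at hz
  ext x
  refine coef_ext (v x).toHilbertBasis fun k => ?_
  rw [OrthonormalBasis.coe_toHilbertBasis]
  have := hz _ (Submodule.subset_span ⟨(x, k), rfl⟩)
  simp only [lp.inner_single_left] at this
  simpa using this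

/-- Eigenbases of the self-adjoint matrices `ℓ x` combine into a basis of `ℓ²(G, V)`. Properness
gives finite multiplicities: a bounded interval contains finitely many spectral values, each
attained at finitely many `x`. -/
lemma exists_isDiag_mulLength [Group G] [FiniteDimensional ℂ V] {ℓ : G → V →L[ℂ] V} (hℓ : IsProperTranslationBounded ℓ) :
    ∃ (c : HilbertBasis (G × Fin (Module.finrank ℂ V)) ℂ (lp (fun _ : G => V) 2))
      (e : G × Fin (Module.finrank ℂ V) → ℝ),
      IsDiag (mulLength ℓ) c e ∧ ∀ R : ℝ, {j | |e j| ≤ R}.Finite := by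
  classical
  have hsymm : ∀ x, (ℓ x : V →ₗ[ℂ] V).IsSymmetric := fun x => (hℓ.selfAdjoint x).isSymmetric
  let v : G → OrthonormalBasis (Fin (Module.finrank ℂ V)) ℂ V := fun x =>
    (hsymm x).eigenvectorBasis rfl
  let ev : G → Fin (Module.finrank ℂ V) → ℝ := fun x => (hsymm x).eigenvalues rfl
  have hev : ∀ x k, ℓ x (v x k) = (ev x k : ℂ) • v x k := fun x k =>
    (hsymm x).apply_eigenvectorBasis rfl k
  have hinner : ∀ x k w, inner ℂ (v x k) (ℓ x w) = ev x k * inner ℂ (v x k) w := by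
    intro x k w
    have := hsymm x (v x k) w
    rw [ContinuousLinearMap.coe_coe, hev, inner_smul_left, Complex.conj_ofReal] at this
    exact this.symm
  obtain ⟨c, hc⟩ := exists_lpBasis v
  have hcin : ∀ p (f : lp (fun _ : G => V) 2), inner ℂ (c p) f = inner ℂ (v p.1 p.2) (f p.1) := by
    intro p f
    rw [hc, lp.inner_single_left]
  refine ⟨c, fun p => ev p.1 p.2, fun f w => ?_, fun R => ?_⟩
  · constructor
    · intro h p
      obtain ⟨g, rfl, rfl⟩ := (LinearPMap.mem_graph_iff _).1 h
      rw [hcin, hcin]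
      exact hinner _ _ _
    · intro h
      have hw : ∀ x, w x = ℓ x (f x) := by
        intro x
        refine coef_ext (v x).toHilbertBasis fun k => ?_
        have := h (x, k)
        rw [hcin, hcin] at this
        rw [OrthonormalBasis.coe_toHilbertBasis, this, hinner]
      have hmem : Memℓp (fun x => ℓ x (f x)) 2 := by
        rw [← show (w : G → V) = fun x => ℓ x (f x) from funext hw]
        exact lp.memℓp w
      refine (LinearPMap.mem_graph_iff _).2 ⟨⟨f, hmem⟩, rfl, ?_⟩
      ext x
      exact (hw x).symm
  · have hspec : ∀ x k, ev x k ∈ spectrum ℝ (ℓ x) := by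
      intro x k
      rw [spectrum.mem_iff]
      intro hu
      have hz : (algebraMap ℝ (V →L[ℂ] V) (ev x k) - ℓ x) (v x k) = 0 := by
        rw [sub_apply, hev, Algebra.algebraMap_eq_smul_one, smul_apply,
          one_apply_eq_self, Complex.coe_smul, sub_self]
      have h0 : v x k = 0 := by
        obtain ⟨w, hw⟩ := hu
        have := congrArg (fun A : V →L[ℂ] V => A (v x k)) w.inv_mul
        simp only [hw, mul_apply_eq_comp, hz, map_zero] at this
        exact this.symm
      have := (v x).orthonormal.1 k
      rw [h0, norm_zero] at this
      exact zero_ne_one this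
    have hfin : {x : G | ∃ k, |ev x k| ≤ R}.Finite := by
      refine ((hℓ.discrete R).biUnion fun t ht => hℓ.finite_fibers t ht.1).subset ?_
      rintro x ⟨k, hk⟩
      exact Set.mem_biUnion ⟨Set.mem_iUnion.2 ⟨x, hspec x k⟩, abs_le.1 hk⟩ (hspec x k)
    refine (hfin.prod (Set.finite_univ (α := Fin (Module.finrank ℂ V)))).subset ?_
    rintro ⟨x, k⟩ h
    exact ⟨⟨k, h⟩, trivial⟩

end Length

/-! ### Operators satisfying the relations of the twisted crossed product. -/

section CrossedRep

variable {A : Type*} [CStarAlgebra A] {G : Type*}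
  {K : Type*} [NormedAddCommGroup K] [InnerProductSpace ℂ K]

/-- The linear extension of `r` to the finitely supported functions. -/
def crossedSum (r : G → A →L[ℂ] (K →L[ℂ] K)) : (G →₀ A) →ₗ[ℂ] (K →L[ℂ] K) :=
  Finsupp.lsum ℂ fun x => (r x : A →ₗ[ℂ] (K →L[ℂ] K))

lemma crossedSum_single (r : G → A →L[ℂ] (K →L[ℂ] K)) (x : G) (a : A) :
    crossedSum r (Finsupp.single x a) = r x a := by
  simp [crossedSum]

lemma crossedSum_apply (r : G → A →L[ℂ] (K →L[ℂ] K)) (f : G →₀ A) :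
    crossedSum r f = f.sum fun x a => r x a := rfl

/-- The finitely supported functions with values in `𝒜`, as a submodule. -/
def finSuppSubmodule (G : Type*) (𝒜 : StarSubalgebra ℂ A) : Submodule ℂ (G →₀ A) where
  carrier := finSupp G 𝒜
  zero_mem' := fun _ => 𝒜.zero_mem
  add_mem' := fun hf hg x => 𝒜.add_mem (hf x) (hg x)
  smul_mem' := fun c _ hf x => 𝒜.smul_mem (hf x) c

lemma single_mem_finSupp {𝒜 : StarSubalgebra ℂ A} (x : G) {a : A} (ha : a ∈ 𝒜) :
    Finsupp.single x a ∈ finSupp G 𝒜 := by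
  classical
  intro y
  rw [Finsupp.single_apply]
  split_ifs
  exacts [ha, 𝒜.zero_mem]

variable [Group G] [CompleteSpace K]

/-- The operators `r x a` satisfy the relations of the elements `a δₓ` of the twisted crossed
product. -/
structure IsCrossedRep (τ : TwistingPair A G) (r : G → A →L[ℂ] (K →L[ℂ] K)) : Prop where
  one : r 1 1 = 1
  mul : ∀ x y a b, r x a * r y b = r (x * y) (a * τ.ρ x b * τ.σ x y)
  star : ∀ x a, star (r x a) = r x⁻¹ (star (τ.σ x⁻¹ x : A) * τ.ρ x⁻¹ (star a))

variable {τ : TwistingPair A G} {𝒜 : StarSubalgebra ℂ A} {r : G → A →L[ℂ] (K →L[ℂ] K)}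

/-- The image of `C_c(G, 𝒜)` as a star subalgebra. -/
def IsCrossedRep.subalgebra (hr : IsCrossedRep τ r) (h𝒜 : τ.IsSmooth 𝒜) :
    StarSubalgebra ℂ (K →L[ℂ] K) :=
  have single_mem : ∀ x, ∀ a ∈ 𝒜, r x a ∈ (finSuppSubmodule G 𝒜).map (crossedSum r) :=
    fun x a ha => ⟨_, single_mem_finSupp x ha, crossedSum_single r x a⟩
  { carrier := (finSuppSubmodule G 𝒜).map (crossedSum r)
    mul_mem' := by
      rintro _ _ ⟨f, hf, rfl⟩ ⟨g, hg, rfl⟩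
      rw [crossedSum_apply, crossedSum_apply, Finsupp.sum, Finsupp.sum, Finset.sum_mul_sum]
      refine Submodule.sum_mem _ fun x _ => Submodule.sum_mem _ fun y _ => ?_
      rw [hr.mul]
      exact single_mem _ _ (𝒜.mul_mem (𝒜.mul_mem (hf x) (h𝒜.ρ_mem x _ (hg y))) (h𝒜.σ_mem x y))
    add_mem' := Submodule.add_mem _
    algebraMap_mem' := by
      intro c
      rw [Algebra.algebraMap_eq_smul_one, ← hr.one]
      exact Submodule.smul_mem _ _ (single_mem _ _ 𝒜.one_mem)
    star_mem' := by
      rintro _ ⟨f, hf, rfl⟩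
      rw [crossedSum_apply, Finsupp.sum, star_sum]
      refine Submodule.sum_mem _ fun x _ => ?_
      rw [hr.star]
      exact single_mem _ _ (𝒜.mul_mem (𝒜.star_mem' (h𝒜.σ_mem _ _))
        (h𝒜.ρ_mem _ _ (𝒜.star_mem' (hf x)))) }

/-- Each map `r x` is continuous, so coefficients in `A` can be approximated by coefficients in the
dense algebra `𝒜`; the supports are finite, so nothing more is needed. -/
lemma IsCrossedRep.cstarImage_le (hr : IsCrossedRep τ r) (h𝒜 : τ.IsSmooth 𝒜)
    (hd : Dense (𝒜 : Set A)) :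
    cstarImage (crossedSum r) ≤ (hr.subalgebra h𝒜).topologicalClosure := by
  refine StarSubalgebra.topologicalClosure_minimal (StarAlgebra.adjoin_le ?_)
    (StarSubalgebra.isClosed_topologicalClosure _)
  rintro _ ⟨f, rfl⟩
  rw [crossedSum_apply]
  refine sum_mem fun x _ => ?_
  have h : f x ∈ closure (𝒜 : Set A) := hd (f x)
  refine map_mem_closure (r x).continuous h fun a ha => ?_
  exact ⟨_, single_mem_finSupp x ha, crossedSum_single r x a⟩

lemma IsCrossedRep.exists_starSubalgebra (hr : IsCrossedRep τ r) (h𝒜 : τ.IsSmooth 𝒜) :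
    ∃ S : StarSubalgebra ℂ (cstarImage (crossedSum r)),
      (S : Set (cstarImage (crossedSum r))) = toImage (crossedSum r) '' finSupp G 𝒜 := by
  refine ⟨(hr.subalgebra h𝒜).comap (cstarImage (crossedSum r)).subtype, ?_⟩
  ext T
  constructor
  · rintro ⟨f, hf, h⟩
    exact ⟨f, hf, Subtype.ext h⟩
  · rintro ⟨f, hf, rfl⟩
    exact ⟨f, hf, rfl⟩

lemma IsCrossedRep.dense (hr : IsCrossedRep τ r) (h𝒜 : τ.IsSmooth 𝒜)
    (hd : Dense (𝒜 : Set A)) : Dense (toImage (crossedSum r) '' finSupp G 𝒜) := by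
  intro T
  rw [closure_subtype]
  have h : (T : K →L[ℂ] K) ∈ closure (crossedSum r '' finSupp G 𝒜) :=
    hr.cstarImage_le h𝒜 hd T.2
  rw [Set.image_image]
  exact h

end CrossedRep

/-! ### The covariant representation as a crossed representation. -/

section Integrated

variable {A : Type*} [CStarAlgebra A] {G : Type*}
  {H : Type*} [NormedAddCommGroup H] [InnerProductSpace ℂ H] [CompleteSpace H]
  {π : A →⋆ₐ[ℂ] (H →L[ℂ] H)} {U : G → unitary (H →L[ℂ] H)}

lemma continuous_rep (π : A →⋆ₐ[ℂ] (H →L[ℂ] H)) : Continuous π :=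
  AddMonoidHomClass.continuous_of_bound π 1 fun a => by
    simpa using NonUnitalStarAlgHom.norm_apply_le π a

/-- The operators `π(a) Uₓ`, as a family of linear maps. -/
def covariantMap (π : A →⋆ₐ[ℂ] (H →L[ℂ] H)) (U : G → unitary (H →L[ℂ] H)) (x : G) :
    A →L[ℂ] (H →L[ℂ] H) where
  toFun a := π a * U x
  map_add' a b := by rw [map_add, add_mul]
  map_smul' c a := by rw [map_smul, smul_mul_assoc, RingHom.id_apply]
  cont := (continuous_rep π).mul continuous_const

lemma covariantMap_apply (x : G) (a : A) : covariantMap π U x a = π a * U x := rfl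

variable [Group G] {τ : TwistingPair A G}

lemma IsCovariantRep.unitary_one (h : IsCovariantRep τ π U) : (U 1 : H →L[ℂ] H) = 1 := by
  have h1 := h.mul 1 1
  rw [τ.σ_one_left, OneMemClass.coe_one, map_one, one_mul, mul_one] at h1
  calc (U 1 : H →L[ℂ] H) = star (U 1 : H →L[ℂ] H) * (U 1 * U 1) := by
        rw [← mul_assoc, Unitary.coe_star_mul_self, one_mul]
    _ = 1 := by rw [h1, Unitary.coe_star_mul_self]

lemma IsCovariantRep.mul_apply (h : IsCovariantRep τ π U) (x : G) (a : A) :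
    (U x : H →L[ℂ] H) * π a = π (τ.ρ x a) * U x := by
  rw [h.covariant, mul_assoc, Unitary.coe_star_mul_self, mul_one]

/-- `U_{x⁻¹}` inverts `U_x` only up to the cocycle: `U_{x⁻¹} U_x = π(σ_{x⁻¹,x})`. -/
lemma IsCovariantRep.star_unitary (h : IsCovariantRep τ π U) (x : G) :
    star (U x : H →L[ℂ] H) = π (star (τ.σ x⁻¹ x : A)) * U x⁻¹ := by
  have h1 := h.mul x⁻¹ x
  rw [inv_mul_cancel, h.unitary_one, mul_one] at h1
  have h2 : (U x⁻¹ : H →L[ℂ] H) = π (τ.σ x⁻¹ x) * star (U x : H →L[ℂ] H) := by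
    rw [← h1, mul_assoc, Unitary.mul_star_self_of_mem (U x).2, mul_one]
  rw [h2, ← mul_assoc, ← map_mul, Unitary.coe_star_mul_self, map_one, one_mul]

lemma IsCovariantRep.isCrossedRep (h : IsCovariantRep τ π U) :
    IsCrossedRep τ (covariantMap π U) where
  one := by rw [covariantMap_apply, map_one, h.unitary_one, one_mul]
  mul x y a b := by
    simp only [covariantMap_apply]
    rw [mul_assoc, ← mul_assoc _ (π b), h.mul_apply, map_mul, map_mul, mul_assoc, mul_assoc, h.mul,
      mul_assoc]
  star x a := by
    simp only [covariantMap_apply]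
    rw [star_mul, h.star_unitary, ← map_star, mul_assoc, h.mul_apply, map_mul, mul_assoc]

end Integrated

/-! ### Compatibility of tensor products and doubling with the star-algebra structure. -/

section TensorOp

variable {H K : Type*} [NormedAddCommGroup H] [InnerProductSpace ℂ H]
  [NormedAddCommGroup K] [InnerProductSpace ℂ K]

lemma tensorOp_mul (S S' : H →L[ℂ] H) (T T' : K →L[ℂ] K) :
    tensorOp S T * tensorOp S' T' = tensorOp (S * S') (T * T') :=
  ext_htmul fun x y => by
    simp only [mul_apply_eq_comp, tensorOp_htmul]

lemma tensorOp_one : tensorOp (1 : H →L[ℂ] H) (1 : K →L[ℂ] K) = 1 :=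
  ext_htmul fun x y => by
    simp only [one_apply_eq_self, tensorOp_htmul]

lemma star_tensorOp [CompleteSpace H] [CompleteSpace K] (S : H →L[ℂ] H) (T : K →L[ℂ] K) :
    star (tensorOp S T) = tensorOp (star S) (star T) := by
  refine ext_htmul fun x y => ?_
  refine ext_inner_right ℂ fun z => ?_
  rw [ContinuousLinearMap.star_eq_adjoint, ContinuousLinearMap.adjoint_inner_left]
  have h : innerSL ℂ (htmul x y) ∘L tensorOp S T =
      innerSL ℂ (tensorOp (star S) (star T) (htmul x y)) := by
    refine ext_htmul fun x' y' => ?_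
    change inner ℂ (htmul x y) (tensorOp S T (htmul x' y')) =
      inner ℂ (tensorOp (star S) (star T) (htmul x y)) (htmul x' y')
    rw [tensorOp_htmul, tensorOp_htmul, inner_htmul, inner_htmul,
      ContinuousLinearMap.star_eq_adjoint, ContinuousLinearMap.star_eq_adjoint,
      ContinuousLinearMap.adjoint_inner_left, ContinuousLinearMap.adjoint_inner_left]
  exact DFunLike.congr_fun h z

/-- `T ↦ T ⊕ T` as a homomorphism of star algebras. -/
def doubleHom (E : Type*) [NormedAddCommGroup E] [InnerProductSpace ℂ E] [CompleteSpace E] :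
    (E →L[ℂ] E) →⋆ₐ[ℂ] (Double E →L[ℂ] Double E) where
  toFun := doubleOp
  map_one' := rfl
  map_mul' _ _ := rfl
  map_zero' := rfl
  map_add' _ _ := rfl
  commutes' _ := rfl
  map_star' T := by
    rw [ContinuousLinearMap.star_eq_adjoint, ContinuousLinearMap.star_eq_adjoint,
      ContinuousLinearMap.eq_adjoint_iff]
    intro z w
    rw [inner_double, inner_double, doubleOp_apply]
    change inner ℂ (ContinuousLinearMap.adjoint T z.fst) w.fst +
      inner ℂ (ContinuousLinearMap.adjoint T z.snd) w.snd =
        inner ℂ z.fst (T w.fst) + inner ℂ z.snd (T w.snd)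
    rw [ContinuousLinearMap.adjoint_inner_left, ContinuousLinearMap.adjoint_inner_left]

end TensorOp

/-! ### Weighted translations on elementary vectors. -/

section Shift

variable {G : Type*} {E : Type*} [NormedAddCommGroup E] [InnerProductSpace ℂ E]

lemma ext_single [DecidableEq G] {F : Type*} [NormedAddCommGroup F] [NormedSpace ℂ F]
    {S T : lp (fun _ : G => E) 2 →L[ℂ] F}
    (h : ∀ y ξ, S (lp.single 2 y ξ) = T (lp.single 2 y ξ)) : S = T :=
  lp.ext_continuousLinearMap ENNReal.ofNat_ne_top fun y => ContinuousLinearMap.ext fun ξ => h y ξ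

lemma ext_inner_single [DecidableEq G] {f g : lp (fun _ : G => E) 2}
    (h : ∀ y ξ, inner ℂ (lp.single 2 y ξ : lp (fun _ : G => E) 2) f =
      inner ℂ (lp.single 2 y ξ : lp (fun _ : G => E) 2) g) : f = g := by
  ext y
  refine ext_inner_left ℂ fun ξ => ?_
  simpa only [lp.inner_single_left] using h y ξ

lemma inner_single_single [DecidableEq G] (y z : G) (ξ η : E) :
    inner ℂ (lp.single 2 y ξ : lp (fun _ : G => E) 2) (lp.single 2 z η) =
      if y = z then inner ℂ ξ η else 0 := by
  rw [lp.inner_single_left]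
  split_ifs with h
  · subst h
    rw [lp.single_apply_self]
  · rw [lp.single_apply_ne _ _ _ h, inner_zero_right]

lemma norm_weightedShift_le [Nonempty G] (w : G → E →L[ℂ] E) (C : ℝ)
    (hw : ∀ z, ‖w z‖ ≤ C) (e : G ≃ G) : ‖weightedShift w C hw e‖ ≤ C := by
  unfold weightedShift
  exact LinearMap.mkContinuous_norm_le _ ((norm_nonneg _).trans (hw (Classical.arbitrary G))) _

lemma weightedShift_single [Group G] [DecidableEq G] (w : G → E →L[ℂ] E) (C : ℝ)
    (hw : ∀ z, ‖w z‖ ≤ C) (x y : G) (ξ : E) :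
    weightedShift w C hw (Equiv.mulLeft x⁻¹) (lp.single 2 y ξ) =
      lp.single 2 (x * y) (w (x * y) ξ) := by
  ext z
  change w z ((lp.single 2 y ξ : lp (fun _ : G => E) 2) (x⁻¹ * z)) = _
  by_cases h : z = x * y
  · subst h
    rw [lp.single_apply_self, inv_mul_cancel_left, lp.single_apply_self]
  · rw [lp.single_apply_ne _ _ _ h, lp.single_apply_ne, map_zero]
    rw [ne_eq, inv_mul_eq_iff_eq_mul]
    exact h

lemma leftReg_single [Group G] [DecidableEq G] (g y : G) (v : E) :
    leftReg E g (lp.single 2 y v) = lp.single 2 (g * y) v :=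
  weightedShift_single _ _ _ _ _ _

lemma leftReg_mul [Group G] (g h : G) : leftReg E g * leftReg E h = leftReg E (g * h) := by
  classical
  refine ext_single fun y v => ?_
  rw [mul_apply_eq_comp, leftReg_single, leftReg_single, leftReg_single, mul_assoc]

lemma leftReg_one [Group G] : leftReg E (1 : G) = 1 := by
  classical
  refine ext_single fun y v => ?_
  rw [leftReg_single, one_mul, one_apply_eq_self]

lemma star_leftReg [Group G] [CompleteSpace E] (g : G) :
    star (leftReg E g) = leftReg E g⁻¹ := by
  classical
  refine ext_single fun y v => ext_inner_single fun z w => ?_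
  rw [ContinuousLinearMap.star_eq_adjoint, ContinuousLinearMap.adjoint_inner_right,
    leftReg_single, leftReg_single, inner_single_single, inner_single_single]
  simp only [eq_inv_mul_iff_mul_eq]

end Shift

/-! ### Fell absorption and the extension to the reduced crossed product. -/

section Regular

variable {A : Type*} [CStarAlgebra A] {G : Type*} [Group G]
  {H : Type*} [NormedAddCommGroup H] [InnerProductSpace ℂ H] [CompleteSpace H]
  {τ : TwistingPair A G} {π : A →⋆ₐ[ℂ] (H →L[ℂ] H)} {U : G → unitary (H →L[ℂ] H)}

/-- The operators `Π(a δₓ)` of the regular representation, as a family of linear maps. -/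
def regularMap (τ : TwistingPair A G) (π : A →⋆ₐ[ℂ] (H →L[ℂ] H)) (x : G) :
    A →L[ℂ] (lp (fun _ : G => H) 2 →L[ℂ] lp (fun _ : G => H) 2) :=
  LinearMap.mkContinuous
    { toFun := fun a => weightedShift (fun z => π (τ.ρ z⁻¹ a * τ.σ z⁻¹ x)) ‖a‖
        (norm_regular_le τ π x a) (Equiv.mulLeft x⁻¹)
      map_add' := fun a b => by
        ext f z
        change π (τ.ρ z⁻¹ (a + b) * τ.σ z⁻¹ x) (f (x⁻¹ * z)) =
          π (τ.ρ z⁻¹ a * τ.σ z⁻¹ x) (f (x⁻¹ * z)) + π (τ.ρ z⁻¹ b * τ.σ z⁻¹ x) (f (x⁻¹ * z))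
        rw [map_add, add_mul, map_add, add_apply]
      map_smul' := fun c a => by
        ext f z
        change π (τ.ρ z⁻¹ (c • a) * τ.σ z⁻¹ x) (f (x⁻¹ * z)) =
          c • π (τ.ρ z⁻¹ a * τ.σ z⁻¹ x) (f (x⁻¹ * z))
        rw [map_smul, smul_mul_assoc, map_smul, smul_apply] }
    1 fun a => by
      rw [one_mul]
      exact norm_weightedShift_le _ _ (norm_regular_le τ π x a) _

lemma regularMap_single [DecidableEq G] (x : G) (a : A) (y : G) (ξ : H) :
    regularMap τ π x a (lp.single 2 y ξ) =
      lp.single 2 (x * y) (π (τ.ρ (x * y)⁻¹ a * τ.σ (x * y)⁻¹ x) ξ) :=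
  weightedShift_single _ _ (norm_regular_le τ π x a) _ _ _

variable {V : Type*} [NormedAddCommGroup V] [InnerProductSpace ℂ V]

/-- The map `ξ ↦ U_{y⁻¹}^* ξ ⊗ δ_y ⊗ v`. -/
def fiberMap [DecidableEq G] (U : G → unitary (H →L[ℂ] H)) (v : V) (y : G) :
    H →L[ℂ] HilbertTensor H (lp (fun _ : G => V) 2) :=
  (htmulL H (lp (fun _ : G => V) 2)).flip (lp.single 2 y v) ∘L star (U y⁻¹ : H →L[ℂ] H)

lemma fiberMap_apply [DecidableEq G] (v : V) (y : G) (ξ : H) :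
    fiberMap U v y ξ = htmul (star (U y⁻¹ : H →L[ℂ] H) ξ) (lp.single 2 y v) := rfl

lemma inner_fiberMap [DecidableEq G] (v w : V) (y z : G) (ξ η : H) :
    inner ℂ (fiberMap U v y ξ) (fiberMap U w z η) =
      if y = z then inner ℂ ξ η * inner ℂ v w else 0 := by
  rw [fiberMap_apply, fiberMap_apply, inner_htmul, inner_single_single]
  split_ifs with h
  · subst h
    rw [ContinuousLinearMap.star_eq_adjoint, ContinuousLinearMap.adjoint_inner_left,
      ← ContinuousLinearMap.star_eq_adjoint, ← mul_apply_eq_comp,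
      Unitary.mul_star_self_of_mem (U y⁻¹).2, one_apply_eq_self]
  · rw [mul_zero]

/-- The map `fiberMap` is isometric for a unit vector `v`. -/
def fiberIsometry [DecidableEq G] (U : G → unitary (H →L[ℂ] H)) {v : V} (hv : ‖v‖ = 1) (y : G) :
    H →ₗᵢ[ℂ] HilbertTensor H (lp (fun _ : G => V) 2) :=
  LinearMap.isometryOfInner (fiberMap U v y).toLinearMap fun ξ η => by
    refine (inner_fiberMap v v y y ξ η).trans ?_
    rw [if_pos rfl, inner_self_eq_norm_sq_to_K, hv]
    simp

lemma orthogonalFamily_fiberIsometry [DecidableEq G] (U : G → unitary (H →L[ℂ] H)) {v : V}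
    (hv : ‖v‖ = 1) : OrthogonalFamily ℂ (fun _ : G => H) (fiberIsometry U hv) := by
  intro y z hyz ξ η
  exact (inner_fiberMap v v y z ξ η).trans (if_neg hyz)

/-- The isometry `ξ ⊗ δ_y ↦ U_{y⁻¹}^* ξ ⊗ δ_y ⊗ v` of `ℓ²(G, H)` into `H ⊗ ℓ²(G) ⊗ V`. -/
def fell (U : G → unitary (H →L[ℂ] H)) {v : V} (hv : ‖v‖ = 1) :
    lp (fun _ : G => H) 2 →L[ℂ] HilbertTensor H (lp (fun _ : G => V) 2) :=
  open Classical in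
  (orthogonalFamily_fiberIsometry U hv).linearIsometry.toContinuousLinearMap

lemma fell_single [hG : DecidableEq G] {v : V} (hv : ‖v‖ = 1) (y : G) (ξ : H) :
    fell U hv (lp.single 2 y ξ) = fiberMap U v y ξ := by
  obtain rfl : hG = fun a b => Classical.propDecidable (a = b) := Subsingleton.elim _ _
  classical
  exact (orthogonalFamily_fiberIsometry U hv).linearIsometry_apply_single ξ

variable (V) in
/-- The operators `π(a) Uₓ ⊗ λₓ ⊗ 1`, as a family of linear maps. -/
def tensorMap (π : A →⋆ₐ[ℂ] (H →L[ℂ] H)) (U : G → unitary (H →L[ℂ] H)) (x : G) (a : A) :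
    HilbertTensor H (lp (fun _ : G => V) 2) →L[ℂ] HilbertTensor H (lp (fun _ : G => V) 2) :=
  tensorOp (π a * (U x : H →L[ℂ] H)) (leftReg V x)

/-- On `ξ ⊗ δ_y`, with `z = (x y)⁻¹`, covariance and the cocycle relation give `U_z^* π(ρ_z(a)
σ_{z,x}) = π(a) U_x U_{y⁻¹}^*`, because `z x = y⁻¹`: the twist by `U` untangles the regular
representation. -/
lemma tensorMap_comp_fell (h : IsCovariantRep τ π U) {v : V} (hv : ‖v‖ = 1) (x : G) (a : A) :
    tensorMap V π U x a ∘L fell U hv = fell U hv ∘L regularMap τ π x a := by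
  classical
  refine ext_single fun y ξ => ?_
  rw [ContinuousLinearMap.comp_apply, ContinuousLinearMap.comp_apply, regularMap_single,
    fell_single, fell_single, fiberMap_apply, fiberMap_apply, tensorMap, tensorOp_htmul, leftReg_single]
  congr 1
  have h1 := h.mul (x * y)⁻¹ x
  have hz : (x * y)⁻¹ * x = y⁻¹ := by group
  rw [hz] at h1
  have h2 : π (τ.σ (x * y)⁻¹ x) = U (x * y)⁻¹ * U x * star (U y⁻¹ : H →L[ℂ] H) := by
    rw [h1, mul_assoc, Unitary.mul_star_self_of_mem (U y⁻¹).2, mul_one]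
  have h3 : star (U (x * y)⁻¹ : H →L[ℂ] H) * π (τ.ρ (x * y)⁻¹ a * τ.σ (x * y)⁻¹ x) =
      π a * U x * star (U y⁻¹ : H →L[ℂ] H) := by
    rw [map_mul, h2, h.covariant]
    simp only [← mul_assoc]
    rw [Unitary.star_mul_self_of_mem (U (x * y)⁻¹).2, one_mul, mul_assoc (π a),
      Unitary.star_mul_self_of_mem (U (x * y)⁻¹).2, mul_one]
  rw [← mul_apply_eq_comp, ← mul_apply_eq_comp, h3]

/-- For orthonormal `v` and `w` the ranges are orthogonal; this orthogonality makes `fellHom`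
multiplicative. -/
lemma adjoint_fell_comp_fell {v w : V} (hv : ‖v‖ = 1) (hw : ‖w‖ = 1) :
    ContinuousLinearMap.adjoint (fell U hv) ∘L fell U hw =
      (inner ℂ v w : ℂ) • ContinuousLinearMap.id ℂ (lp (fun _ : G => H) 2) := by
  classical
  refine ext_single fun y ξ => ext_inner_single fun z η => ?_
  rw [ContinuousLinearMap.comp_apply, ContinuousLinearMap.adjoint_inner_right, fell_single,
    fell_single, inner_fiberMap, smul_apply, inner_smul_right, ContinuousLinearMap.id_apply,
    inner_single_single]
  split_ifs
  · rw [mul_comm]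
  · rw [mul_zero]

lemma adjoint_fell_comp_fell_self {v : V} (hv : ‖v‖ = 1) :
    ContinuousLinearMap.adjoint (fell U hv) ∘L fell U hv =
      ContinuousLinearMap.id ℂ (lp (fun _ : G => H) 2) := by
  rw [adjoint_fell_comp_fell, inner_self_eq_norm_sq_to_K, hv]
  simp

lemma adjoint_fell_htmul [DecidableEq G] [CompleteSpace V] {v : V} (hv : ‖v‖ = 1) (x : H) (y : G)
    (w : V) : ContinuousLinearMap.adjoint (fell U hv) (htmul x (lp.single 2 y w)) =
      (inner ℂ v w : ℂ) • lp.single 2 y ((U y⁻¹ : H →L[ℂ] H) x) := by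
  refine ext_inner_single fun z η => ?_
  rw [ContinuousLinearMap.adjoint_inner_right, fell_single, fiberMap_apply, inner_htmul,
    inner_single_single, inner_smul_right, inner_single_single]
  split_ifs with h
  · subst h
    rw [ContinuousLinearMap.star_eq_adjoint, ContinuousLinearMap.adjoint_inner_left, mul_comm]
  · rw [mul_zero, mul_zero]

/-- The regular representation satisfies the relations of the crossed product, because it is
contained in `x, a ↦ π(a) Uₓ ⊗ λₓ`. -/
lemma IsCovariantRep.isCrossedRep_regularMap (h : IsCovariantRep τ π U) :
    IsCrossedRep τ (regularMap τ π) := by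
  -- One isometry suffices to transport relations back, so the auxiliary space is `ℂ`. Left
  -- cancellation by `J` gives the unit and product relations, and `J^* J = 1` gives the adjoint.
  have hv : ‖(1 : ℂ)‖ = 1 := norm_one
  set J := fell U hv with hJ
  have hc := h.isCrossedRep
  have hJJ : ContinuousLinearMap.adjoint J ∘L J = ContinuousLinearMap.id ℂ _ :=
    adjoint_fell_comp_fell_self hv
  have hE : ∀ x a, tensorMap ℂ π U x a ∘L J = J ∘L regularMap τ π x a :=
    fun x a => tensorMap_comp_fell h hv x a
  have hinj : ∀ {S T : lp (fun _ : G => H) 2 →L[ℂ] lp (fun _ : G => H) 2},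
      J ∘L S = J ∘L T → S = T := by
    intro S T hST
    have := congrArg (fun X => ContinuousLinearMap.adjoint J ∘L X) hST
    simpa only [← ContinuousLinearMap.comp_assoc, hJJ, ContinuousLinearMap.id_comp] using this
  constructor
  · refine hinj ?_
    rw [← hE, tensorMap, leftReg_one]
    have := hc.one
    rw [covariantMap_apply] at this
    rw [this, tensorOp_one]
    rfl
  · intro x y a b
    refine hinj ?_
    rw [← hE, tensorMap, ← leftReg_mul, ← covariantMap_apply, ← hc.mul, ← tensorOp_mul]
    change J ∘L (regularMap τ π x a ∘L regularMap τ π y b) =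
      (tensorMap ℂ π U x a ∘L tensorMap ℂ π U y b) ∘L J
    rw [ContinuousLinearMap.comp_assoc, hE, ← ContinuousLinearMap.comp_assoc,
      ← ContinuousLinearMap.comp_assoc, hE]
  · intro x a
    have h1 : regularMap τ π x a = ContinuousLinearMap.adjoint J ∘L tensorMap ℂ π U x a ∘L J := by
      rw [hE, ← ContinuousLinearMap.comp_assoc, hJJ, ContinuousLinearMap.id_comp]
    have h2 : ContinuousLinearMap.adjoint (tensorMap ℂ π U x a) =
        tensorMap ℂ π U x⁻¹ (star (τ.σ x⁻¹ x : A) * τ.ρ x⁻¹ (star a)) := by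
      rw [tensorMap, tensorMap, ← ContinuousLinearMap.star_eq_adjoint, star_tensorOp, star_leftReg,
        ← covariantMap_apply, ← covariantMap_apply, hc.star]
    rw [ContinuousLinearMap.star_eq_adjoint, h1, ContinuousLinearMap.adjoint_comp,
      ContinuousLinearMap.adjoint_comp, ContinuousLinearMap.adjoint_adjoint, h2,
      ContinuousLinearMap.comp_assoc, hE, ← ContinuousLinearMap.comp_assoc, hJJ,
      ContinuousLinearMap.id_comp]

/-- On `x ⊗ δ_y ⊗ w` the twists by `U_{y⁻¹}` cancel, and what remains is the expansion of `w` in the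
basis of `V`. This makes `fellHom` unital. -/
lemma sum_fell_comp_adjoint_fell [CompleteSpace V] {n : ℕ} (v : OrthonormalBasis (Fin n) ℂ V) :
    ∑ k, fell U (v.norm_eq_one k) ∘L ContinuousLinearMap.adjoint (fell U (v.norm_eq_one k)) =
      ContinuousLinearMap.id ℂ (HilbertTensor H (lp (fun _ : G => V) 2)) := by
  classical
  refine ext_htmul fun x f => ?_
  suffices hx : (∑ k, fell U (v.norm_eq_one k) ∘L
      ContinuousLinearMap.adjoint (fell U (v.norm_eq_one k))) ∘L htmulL H _ x = htmulL H _ x from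
    DFunLike.congr_fun hx f
  refine ext_single fun y w => ?_
  rw [ContinuousLinearMap.comp_apply, htmulL_apply, sum_apply]
  have hk : ∀ k, (fell U (v.norm_eq_one k) ∘L
      ContinuousLinearMap.adjoint (fell U (v.norm_eq_one k))) (htmul x (lp.single 2 y w)) =
      htmulL H (lp (fun _ : G => V) 2) x
        (lp.singleContinuousLinearMap ℂ (fun _ : G => V) 2 y ((inner ℂ (v k) w : ℂ) • v k)) := by
    intro k
    rw [ContinuousLinearMap.comp_apply, adjoint_fell_htmul, map_smul, fell_single, fiberMap_apply,
      ← mul_apply_eq_comp, Unitary.star_mul_self_of_mem (U y⁻¹).2, one_apply_eq_self, map_smul,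
      map_smul]
    rfl
  rw [Finset.sum_congr rfl fun k _ => hk k, ← map_sum, ← map_sum, v.sum_repr']
  rfl

/-- The homomorphism `T ↦ ∑ₖ Jₖ T Jₖ^*` given by the isometries `Jₖ` of an orthonormal basis. -/
def fellHom [CompleteSpace V] {n : ℕ} (U : G → unitary (H →L[ℂ] H))
    (v : OrthonormalBasis (Fin n) ℂ V) :
    (lp (fun _ : G => H) 2 →L[ℂ] lp (fun _ : G => H) 2) →⋆ₐ[ℂ]
      (HilbertTensor H (lp (fun _ : G => V) 2) →L[ℂ] HilbertTensor H (lp (fun _ : G => V) 2)) :=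
  StarAlgHom.mk
    (AlgHom.ofLinearMap
      { toFun := fun T => ∑ k, fell U (v.norm_eq_one k) ∘L T ∘L
          ContinuousLinearMap.adjoint (fell U (v.norm_eq_one k))
        map_add' := fun S T => by
          simp only [ContinuousLinearMap.add_comp, ContinuousLinearMap.comp_add,
            Finset.sum_add_distrib]
        map_smul' := fun c T => by
          simp only [ContinuousLinearMap.smul_comp, ContinuousLinearMap.comp_smul,
            Finset.smul_sum, RingHom.id_apply] }
      (sum_fell_comp_adjoint_fell v)
      (fun S T => by
        change (∑ k, fell U (v.norm_eq_one k) ∘L (S ∘L T) ∘L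
            ContinuousLinearMap.adjoint (fell U (v.norm_eq_one k))) =
          (∑ k, fell U (v.norm_eq_one k) ∘L S ∘L
            ContinuousLinearMap.adjoint (fell U (v.norm_eq_one k))) *
          (∑ k, fell U (v.norm_eq_one k) ∘L T ∘L
            ContinuousLinearMap.adjoint (fell U (v.norm_eq_one k)))
        rw [Finset.sum_mul_sum]
        refine Finset.sum_congr rfl fun k _ => ?_
        rw [Finset.sum_eq_single k]
        · ext z
          have h := adjoint_fell_comp_fell_self (U := U) (v.norm_eq_one k)
          have h' := DFunLike.congr_fun h
            (T (ContinuousLinearMap.adjoint (fell U (v.norm_eq_one k)) z))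
          exact congrArg (fun t => fell U (v.norm_eq_one k) (S t)) h'.symm
        · intro l _ hl
          ext z
          have h := adjoint_fell_comp_fell (U := U) (v.norm_eq_one k) (v.norm_eq_one l)
          rw [orthonormal_iff_ite.1 v.orthonormal k l, if_neg hl.symm, zero_smul] at h
          have h' := DFunLike.congr_fun h
            (T (ContinuousLinearMap.adjoint (fell U (v.norm_eq_one l)) z))
          refine (congrArg (fun t => fell U (v.norm_eq_one k) (S t)) h').trans ?_
          rw [zero_apply, map_zero, map_zero, zero_apply]
        · exact fun h => absurd (Finset.mem_univ k) h))
    (fun T => by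
      change (∑ k, fell U (v.norm_eq_one k) ∘L star T ∘L
          ContinuousLinearMap.adjoint (fell U (v.norm_eq_one k))) =
        star (∑ k, fell U (v.norm_eq_one k) ∘L T ∘L
          ContinuousLinearMap.adjoint (fell U (v.norm_eq_one k)))
      rw [star_sum]
      refine Finset.sum_congr rfl fun k _ => ?_
      rw [ContinuousLinearMap.star_eq_adjoint, ContinuousLinearMap.star_eq_adjoint,
        ContinuousLinearMap.adjoint_comp, ContinuousLinearMap.adjoint_comp,
        ContinuousLinearMap.adjoint_adjoint, ContinuousLinearMap.comp_assoc])

/-- The intertwining relation moves `tensorMap` out of the sum, leaving the sum of range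
projections, which is the identity. -/
lemma fellHom_regularMap [CompleteSpace V] (h : IsCovariantRep τ π U) {n : ℕ}
    (v : OrthonormalBasis (Fin n) ℂ V) (x : G) (a : A) :
    fellHom U v (regularMap τ π x a) = tensorMap V π U x a := by
  change (∑ k, fell U (v.norm_eq_one k) ∘L regularMap τ π x a ∘L
    ContinuousLinearMap.adjoint (fell U (v.norm_eq_one k))) = _
  have hk : ∀ k, fell U (v.norm_eq_one k) ∘L regularMap τ π x a ∘L
      ContinuousLinearMap.adjoint (fell U (v.norm_eq_one k)) = tensorMap V π U x a *
        (fell U (v.norm_eq_one k) ∘L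
          ContinuousLinearMap.adjoint (fell U (v.norm_eq_one k))) := by
    intro k
    rw [← ContinuousLinearMap.comp_assoc, ← tensorMap_comp_fell h, ContinuousLinearMap.comp_assoc]
    rfl
  rw [Finset.sum_congr rfl fun k _ => hk k, ← Finset.mul_sum, sum_fell_comp_adjoint_fell]
  exact mul_one _

/-- The representation of the equivariant construction extends to the reduced crossed product. -/
def equivariantHom [CompleteSpace V] {n : ℕ} (τ : TwistingPair A G) (π : A →⋆ₐ[ℂ] (H →L[ℂ] H))
    (U : G → unitary (H →L[ℂ] H)) (v : OrthonormalBasis (Fin n) ℂ V) :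
    reducedCrossedProduct τ π →⋆ₐ[ℂ] (EquivariantSpace H G V →L[ℂ] EquivariantSpace H G V) :=
  ((doubleHom _).comp (fellHom U v)).comp (reducedCrossedProduct τ π).subtype

lemma equivariantHom_toImage [CompleteSpace V] (h : IsCovariantRep τ π U) {n : ℕ}
    (v : OrthonormalBasis (Fin n) ℂ V) (f : G →₀ A) :
    equivariantHom τ π U v (toImage (regularRep τ π) f) = equivariantRep V π U f := by
  change doubleHom _ (fellHom U v (f.sum fun x a => regularMap τ π x a)) = _
  rw [Finsupp.sum, map_sum, map_sum]
  refine Finset.sum_congr rfl fun x _ => ?_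
  rw [fellHom_regularMap h]
  rfl

end Regular

/-! ### The three assertions for an equivariant triple. -/

section Consequences

variable {A : Type*} [CStarAlgebra A] {G : Type*}
  {H : Type*} [NormedAddCommGroup H] [InnerProductSpace ℂ H] [CompleteSpace H]
  {𝒜 : StarSubalgebra ℂ A} {π : A →⋆ₐ[ℂ] (H →L[ℂ] H)} {D : H →ₗ.[ℂ] H}
  {U : G → unitary (H →L[ℂ] H)}

lemma isRegularOp_covariant (hreg : IsRegular (integratedForm π U '' finSupp G 𝒜) D) (g : G)
    {a : A} (ha : a ∈ 𝒜) : IsRegularOp D (π a * U g) :=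
  hreg _ ⟨_, single_mem_finSupp g ha, crossedSum_single (covariantMap π U) g a⟩

variable [Group G] {τ : TwistingPair A G}

lemma isRegularOp_leftReg {V : Type*} [NormedAddCommGroup V] [InnerProductSpace ℂ V]
    [CompleteSpace V] {M : lp (fun _ : G => V) 2 →ₗ.[ℂ] lp (fun _ : G => V) 2}
    (hreg : IsRegular (groupAlgebraOps G V) M) (g : G) : IsRegularOp M (leftReg V g) :=
  hreg _ ⟨Finsupp.single g 1, by simp⟩

/-- The equivariant construction of regular triples is a regular triple. -/
lemma IsEquivariantTriple.isSpectralTriple_equivariantDirac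
    (h : IsEquivariantTriple τ 𝒜 π D U) {V : Type*} [NormedAddCommGroup V] [InnerProductSpace ℂ V]
    [FiniteDimensional ℂ V] [CompleteSpace V] {ℓ : G → V →L[ℂ] V}
    (hℓ : IsProperTranslationBounded ℓ)
    (hreg : IsRegular (integratedForm π U '' finSupp G 𝒜) D)
    (hreg' : IsRegular (groupAlgebraOps G V) (mulLength ℓ))
    (Φ : reducedCrossedProduct τ π →⋆ₐ[ℂ] (EquivariantSpace H G V →L[ℂ] EquivariantSpace H G V))
    (hΦ : ∀ f : G →₀ A, Φ (toImage (regularRep τ π) f) = equivariantRep V π U f) :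
    IsSpectralTriple (toImage (regularRep τ π) '' finSupp G 𝒜) Φ (equivariantDirac D ℓ) ∧
      IsRegular (Φ '' (toImage (regularRep τ π) '' finSupp G 𝒜)) (equivariantDirac D ℓ) := by
  obtain ⟨ι, b, d, hD⟩ :=
    exists_isDiag h.isSpectralTriple.selfAdjoint h.isSpectralTriple.compactResolvent
  obtain ⟨c, e, hM, he⟩ := exists_isDiag_mulLength hℓ
  have hd := hD.finite_of_hasCompactResolvent h.isSpectralTriple.compactResolvent
  have hregΦ : ∀ f ∈ finSupp G 𝒜,
      IsRegularOp (equivariantDirac D ℓ) (Φ (toImage (regularRep τ π) f)) := by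
    intro f hf
    rw [hΦ]
    -- Each summand is two copies of a tensor product of `π(a) U_g`, regular for `D`, with `λ_g`,
    -- regular for `M_ℓ`.
    exact IsRegularOp.sum fun g _ => IsRegularOp.doubleOp_tensorOp hD hM
      (isRegularOp_covariant hreg g (hf g)) (isRegularOp_leftReg hreg' g)
  have hr := h.isCovariantRep.isCrossedRep_regularMap
  have hsa := isSelfAdjoint_productDirac hD hM
  refine ⟨⟨hr.exists_starSubalgebra h.isSmooth, hr.dense h.isSmooth h.isSpectralTriple.dense,
    hsa.dense_domain, hsa, hasCompactResolvent_productDirac hD hM hd he, ?_⟩, ?_⟩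
  · rintro _ ⟨f, hf, rfl⟩
    obtain ⟨-, C, hC, -⟩ := hregΦ f hf
    exact ⟨C, hC⟩
  · rintro _ ⟨_, ⟨f, hf, rfl⟩, rfl⟩
    exact hregΦ f hf

lemma IsEquivariantTriple.isRegular_integratedForm (h : IsEquivariantTriple τ 𝒜 π D U)
    (hreg : IsRegular (π '' (𝒜 : Set A)) D)
    (hU : ∀ g, IsLaplaceCompatible D (U g : H →L[ℂ] H)) :
    IsRegular (integratedForm π U '' finSupp G 𝒜) D := by
  rintro _ ⟨f, hf, rfl⟩
  exact IsRegularOp.sum fun g _ => IsRegularOp.mul (hreg _ ⟨_, hf g, rfl⟩)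
    ((IsRegularOp.iff_isLaplaceCompatible h.isSpectralTriple.selfAdjoint
      h.isSpectralTriple.compactResolvent (h.boundedCommutator g)).2 (hU g))

lemma IsEquivariantTriple.isSpectralTriple_integratedForm (h : IsEquivariantTriple τ 𝒜 π D U)
    (hreg : IsRegular (integratedForm π U '' finSupp G 𝒜) D) :
    IsSpectralTriple (toImage (integratedForm π U) '' finSupp G 𝒜)
      (cstarImage (integratedForm π U)).subtype D := by
  have hr := h.isCovariantRep.isCrossedRep
  have ht := h.isSpectralTriple
  refine ⟨hr.exists_starSubalgebra h.isSmooth, hr.dense h.isSmooth ht.dense, ht.denseDomain,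
    ht.selfAdjoint, ht.compactResolvent, ?_⟩
  rintro _ ⟨f, hf, rfl⟩
  obtain ⟨-, C, hC, -⟩ := hreg _ ⟨f, hf, rfl⟩
  exact ⟨C, hC⟩

/-- Functions supported at one point suffice: `a δ_e` acts as `π(a)`, since `U_e = 1`, and `1 δ_g`
acts as `U_g`. -/
lemma IsEquivariantTriple.isRegular_of_integratedForm (h : IsEquivariantTriple τ 𝒜 π D U)
    (hreg : IsRegular (integratedForm π U '' finSupp G 𝒜) D) :
    IsRegular (π '' (𝒜 : Set A)) D ∧ ∀ g, IsLaplaceCompatible D (U g : H →L[ℂ] H) := by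
  constructor
  · rintro _ ⟨a, ha, rfl⟩
    have := isRegularOp_covariant hreg 1 ha
    rwa [h.isCovariantRep.unitary_one, mul_one] at this
  · intro g
    have := isRegularOp_covariant hreg g 𝒜.one_mem
    rw [map_one, one_mul] at this
    exact (IsRegularOp.iff_isLaplaceCompatible h.isSpectralTriple.selfAdjoint
      h.isSpectralTriple.compactResolvent (h.boundedCommutator g)).1 this

end Consequences

end TwistedTriple

end

open TwistedTriple in
theorem theorem4p3 {A : Type*} [CStarAlgebra A] {G : Type*} [Group G]
    {H : Type*} [NormedAddCommGroup H] [InnerProductSpace ℂ H] [CompleteSpace H]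
    {V : Type*} [NormedAddCommGroup V] [InnerProductSpace ℂ V] [FiniteDimensional ℂ V]
    [CompleteSpace V]
    (τ : TwistingPair A G) (𝒜 : StarSubalgebra ℂ A)
    (π : A →⋆ₐ[ℂ] (H →L[ℂ] H)) (hπ : Function.Injective π)
    (D : H →ₗ.[ℂ] H) (U : G → unitary (H →L[ℂ] H))
    (hequiv : IsEquivariantTriple τ 𝒜 π D U)
    (ℓ : G → V →L[ℂ] V) (hℓ : IsProperTranslationBounded ℓ) :
    -- (1)
    (IsRegular (integratedForm π U '' finSupp G 𝒜) D →
      IsRegular (groupAlgebraOps G V) (mulLength ℓ) →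
      ∃ Φ : reducedCrossedProduct τ π →⋆ₐ[ℂ]
          (EquivariantSpace H G V →L[ℂ] EquivariantSpace H G V),
        (∀ f : G →₀ A, Φ (toImage (regularRep τ π) f) = equivariantRep V π U f) ∧
        IsSpectralTriple (toImage (regularRep τ π) '' finSupp G 𝒜) Φ (equivariantDirac D ℓ) ∧
        IsRegular (Φ '' (toImage (regularRep τ π) '' finSupp G 𝒜)) (equivariantDirac D ℓ)) ∧
    -- (2)
    (IsRegular (π '' (𝒜 : Set A)) D →
      (∀ g, IsLaplaceCompatible D (U g : H →L[ℂ] H)) →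
      IsSpectralTriple (toImage (integratedForm π U) '' finSupp G 𝒜)
        (cstarImage (integratedForm π U)).subtype D ∧
      IsRegular (integratedForm π U '' finSupp G 𝒜) D) ∧
    -- (3)
    (IsRegular (integratedForm π U '' finSupp G 𝒜) D →
      IsRegular (π '' (𝒜 : Set A)) D ∧
      ∀ g, IsLaplaceCompatible D (U g : H →L[ℂ] H)) := by
  refine ⟨fun hreg hreg' => ?_, fun hreg hU => ?_, hequiv.isRegular_of_integratedForm⟩
  · have hΦ := equivariantHom_toImage hequiv.isCovariantRep (stdOrthonormalBasis ℂ V)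
    exact ⟨equivariantHom τ π U (stdOrthonormalBasis ℂ V), hΦ,
      hequiv.isSpectralTriple_equivariantDirac hℓ hreg hreg' _ hΦ⟩
  · have hreg' := hequiv.isRegular_integratedForm hreg hU
    exact ⟨hequiv.isSpectralTriple_integratedForm hreg', hreg'⟩
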